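/- Let $M,N$ be natural numbers, let $z_1,\dots,z_N$ be pairwise distinct complex numbers, and let $\boldsymbol n=(n_1,\dots,n_N)\in\mathbb Z_{\ge0}^N$, $\boldsymbol m=(m_1,\dots,m_M)\in\mathbb Z_{\ge0}^M$ satisfy $\sum_a n_a=\sum_i m_i$. Let $E_{ij}$ be the standard generators of $\mathfrak{gl}_M$ over $\mathbb C$, and let $E_{ij}^{(a)}=1^{\otimes(a-1)}\otimes E_{ij}\otimes1^{\otimes(N-a)}\in(U\mathfrak{gl}_M)^{\otimes N}$. For $\boldsymbol\lambda=(\lambda_1,\dots,\lambda_M)\in\mathbb C^M$ with pairwise distinct coordinates, write $$\operatorname{rdet}\Big((\partial_u-\lambda_i)\delta_{ij}-\sum_{a=1}^N\frac{E_{ji}^{(a)}}{u-z_a}\Big)_{i,j=1}^M=\partial_u^M+\widetilde G_1(u)\,\partial_u^{M-1}+\dots+\widetilde G_M(u),$$ where $\operatorname{rdet}(A)=\sum_{\sigma\in S_M}\operatorname{sgn}(\sigma)\,a_{1\sigma(1)}\cdots a_{M\sigma(M)}$ and the $\widetilde G_i(u)$ are rational functions of $u$ with values in $(U\mathfrak{gl}_M)^{\otimes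 N}$. The Bethe subalgebra $\mathcal G(M,N,\boldsymbol z,\boldsymbol\lambda)\subset(U\mathfrak{gl}_M)^{\otimes N}$ is the (unital) subalgebra generated by the coefficients of the polynomials $\widetilde G_i(u)\prod_{a=1}^N(u-z_a)^i$, $i=1,\dots,M$. Let $L_k$ be the space of homogeneous polynomials of degree $k$ in $\mathbb C[x_1,\dots,x_M]$, with $E_{ij}$ acting as $x_i\,\partial/\partial x_j$; let $\boldsymbol L_{\boldsymbol n}=L_{n_1}\otimes\dots\otimes L_{n_N}$, on which $(U\mathfrak{gl}_M)^{\otimes N}$ acts factor by factor, and let $\boldsymbol L_{\boldsymbol n}[\boldsymbol m]$ be the subspace of the vectors $v$ with $\sum_{a}E_{ii}^{(a)}v=m_iv$ for $i=1,\dots,M$. Then for generic $\boldsymbol\lambda$ the joint spectrum of $\mathcal G(M,N,\boldsymbol z,\boldsymbol\lambda)$ acting in $\boldsymbol L_{\boldsymbol n}[\boldsymbol m]$ is simple. That is, there is a nonzero polynomial $P\in\mathbb C[\lambda_1,\dots,\lambda_M]$ (which may depend on $M,N,\boldsymbol z,\boldsymbol n,\boldsymbol m$) such that for every $\boldsymbol\lambda\in\mathbb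 C^M$ with pairwise distinct coordinates and $P(\boldsymbol\lambda)\ne0$, the space $\boldsymbol L_{\boldsymbol n}[\boldsymbol m]$ has a finite basis consisting of common eigenvectors of all elements of $\mathcal G(M,N,\boldsymbol z,\boldsymbol\lambda)$, and for any two different basis vectors some element of $\mathcal G(M,N,\boldsymbol z,\boldsymbol\lambda)$ has different eigenvalues on them. -/

import Mathlib

open scoped TensorProduct BigOperators

attribute [local instance 100] LieRing.ofAssociativeRing

noncomputable section

namespace BetheGaudin

/-! ### Row determinants -/

/-- The row determinant `∑ σ, sgn(σ) a_{1 σ(1)} ⋯ a_{n σ(n)}` (factors in this order) of a square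
matrix with entries in a possibly noncommutative ring. -/
def rdet {R : Type*} [Ring R] {n : ℕ} (A : Matrix (Fin n) (Fin n) R) : R :=
  ∑ σ : Equiv.Perm (Fin n), Equiv.Perm.sign σ • (List.ofFn fun i => A i (σ i)).prod

/-! ### The derivation `d/du` of the field of rational functions in `u` -/

/-- The derivative of a rational function, by the quotient rule. -/
def ratDerivFun (f : RatFunc ℂ) : RatFunc ℂ :=
  (algebraMap (Polynomial ℂ) (RatFunc ℂ)
      (Polynomial.derivative f.num * f.denom - f.num * Polynomial.derivative f.denom)) /
    (algebraMap (Polynomial ℂ) (RatFunc ℂ) f.denom) ^ 2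

theorem quotient_rule_aux {p q N D : Polynomial ℂ} (h : N * q = p * D) :
    (Polynomial.derivative N * D - N * Polynomial.derivative D) * q ^ 2 =
      (Polynomial.derivative p * q - p * Polynomial.derivative q) * D ^ 2 := by
  have hder := congrArg Polynomial.derivative h
  simp only [Polynomial.derivative_mul] at hder
  linear_combination (D * q) * hder
    - (D * Polynomial.derivative q + q * Polynomial.derivative D) * h

theorem ratDerivFun_div (p q : Polynomial ℂ) (hq : q ≠ 0) :
    ratDerivFun (algebraMap _ (RatFunc ℂ) p / algebraMap _ (RatFunc ℂ) q) =
      (algebraMap (Polynomial ℂ) (RatFunc ℂ)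
        (Polynomial.derivative p * q - p * Polynomial.derivative q)) /
      (algebraMap (Polynomial ℂ) (RatFunc ℂ) q) ^ 2 := by
  generalize hf : algebraMap _ (RatFunc ℂ) p / algebraMap _ (RatFunc ℂ) q = f
  have hq' : algebraMap _ (RatFunc ℂ) q ≠ 0 := by simpa using hq
  have hd' : algebraMap _ (RatFunc ℂ) f.denom ≠ 0 := by simpa using f.denom_ne_zero
  have key : f.num * q = p * f.denom := by
    apply RatFunc.algebraMap_injective ℂ
    have h := f.num_div_denom.trans hf.symm
    rw [div_eq_div_iff hd' hq'] at h
    simpa using h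
  rw [ratDerivFun, div_eq_div_iff (pow_ne_zero _ hd') (pow_ne_zero _ hq'), ← map_pow, ← map_pow,
    ← map_mul, ← map_mul, quotient_rule_aux key]

/-- The derivation `d/du` of the field `ℂ(u)`. -/
def ratDeriv : Derivation ℂ (RatFunc ℂ) (RatFunc ℂ) :=
  Derivation.mk'
    { toFun := ratDerivFun
      map_add' := fun f g => by
        have hf : algebraMap _ (RatFunc ℂ) f.denom ≠ 0 := by simpa using f.denom_ne_zero
        have hg : algebraMap _ (RatFunc ℂ) g.denom ≠ 0 := by simpa using g.denom_ne_zero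
        have h : f + g = algebraMap _ (RatFunc ℂ) (f.num * g.denom + f.denom * g.num) /
            algebraMap _ (RatFunc ℂ) (f.denom * g.denom) := by
          conv_lhs => rw [← f.num_div_denom, ← g.num_div_denom]
          rw [div_add_div _ _ hf hg]
          simp
        rw [h, ratDerivFun_div _ _ (mul_ne_zero f.denom_ne_zero g.denom_ne_zero), ratDerivFun,
          ratDerivFun]
        simp only [Polynomial.derivative_mul, map_add, map_mul, map_sub]
        field_simp
        ring
      map_smul' := fun c f => by
        have h : c • f = algebraMap _ (RatFunc ℂ) (Polynomial.C c * f.num) /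
            algebraMap _ (RatFunc ℂ) f.denom := by
          conv_lhs => rw [← f.num_div_denom]
          rw [map_mul, mul_div_assoc, RatFunc.algebraMap_C, RatFunc.smul_eq_C_mul]
        rw [h, ratDerivFun_div _ _ f.denom_ne_zero, ratDerivFun, RingHom.id_apply,
          RatFunc.smul_eq_C_mul, ← RatFunc.algebraMap_C, ← mul_div_assoc, ← map_mul]
        congr 2
        simp only [Polynomial.derivative_mul, Polynomial.derivative_C]
        ring }
    (fun f g => by
      have hf : algebraMap _ (RatFunc ℂ) f.denom ≠ 0 := by simpa using f.denom_ne_zero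
      have hg : algebraMap _ (RatFunc ℂ) g.denom ≠ 0 := by simpa using g.denom_ne_zero
      have h : f * g = algebraMap _ (RatFunc ℂ) (f.num * g.num) /
          algebraMap _ (RatFunc ℂ) (f.denom * g.denom) := by
        conv_lhs => rw [← f.num_div_denom, ← g.num_div_denom]
        rw [div_mul_div_comm]
        simp
      change ratDerivFun (f * g) = f * ratDerivFun g + g * ratDerivFun f
      rw [h, ratDerivFun_div _ _ (mul_ne_zero f.denom_ne_zero g.denom_ne_zero)]
      conv_rhs => rw [← f.num_div_denom, ← g.num_div_denom,
        ratDerivFun_div _ _ f.denom_ne_zero, ratDerivFun_div _ _ g.denom_ne_zero]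
      simp only [Polynomial.derivative_mul, map_add, map_mul, map_sub]
      field_simp
      ring)

/-! ### Differential operators with coefficients in an algebra with a derivation -/

/-- Differential operators with coefficients in the algebra `B`, in normally ordered form:
the finitely supported family `c` stands for `∑ k, c k * ∂ ^ k`. -/
def DiffOp (B : Type) [Ring B] : Type := ℕ →₀ B

namespace DiffOp

variable {B : Type} [Ring B] [Algebra ℂ B]

instance : AddCommGroup (DiffOp B) := inferInstanceAs (AddCommGroup (ℕ →₀ B))

instance : Module ℂ (DiffOp B) := inferInstanceAs (Module ℂ (ℕ →₀ B))

/-- The coefficient of `∂ ^ k`. -/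
def coeff (k : ℕ) : DiffOp B →ₗ[ℂ] B := Finsupp.lapply (M := B) (R := ℂ) k

/-- The differential operator `b * ∂ ^ k`. -/
def monomial (k : ℕ) : B →ₗ[ℂ] DiffOp B := Finsupp.lsingle (M := B) (R := ℂ) k

/-- Left multiplication by `∂` on differential operators:
`∂ * (∑ k, c k * ∂ ^ k) = ∑ k, c k * ∂ ^ (k + 1) + ∑ k, (c k)' * ∂ ^ k`,
where `'` is the given derivation `d` of `B`. -/
def leftPartial (d : B →ₗ[ℂ] B) : Module.End ℂ (DiffOp B) :=
  Finsupp.lsum (M := B) ℂ fun k => monomial (k + 1) + (monomial k).comp d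

/-- Left multiplication by `b ∈ B` on differential operators. -/
def leftCoeff (b : B) : Module.End ℂ (DiffOp B) :=
  Finsupp.lsum (M := B) ℂ fun k => (monomial k).comp (LinearMap.mulLeft ℂ b)

/-- A differential operator is determined by the left multiplication by it on the algebra of
differential operators: the normally ordered form is its value on the operator `1`. -/
def normalForm (T : Module.End ℂ (DiffOp B)) : DiffOp B := T (monomial 0 1)

theorem coeff_monomial (j k : ℕ) (b : B) : coeff j (monomial k b) = if k = j then b else 0 :=
  Finsupp.single_apply

theorem induction {p : DiffOp B → Prop} (c : DiffOp B) (zero : p 0)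
    (add : ∀ c c', p c → p c' → p (c + c')) (monomial : ∀ k b, p (monomial k b)) : p c :=
  Finsupp.induction_linear c zero add monomial

theorem hom_ext {V : Type*} [AddCommMonoid V] [Module ℂ V] {S T : DiffOp B →ₗ[ℂ] V}
    (h : ∀ k b, S (monomial k b) = T (monomial k b)) : S = T :=
  LinearMap.ext fun c => c.induction (p := fun c => S c = T c) (by rw [map_zero, map_zero])
    (fun c c' hc hc' => by rw [map_add, map_add, hc, hc']) h

theorem lsum_monomial {V : Type*} [AddCommMonoid V] [Module ℂ V] (f : ℕ → B →ₗ[ℂ] V) (k : ℕ)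
    (b : B) : Finsupp.lsum (M := B) ℂ f (monomial k b : DiffOp B) = f k b := by
  change Finsupp.lsum (M := B) ℂ f (Finsupp.single k b) = f k b
  rw [Finsupp.lsum_single]

theorem leftPartial_monomial (d : B →ₗ[ℂ] B) (k : ℕ) (x : B) :
    leftPartial d (monomial k x) = monomial (k + 1) x + monomial k (d x) :=
  lsum_monomial _ k x

theorem leftCoeff_monomial (b : B) (k : ℕ) (x : B) :
    leftCoeff b (monomial k x) = monomial k (b * x) :=
  lsum_monomial _ k x

theorem leftCoeff_add (a b : B) : leftCoeff (a + b) = leftCoeff a + leftCoeff b :=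
  hom_ext fun k x => by
    rw [LinearMap.add_apply, leftCoeff_monomial, leftCoeff_monomial, leftCoeff_monomial, add_mul,
      map_add]

theorem leftCoeff_smul (r : ℂ) (b : B) : leftCoeff (r • b) = r • leftCoeff b :=
  hom_ext fun k x => by
    rw [LinearMap.smul_apply, leftCoeff_monomial, leftCoeff_monomial, smul_mul_assoc, map_smul]

theorem leftCoeff_mul (a b : B) : leftCoeff (a * b) = leftCoeff a * leftCoeff b :=
  hom_ext fun k x => by
    rw [Module.End.mul_apply, leftCoeff_monomial, leftCoeff_monomial, leftCoeff_monomial,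
      mul_assoc]

theorem leftCoeff_one : leftCoeff (1 : B) = 1 :=
  hom_ext fun k x => by rw [leftCoeff_monomial, one_mul, Module.End.one_apply]

/-- The relation `∂ b = b ∂ + b'`. -/
theorem leftPartial_mul_leftCoeff {d : B →ₗ[ℂ] B} (hd : ∀ a b, d (a * b) = a * d b + d a * b)
    (b : B) : leftPartial d * leftCoeff b = leftCoeff b * leftPartial d + leftCoeff (d b) :=
  hom_ext fun k x => by
    rw [LinearMap.add_apply, Module.End.mul_apply, Module.End.mul_apply, leftCoeff_monomial,
      leftPartial_monomial, leftPartial_monomial, map_add, leftCoeff_monomial,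
      leftCoeff_monomial, leftCoeff_monomial, hd, map_add, add_assoc]

/-- The left multiplication by `∑ k, c k * ∂ ^ k`. -/
def leftMul (d : B →ₗ[ℂ] B) : DiffOp B →ₗ[ℂ] Module.End ℂ (DiffOp B) :=
  Finsupp.lsum (M := B) ℂ fun k =>
    { toFun := fun b => leftCoeff b * leftPartial d ^ k
      map_add' := fun a b => by rw [leftCoeff_add, add_mul]
      map_smul' := fun r b => by rw [leftCoeff_smul, smul_mul_assoc, RingHom.id_apply] }

theorem leftMul_monomial (d : B →ₗ[ℂ] B) (k : ℕ) (b : B) :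
    leftMul d (monomial k b) = leftCoeff b * leftPartial d ^ k :=
  lsum_monomial _ k b

/-- Every element of the algebra generated by `∂` and the elements of `B` is the sum
`∑ k, c k * ∂ ^ k`, where `c` is its normal form. -/
theorem leftMul_normalForm {d : B →ₗ[ℂ] B} (hd : ∀ a b, d (a * b) = a * d b + d a * b)
    {T : Module.End ℂ (DiffOp B)}
    (hT : T ∈ Algebra.adjoin ℂ (insert (leftPartial d) (Set.range leftCoeff))) :
    leftMul d (normalForm T) = T := by
  have main : ∀ c, T * leftMul d c = leftMul d (T c) := by
    induction hT using Algebra.adjoin_induction with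
    | mem T hT =>
      intro c
      induction c using DiffOp.induction with
      | zero => simp only [map_zero, mul_zero]
      | add c c' hc hc' => simp only [map_add, mul_add, hc, hc']
      | monomial k x =>
        rcases hT with rfl | ⟨b, rfl⟩
        · rw [leftPartial_monomial, map_add, leftMul_monomial, leftMul_monomial,
            leftMul_monomial, ← mul_assoc, leftPartial_mul_leftCoeff hd, add_mul, pow_succ',
            mul_assoc]
        · rw [leftCoeff_monomial, leftMul_monomial, leftMul_monomial, leftCoeff_mul, mul_assoc]
    | algebraMap r =>
      intro c
      rw [Module.algebraMap_end_apply, map_smul, Algebra.smul_def]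
    | add S T _ _ hS hT => intro c; rw [add_mul, hS, hT, LinearMap.add_apply, map_add]
    | mul S T _ _ hS hT => intro c; rw [mul_assoc, hT, hS, Module.End.mul_apply]
  have h := main (monomial 0 1)
  rw [leftMul_monomial, leftCoeff_one, pow_zero, mul_one, mul_one] at h
  exact h.symm

end DiffOp

/-! ### Transfer matrices -/

section Transfer

variable {A : Type} [Ring A] [Algebra ℂ A]

/-- Rational functions in `u` with values in the algebra `A`: the algebra `ℂ(u) ⊗ A`. -/
abbrev RatVal (A : Type) [Ring A] [Algebra ℂ A] : Type := RatFunc ℂ ⊗[ℂ] A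

/-- The derivation `d/du` of `ℂ(u) ⊗ A`. -/
def ratValDeriv (A : Type) [Ring A] [Algebra ℂ A] : RatVal A →ₗ[ℂ] RatVal A :=
  LinearMap.rTensor A (ratDeriv : RatFunc ℂ →ₗ[ℂ] RatFunc ℂ)

theorem ratValDeriv_mul (a b : RatVal A) :
    ratValDeriv A (a * b) = a * ratValDeriv A b + ratValDeriv A a * b := by
  induction a using TensorProduct.induction_on with
  | zero => simp
  | add x y hx hy => simp only [add_mul, map_add, hx, hy]; abel
  | tmul f x =>
    induction b using TensorProduct.induction_on with
    | zero => simp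
    | add x y hx hy => simp only [mul_add, map_add, hx, hy]; abel
    | tmul g y => simp [ratValDeriv, TensorProduct.add_tmul, mul_comm]

/-- For elements `e i j a` of the algebra `A`, the matrix
`((∂/∂u - lam_i) δ_{ij} - ∑_a e_{ji}^{(a)} / (u - z_a))_{ij}` of differential operators. -/
def gaudinMatrix {M N : ℕ} (e : Fin M → Fin M → Fin N → A) (z : Fin N → ℂ) (lam : Fin M → ℂ) :
    Matrix (Fin M) (Fin M) (Module.End ℂ (DiffOp (RatVal A))) :=
  Matrix.of fun i j =>
    (if i = j then DiffOp.leftPartial (ratValDeriv A) - algebraMap ℂ _ (lam i) else 0) -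
      ∑ a : Fin N, DiffOp.leftCoeff
        (((RatFunc.X - RatFunc.C (z a))⁻¹ : RatFunc ℂ) ⊗ₜ[ℂ] e j i a)

/-- The row determinant of the matrix of differential operators is (left multiplication by) its
normal form. -/
theorem leftMul_normalForm_rdet {M N : ℕ} (e : Fin M → Fin M → Fin N → A) (z : Fin N → ℂ)
    (lam : Fin M → ℂ) :
    DiffOp.leftMul (ratValDeriv A) (DiffOp.normalForm (rdet (gaudinMatrix e z lam))) =
      rdet (gaudinMatrix e z lam) := by
  refine DiffOp.leftMul_normalForm ratValDeriv_mul ?_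
  set S := Algebra.adjoin ℂ
    (insert (DiffOp.leftPartial (ratValDeriv A)) (Set.range DiffOp.leftCoeff))
  have hS (i j : Fin M) : gaudinMatrix e z lam i j ∈ S := by
    rw [gaudinMatrix, Matrix.of_apply]
    refine sub_mem ?_ (sum_mem fun a _ =>
      Algebra.subset_adjoin (Set.mem_insert_of_mem _ (Set.mem_range_self _)))
    split_ifs
    · exact sub_mem (Algebra.subset_adjoin (Set.mem_insert _ _)) (S.algebraMap_mem _)
    · exact zero_mem _
  refine sum_mem fun σ _ => ?_
  have hp : (List.ofFn fun i => gaudinMatrix e z lam i (σ i)).prod ∈ S :=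
    list_prod_mem fun x hx => by
      obtain ⟨i, rfl⟩ := (List.mem_ofFn' _ _).1 hx
      exact hS _ _
  rw [Units.smul_def]
  exact zsmul_mem hp _

/-- The transfer matrix `G_i(u)`: the coefficient of `∂^{M-i}` in the row determinant of the
matrix of differential operators (used for `1 ≤ i ≤ M`). -/
def transferMatrix {M N : ℕ} (e : Fin M → Fin M → Fin N → A) (z : Fin N → ℂ) (lam : Fin M → ℂ)
    (i : ℕ) : RatVal A :=
  DiffOp.coeff (M - i) (DiffOp.normalForm (rdet (gaudinMatrix e z lam)))

/-- A polynomial in `u` with coefficients in `A`, viewed in `ℂ(u) ⊗ A`. -/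
def polyToRatVal (P : Polynomial A) : RatVal A :=
  P.sum fun k x => ((RatFunc.X : RatFunc ℂ) ^ k) ⊗ₜ[ℂ] x

/-- The subalgebra of `A` generated by the coefficients of the polynomials
`G_i(u) * ∏_a (u - z_a)^i`, `1 ≤ i ≤ M`. -/
def transferSubalgebra {M N : ℕ} (e : Fin M → Fin M → Fin N → A) (z : Fin N → ℂ)
    (lam : Fin M → ℂ) : Subalgebra ℂ A :=
  Algebra.adjoin ℂ
    {x | ∃ i ∈ Finset.Icc 1 M, ∃ P : Polynomial A,
      polyToRatVal P =
        (∏ a : Fin N, (RatFunc.X - RatFunc.C (z a) : RatFunc ℂ) ^ i) • transferMatrix e z lam i ∧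
      ∃ k : ℕ, P.coeff k = x}

end Transfer

/-! ### The Bethe subalgebra of `(U gl_M)^{⊗ N}` -/

/-- The Lie algebra `gl_M` over `ℂ`. -/
abbrev Gl (M : ℕ) : Type := Matrix (Fin M) (Fin M) ℂ

/-- The universal enveloping algebra `U gl_M`. -/
abbrev UGl (M : ℕ) : Type := UniversalEnvelopingAlgebra ℂ (Gl M)

/-- The algebra `(U gl_M)^{⊗ N}`. -/
abbrev UGlTensor (M N : ℕ) : Type := ⨂[ℂ] _ : Fin N, UGl M

/-- The element `E_{ij}^{(a)} = 1^{⊗ (a-1)} ⊗ E_{ij} ⊗ 1^{⊗ (N-a)}`. -/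
def E (M N : ℕ) (i j : Fin M) (a : Fin N) : UGlTensor M N :=
  PiTensorProduct.singleAlgHom (R := ℂ) (A := fun _ : Fin N => UGl M) a
    (UniversalEnvelopingAlgebra.ι ℂ (Matrix.single i j (1 : ℂ) : Gl M))

/-- The Bethe subalgebra of `(U gl_M)^{⊗ N}`. -/
def betheSubalgebra (M N : ℕ) (z : Fin N → ℂ) (lam : Fin M → ℂ) :
    Subalgebra ℂ (UGlTensor M N) :=
  transferSubalgebra (E M N) z lam

/-! ### Tensor products of symmetric powers -/

/-- The derivation `∑_{i,j} A_{ij} x_i ∂/∂x_j` of `ℂ[x_1, …, x_M]`; thus `E_{ij}` goes to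
`x_i ∂/∂x_j`. -/
def polyDerivation {M : ℕ} (A : Gl M) :
    Derivation ℂ (MvPolynomial (Fin M) ℂ) (MvPolynomial (Fin M) ℂ) :=
  ∑ i, ∑ j, A i j • (MvPolynomial.X i : MvPolynomial (Fin M) ℂ) • MvPolynomial.pderiv j

theorem polyDerivation_apply {M : ℕ} (A : Gl M) (p : MvPolynomial (Fin M) ℂ) :
    polyDerivation A p =
      ∑ i, ∑ j, A i j • (MvPolynomial.X i * MvPolynomial.pderiv j p) := by
  have key (s : Fin M → Derivation ℂ (MvPolynomial (Fin M) ℂ) (MvPolynomial (Fin M) ℂ)) :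
      (∑ i, s i) p = ∑ i, s i p :=
    map_sum (⟨⟨fun D => D p, rfl⟩, fun _ _ => rfl⟩ :
      Derivation ℂ (MvPolynomial (Fin M) ℂ) (MvPolynomial (Fin M) ℂ) →+ _) _ _
  simp [polyDerivation, key]

theorem polyDerivation_X {M : ℕ} (A : Gl M) (k : Fin M) :
    polyDerivation A (MvPolynomial.X k) = ∑ i, A i k • MvPolynomial.X i := by
  classical
  simp [polyDerivation_apply, MvPolynomial.pderiv_X, Pi.single_apply]

theorem polyDerivation_lie {M : ℕ} (A B : Gl M) :
    polyDerivation ⁅A, B⁆ = ⁅polyDerivation A, polyDerivation B⁆ := by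
  refine MvPolynomial.derivation_ext fun k => ?_
  rw [Derivation.commutator_apply]
  have key (A B : Gl M) : polyDerivation A (∑ i, B i k • MvPolynomial.X i) =
      ∑ i, (A * B) i k • (MvPolynomial.X i : MvPolynomial (Fin M) ℂ) := by
    rw [map_sum]
    simp only [Derivation.map_smul, polyDerivation_X, Finset.smul_sum, smul_smul]
    rw [Finset.sum_comm]
    refine Finset.sum_congr rfl fun i _ => ?_
    rw [← Finset.sum_smul, Matrix.mul_apply]
    simp only [mul_comm]
  rw [polyDerivation_X, polyDerivation_X, polyDerivation_X, key, key, Ring.lie_def,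
    ← Finset.sum_sub_distrib]
  simp only [Matrix.sub_apply, sub_smul]

/-- The space `L_m^{(M)}` of homogeneous polynomials of degree `m` in `M` variables. -/
abbrev SymPow (M m : ℕ) : Submodule ℂ (MvPolynomial (Fin M) ℂ) :=
  MvPolynomial.homogeneousSubmodule (Fin M) ℂ m

theorem polyDerivation_mem {M m : ℕ} (A : Gl M) {p : MvPolynomial (Fin M) ℂ}
    (hp : p ∈ SymPow M m) : polyDerivation A p ∈ SymPow M m := by
  rw [polyDerivation_apply]
  refine Submodule.sum_mem _ fun i _ => Submodule.sum_mem _ fun j _ => Submodule.smul_mem _ _ ?_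
  rw [MvPolynomial.mem_homogeneousSubmodule] at hp ⊢
  rcases m with _ | m
  · rw [MvPolynomial.totalDegree_eq_zero_iff_eq_C.1 (Nat.le_zero.1 hp.totalDegree_le),
      MvPolynomial.pderiv_C, mul_zero]
    exact MvPolynomial.isHomogeneous_zero _ _ _
  · have h := (MvPolynomial.isHomogeneous_X ℂ i).mul (hp.pderiv (i := j))
    rwa [Nat.add_sub_cancel, add_comm] at h

/-- The `gl_M`-module structure on `L_m^{(M)}`. -/
def symPowRep (M m : ℕ) : Gl M →ₗ⁅ℂ⁆ Module.End ℂ (SymPow M m) where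
  toFun A := (polyDerivation A : MvPolynomial (Fin M) ℂ →ₗ[ℂ] MvPolynomial (Fin M) ℂ).restrict
    fun _ hp => polyDerivation_mem A hp
  map_add' A B := by
    ext p : 2
    simp [LinearMap.restrict_apply, polyDerivation_apply, add_smul, Finset.sum_add_distrib]
  map_smul' c A := by
    ext p : 2
    simp [LinearMap.restrict_apply, polyDerivation_apply, mul_smul, Finset.smul_sum]
  map_lie' {A B} := by
    ext p : 2
    change polyDerivation ⁅A, B⁆ (p : MvPolynomial (Fin M) ℂ) =
      polyDerivation A (polyDerivation B p) - polyDerivation B (polyDerivation A p)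
    rw [polyDerivation_lie, Derivation.commutator_apply]

/-- The tensor product `L_n = L_{n_1}^{(M)} ⊗ ⋯ ⊗ L_{n_N}^{(M)}`. -/
abbrev SymTensor (M : ℕ) {N : ℕ} (n : Fin N → ℕ) : Type :=
  ⨂[ℂ] a : Fin N, SymPow M (n a)

/-- The action of `(U gl_M)^{⊗ N}` on `L_n`, factor by factor. -/
def tensorAction (M : ℕ) {N : ℕ} (n : Fin N → ℕ) :
    UGlTensor M N →ₐ[ℂ] Module.End ℂ (SymTensor M n) :=
  PiTensorProduct.liftAlgHom
    ((PiTensorProduct.mapMultilinear ℂ (fun a => SymPow M (n a))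
        (fun a => SymPow M (n a))).compLinearMap
      fun a => (UniversalEnvelopingAlgebra.lift ℂ (symPowRep M (n a))).toLinearMap)
    (by
      rw [MultilinearMap.compLinearMap_apply]
      simp only [Pi.one_apply, AlgHom.toLinearMap_apply, map_one]
      exact PiTensorProduct.map_one)
    (fun x y => by
      simp only [MultilinearMap.compLinearMap_apply, Pi.mul_apply, AlgHom.toLinearMap_apply,
        map_mul]
      exact PiTensorProduct.map_mul _ _)

/-- The weight subspace `L_n[m]`: the vectors on which `E_{ii}`, acting diagonally as
`∑_a E_{ii}^{(a)}`, is multiplication by `m_i` for all `i`. -/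
def weightSpace (M : ℕ) {N : ℕ} (n : Fin N → ℕ) (m : Fin M → ℕ) :
    Submodule ℂ (SymTensor M n) :=
  ⨅ i : Fin M, LinearMap.eqLocus (tensorAction M n (∑ a : Fin N, E M N i i a))
    ((m i : ℂ) • LinearMap.id)

/-! ### Simple joint spectrum -/

/-- The elements of `S`, acting on `V` through `ρ`, have simple joint spectrum in the
subspace `W`: there is a finite basis of `W` that consists of common eigenvectors of all elements
of `S`, and distinct basis vectors have distinct families of eigenvalues. -/
def HasSimpleJointSpectrum {A V : Type*} [Ring A] [Algebra ℂ A] [AddCommMonoid V] [Module ℂ V]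
    (ρ : A →ₐ[ℂ] Module.End ℂ V) (S : Subalgebra ℂ A) (W : Submodule ℂ V) : Prop :=
  ∃ (d : ℕ) (b : Module.Basis (Fin d) ℂ W) (χ : Fin d → S → ℂ),
    (∀ i (s : S), ρ (s : A) (b i : V) = χ i s • (b i : V)) ∧ Function.Injective χ

end BetheGaudin

end

/-! For `c : Fin N → ℂ` consider the quadratic Hamiltonian H = ∑ 2 c_a λ_i E_ii^(a) + ∑_{a ≠ b} (c_a
- c_b)/(z_a - z_b) ∑_{i,j} E_ij^(a) E_ji^(b). On L_n, for M ≥ 2, twice the contraction of the second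
transfer matrix with a functional on ℂ(u) sending each 1/(u - z_a) to c_a is a scalar minus H
(`two_smul_tensorAction_transferCoeff_two`, `tensorAction_centralPart`). So H belongs to the image
of the Bethe subalgebra up to scalars.

Generic simplicity: H is affine in λ, and its λ-linear part is diagonal in the monomial basis of
L_n. For c and one direction μ built from powers of a transcendental number, the eigenvalues of that
part are distinct (`exists_injective_weight_sum`). For λ far out in the direction μ the remaining
part is a small perturbation, so the discriminant of the characteristic polynomial of H is a nonzero
polynomial in λ (`exists_polynomial_separable_charpoly`); this is the required P.

Where P does not vanish, H has simple spectrum on all of L_n, and every operator commuting with H is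
diagonal in its eigenbasis. It remains that H commutes with all transfer matrices and with the
weight operators; the second then puts a part of the eigenbasis into L_n[m] as a basis.
Commutativity of the whole Bethe subalgebra is not needed.

Commutation is proved for the realization of E_ij^(a) as x_ia ∂/∂x_ja. A differential operator is
encoded by its normally ordered symbol in ℂ[x, y]; left composition with x_ia ∂/∂x_ja becomes
`hatE`, right composition becomes `checkE`. A Capelli identity shows that the symbol of the row
determinant is the determinant of the commutative matrix (v - λ_i) δ_ij - ∑_a y_ia x_ja/(u - z_a).
Commutation becomes the statement that left and right composition with H agree on this determinant
(`hamiltonian_hatE_det`). Their difference has a first-order part, a classical flow in Lax form that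
preserves determinants, and a second-order part, whose two terms cancel on the determinant. For M ≤
1 the space L_n has dimension at most one. -/

noncomputable section

namespace BetheGaudin

/-! ### Derivations and determinants -/

section DerivationDet

variable {R S : Type*} [CommRing R] [CommRing S] [Algebra R S]

theorem derivation_prod {ι : Type*} [DecidableEq ι] (D : Derivation R S S) (s : Finset ι)
    (f : ι → S) : D (∏ i ∈ s, f i) = ∑ l ∈ s, (∏ i ∈ s.erase l, f i) * D (f l) := by
  induction s using Finset.induction_on with
  | empty => simp
  | insert a s ha ih =>
    rw [Finset.prod_insert ha, Derivation.leibniz, ih, Finset.sum_insert ha,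
      Finset.erase_insert ha, smul_eq_mul, smul_eq_mul, add_comm, Finset.mul_sum]
    congr 1
    refine Finset.sum_congr rfl fun l hl => ?_
    have hal : a ≠ l := fun h => ha (h ▸ hl)
    rw [Finset.erase_insert_of_ne hal, Finset.prod_insert (by simp [ha]), mul_assoc]

theorem derivation_aeval {ι : Type*} [Fintype ι] (D : Derivation R S S) (x : ι → S)
    (p : MvPolynomial ι R) :
    D (MvPolynomial.aeval x p) =
      ∑ i, MvPolynomial.aeval x (MvPolynomial.pderiv i p) * D (x i) := by
  classical
  induction p using MvPolynomial.induction_on with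
  | C a => simp
  | add p q hp hq => simp [hp, hq, add_mul, Finset.sum_add_distrib]
  | mul_X p i hp =>
    simp only [map_mul, Derivation.leibniz, hp, MvPolynomial.aeval_X, smul_eq_mul, map_add,
      add_mul, Finset.sum_add_distrib, MvPolynomial.pderiv_X, Finset.mul_sum]
    congr 1
    · rw [Finset.sum_eq_single i (fun j _ hj => by simp [hj.symm]) (by simp)]
      simp
    · exact Finset.sum_congr rfl fun j _ => by ring

/-- With the determinant written as a polynomial in the entries, derivations act on it by the chain
rule `derivation_aeval`. -/
theorem det_eq_aeval_det {n : Type*} [DecidableEq n] [Fintype n] (C : Matrix n n S) :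
    C.det = MvPolynomial.aeval (fun p : n × n => C p.1 p.2)
      (Matrix.mvPolynomialX n n R).det := by
  rw [AlgHom.map_det, Matrix.mvPolynomialX_mapMatrix_aeval]

/-- The second derivative of the determinant along matrices whose own second derivative vanishes
is a symmetric bilinear form in the first derivatives. -/
theorem exists_symm_derivation_derivation_det {n : Type*} [DecidableEq n] [Fintype n]
    (C : Matrix n n S) :
    ∃ B : n × n → n × n → S, (∀ p q, B p q = B q p) ∧
      ∀ D D' : Derivation R S S, (∀ i j, D (D' (C i j)) = 0) →
        D (D' C.det) = ∑ p, ∑ q, B p q * (D (C p.1 p.2) * D' (C q.1 q.2)) := by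
  -- The form is the Hessian of the generic determinant, evaluated at the entries of `C`; in
  -- particular it does not depend on `D` and `D'`.
  refine ⟨fun p q => MvPolynomial.aeval (fun p : n × n => C p.1 p.2)
    (MvPolynomial.pderiv p (MvPolynomial.pderiv q (Matrix.mvPolynomialX n n R).det)),
    fun p q => ?_, fun D D' h => ?_⟩
  · have := congrArg (fun D => D (Matrix.mvPolynomialX n n R).det)
      (MvPolynomial.derivation_ext (σ := n × n) (R := R)
        (D₁ := ⁅MvPolynomial.pderiv p, MvPolynomial.pderiv q⁆) (D₂ := 0) fun i => by
          classical
          rw [Derivation.commutator_apply]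
          simp [MvPolynomial.pderiv_X, Pi.single_apply, apply_ite])
    rw [Derivation.commutator_apply, Derivation.zero_apply, sub_eq_zero] at this
    exact congrArg _ this
  · rw [det_eq_aeval_det (R := R) C, derivation_aeval, map_sum, Finset.sum_comm]
    refine Finset.sum_congr rfl fun q _ => ?_
    rw [Derivation.leibniz, h, smul_zero, zero_add, derivation_aeval, smul_eq_mul,
      Finset.mul_sum]
    exact Finset.sum_congr rfl fun p _ => by ring

/-- If a derivation acts on a matrix as a commutator, it annihilates the determinant. -/
theorem derivation_det_eq_zero {n : Type*} [DecidableEq n] [Fintype n]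
    (D : Derivation R S S) (C L : Matrix n n S)
    (h : ∀ i j, D (C i j) = (L * C - C * L) i j) : D C.det = 0 := by
  -- Over the dual numbers, s ↦ s + ε D(s) is a ring homomorphism, and the hypothesis says that it
  -- sends `C` to its conjugate by 1 + ε L. Conjugation preserves the determinant, so the ε-part of
  -- φ(det C), which is D(det C), vanishes.
  let φ : S →+* TrivSqZeroExt S S :=
    { toFun := fun s => TrivSqZeroExt.inl s + TrivSqZeroExt.inr (D s)
      map_one' := by simp
      map_mul' := fun a b => by
        ext <;> simp [mul_comm]
      map_zero' := by simp
      map_add' := fun a b => by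
        ext <;> simp }
  let e : S →+* TrivSqZeroExt S S := TrivSqZeroExt.inlHom S S
  let L' : Matrix n n (TrivSqZeroExt S S) := L.map TrivSqZeroExt.inr
  have hL : (1 + L') * (1 - L') = 1 := by
    have : L' * L' = 0 := by
      ext i j <;> simp [L', Matrix.mul_apply, TrivSqZeroExt.fst_sum, TrivSqZeroExt.snd_sum]
    rw [add_mul, one_mul, mul_sub, this, mul_one]; abel
  have hC : φ.mapMatrix C = (1 + L') * e.mapMatrix C * (1 - L') := by
    have h1 : L' * e.mapMatrix C = (L * C).map TrivSqZeroExt.inr := by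
      ext i j <;> simp [L', e, Matrix.mul_apply, TrivSqZeroExt.fst_sum, TrivSqZeroExt.snd_sum]
    have h2 : e.mapMatrix C * L' = (C * L).map TrivSqZeroExt.inr := by
      ext i j <;> simp [L', e, Matrix.mul_apply, TrivSqZeroExt.fst_sum, TrivSqZeroExt.snd_sum,
        mul_comm]
    have h3 : L' * (e.mapMatrix C * L') = 0 := by
      rw [h2]
      ext i j <;> simp [L', Matrix.mul_apply, TrivSqZeroExt.fst_sum, TrivSqZeroExt.snd_sum]
    have h4 : (1 + L') * e.mapMatrix C * (1 - L') =
        e.mapMatrix C + (L' * e.mapMatrix C - e.mapMatrix C * L')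
          - L' * (e.mapMatrix C * L') := by noncomm_ring
    rw [h4, h3, h1, h2, sub_zero]
    ext i j
    · simp [φ, e]
    · simp [φ, e, h]
  have hdet : φ C.det = e C.det := by
    rw [RingHom.map_det, hC, Matrix.det_mul, Matrix.det_mul, mul_right_comm, ← Matrix.det_mul,
      hL, Matrix.det_one, one_mul, RingHom.map_det]
  simpa [φ, e] using congrArg TrivSqZeroExt.snd hdet

end DerivationDet

/-! ### A Capelli identity -/

/-- If the derivations `D i j` act on the entries of a matrix `C` over a commutative ring by
`D i j (C k l) = δ_{ij} q_{kl} + δ_{il} q_{kj}`, then the row determinant of the operators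
`C i j + D i j` sends `1` to the determinant of `C`. -/
theorem rdet_apply_one {R S : Type*} [CommRing R] [CommRing S] [Algebra R S] {M : ℕ}
    (C q : Matrix (Fin M) (Fin M) S) (D : Fin M → Fin M → Derivation R S S)
    (hD : ∀ i j k l, D i j (C k l) =
      (if i = j then q k l else 0) + (if i = l then q k j else 0)) :
    rdet (Matrix.of fun i j => LinearMap.mulLeft R (C i j) + (D i j : S →ₗ[R] S)) 1 = C.det := by
  classical
  set A : Matrix (Fin M) (Fin M) (Module.End R S) :=
    Matrix.of fun i j => LinearMap.mulLeft R (C i j) + (D i j : S →ₗ[R] S) with hA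
  let L (k : ℕ) (σ : Equiv.Perm (Fin M)) : Module.End R S :=
    ((List.ofFn fun i => A i (σ i)).take k).prod
  -- `F k` interpolates between the determinant (`k = 0`) and the row determinant applied to 1 (`k =
  -- M`): the first k factors are operators, the others are already multiplied out as ring elements.
  -- The claim is that `F` is constant.
  let F (k : ℕ) : S := ∑ σ : Equiv.Perm (Fin M), Equiv.Perm.sign σ •
    L k σ (∏ i with k ≤ i.val, C i (σ i))
  have step (k : ℕ) (hk : k < M) : F (k + 1) = F k := by
    let κ : Fin M := ⟨k, hk⟩
    let s : Finset (Fin M) := Finset.univ.filter fun i => k + 1 ≤ i.val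
    have hins : (Finset.univ.filter fun i : Fin M => k ≤ i.val) = insert κ s := by
      ext i
      simp only [Finset.mem_filter, Finset.mem_univ, true_and, Finset.mem_insert, s, κ, Fin.ext_iff]
      omega
    have hκ : κ ∉ s := by simp [s, κ]
    -- `U σ l` is the contribution of the δ_ij term when the derivation in row κ hits the factor of
    -- row l. The δ_il term is the same expression for σ composed with the transposition of κ and l,
    -- which has the opposite sign and leaves the first k factors alone, so the two cancel after
    -- summation over σ.
    let U (σ : Equiv.Perm (Fin M)) (l : Fin M) : S :=
      L k σ ((∏ i ∈ s.erase l, C i (σ i)) * if κ = σ κ then q l (σ l) else 0)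
    have hL (σ : Equiv.Perm (Fin M)) (f : S) :
        L (k + 1) σ f = L k σ (C κ (σ κ) * f) + L k σ (D κ (σ κ) f) := by
      have : L (k + 1) σ = L k σ * A κ (σ κ) := by
        simp only [L]
        rw [← List.take_concat_get' _ k (by simpa using hk), List.prod_append]
        simp [κ]
      rw [this, Module.End.mul_apply, hA]
      simp
    have hLswap (σ : Equiv.Perm (Fin M)) (l : Fin M) (hl : l ∈ s) :
        L k (σ * Equiv.swap κ l) = L k σ := by
      have hl' : k + 1 ≤ l.val := by simpa [s] using hl
      simp only [L]
      congr 1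
      refine List.ext_getElem (by simp) fun i h1 h2 => ?_
      have hi : i < k := by simp at h1; omega
      simp only [List.getElem_take, List.getElem_ofFn, Equiv.Perm.mul_apply]
      rw [Equiv.swap_apply_of_ne_of_ne]
      · simp [κ, Fin.ext_iff]; omega
      · simp [Fin.ext_iff]; omega
    have hDer (σ : Equiv.Perm (Fin M)) :
        L k σ (D κ (σ κ) (∏ i ∈ s, C i (σ i))) =
          ∑ l ∈ s, (U σ l + U (σ * Equiv.swap κ l) l) := by
      rw [derivation_prod, map_sum]
      refine Finset.sum_congr rfl fun l hl => ?_
      simp only [U]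
      rw [hLswap σ l hl, hD, mul_add, map_add]
      congr 3
      · refine Finset.prod_congr rfl fun i hi => ?_
        have hi' := Finset.mem_erase.1 hi
        rw [Equiv.Perm.mul_apply, Equiv.swap_apply_of_ne_of_ne _ hi'.1]
        rintro rfl
        exact hκ hi'.2
      · simp
    have hzero (l : Fin M) (hl : l ∈ s) :
        ∑ σ : Equiv.Perm (Fin M), Equiv.Perm.sign σ • (U σ l + U (σ * Equiv.swap κ l) l) = 0 := by
      have hne : κ ≠ l := fun h => hκ (h ▸ hl)
      simp only [smul_add, Finset.sum_add_distrib]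
      rw [← Equiv.sum_comp (Equiv.mulRight (Equiv.swap κ l))
        (fun σ => Equiv.Perm.sign σ • U σ l), ← Finset.sum_add_distrib]
      refine Finset.sum_eq_zero fun σ _ => ?_
      simp [Equiv.Perm.sign_swap hne]
    simp only [F]
    rw [← sub_eq_zero, ← Finset.sum_sub_distrib]
    calc _ = ∑ σ : Equiv.Perm (Fin M), Equiv.Perm.sign σ •
          ∑ l ∈ s, (U σ l + U (σ * Equiv.swap κ l) l) := by
          refine Finset.sum_congr rfl fun σ _ => ?_
          rw [← smul_sub, hins, Finset.prod_insert hκ, ← hDer, hL, add_sub_cancel_left]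
      _ = 0 := by
          simp only [Finset.smul_sum]
          rw [Finset.sum_comm]
          exact Finset.sum_eq_zero hzero
  have hconst (k : ℕ) (hk : k ≤ M) : F k = F 0 := by
    induction k with
    | zero => rfl
    | succ k ih => rw [step k hk, ih (by omega)]
  have hM : F M = rdet A 1 := by
    simp only [F, L, rdet, LinearMap.sum_apply]
    refine Finset.sum_congr rfl fun σ _ => ?_
    rw [List.take_of_length_le (by simp), Finset.prod_eq_one]
    · simp [Units.smul_def]
    · intro i hi
      have := (Finset.mem_filter.1 hi).2
      omega
  rw [← hM, hconst M le_rfl, ← Matrix.det_transpose, Matrix.det_apply]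
  simp [F, L]

/-! ### The second coefficient of the characteristic polynomial -/

/-- The coefficient is the sum of the principal 2 × 2 minors. The double sum meets each unordered
pair of indices twice, and its diagonal terms are zero. -/
theorem two_mul_charpoly_coeff {S : Type*} [CommRing S] {n : Type*} [DecidableEq n] [Fintype n]
    (B : Matrix n n S) (hn : 2 ≤ Fintype.card n) :
    2 * B.charpoly.coeff (Fintype.card n - 2) = ∑ i, ∑ j, (B i i * B j j - B i j * B j i) := by
  rw [Matrix.charpoly_coeff_eq_sum_minors B 2 hn]
  have hpair (s : Finset n) (hs : s ∈ Finset.univ.powersetCard 2) :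
      2 * (B.submatrix (Subtype.val : s → n) (Subtype.val : s → n)).det =
        ∑ p ∈ Finset.univ.offDiag with ({p.1, p.2} : Finset n) = s,
          (B p.1 p.1 * B p.2 p.2 - B p.1 p.2 * B p.2 p.1) := by
    obtain ⟨a, b, hab, rfl⟩ := Finset.card_eq_two.1 (Finset.mem_powersetCard.1 hs).2
    have hfil : (Finset.univ.offDiag.filter fun p : n × n => ({p.1, p.2} : Finset n) = {a, b}) =
        {(a, b), (b, a)} := by
      ext ⟨c, d⟩
      simp only [Finset.mem_filter, Finset.mem_offDiag, Finset.mem_univ, true_and,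
        Finset.mem_insert, Finset.mem_singleton, Prod.mk.injEq]
      constructor
      · rintro ⟨hcd, h⟩
        have h1 : c ∈ ({a, b} : Finset n) := h ▸ by simp
        have h2 : d ∈ ({a, b} : Finset n) := h ▸ by simp
        simp only [Finset.mem_insert, Finset.mem_singleton] at h1 h2
        grind
      · rintro (⟨rfl, rfl⟩ | ⟨rfl, rfl⟩)
        · exact ⟨hab, rfl⟩
        · exact ⟨hab.symm, Finset.pair_comm _ _⟩
    rw [hfil, Finset.sum_pair (by simp [hab])]
    let f : Fin 2 → ({a, b} : Finset n) := ![⟨a, by simp⟩, ⟨b, by simp⟩]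
    have hf : Function.Bijective f := by
      constructor
      · intro i j
        fin_cases i <;> fin_cases j <;> simp [f, hab, hab.symm]
      · rintro ⟨x, hx⟩
        rcases Finset.mem_insert.1 hx with rfl | hx'
        · exact ⟨0, rfl⟩
        · exact ⟨1, by simp [f, Finset.mem_singleton.1 hx']⟩
    rw [← Matrix.det_submatrix_equiv_self (Equiv.ofBijective f hf), Matrix.det_fin_two]
    simp [f]
    ring
  have hdiag : ∑ i, ∑ j, (B i i * B j j - B i j * B j i) =
      ∑ p ∈ Finset.univ.offDiag, (B p.1 p.1 * B p.2 p.2 - B p.1 p.2 * B p.2 p.1) := by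
    rw [← Finset.sum_product', ← Finset.diag_union_offDiag,
      Finset.sum_union (Finset.disjoint_diag_offDiag _), Finset.sum_diag]
    simp
  rw [hdiag, neg_one_sq, one_mul, Finset.mul_sum, Finset.sum_congr rfl hpair,
    Finset.sum_fiberwise_of_maps_to]
  intro p hp
  rw [Finset.mem_powersetCard]
  exact ⟨Finset.subset_univ _, Finset.card_pair (by simpa using hp)⟩

end BetheGaudin

end

noncomputable section

namespace BetheGaudin

/-! ### Symbols of differential operators -/

theorem derivation_sum_apply {R S ι : Type*} [CommRing R] [CommRing S] [Algebra R S]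
    (s : Finset ι) (D : ι → Derivation R S S) (f : S) : (∑ i ∈ s, D i) f = ∑ i ∈ s, D i f :=
  map_sum (⟨⟨fun D => D f, rfl⟩, fun _ _ => rfl⟩ : Derivation R S S →+ S) D s

/-- A commutative ring with coordinates `x i a`, `y i a`, `r a`, `v` and derivations that behave
like the coordinates `x_{ia}`, the symbols of `∂/∂x_{ia}`, the functions `1 / (u - z_a)`, the symbol
of `∂/∂u`, and the partial derivatives with respect to `x_{ia}`, `y_{ia}` and `u`. -/
structure SymbolRing (M N : ℕ) (z : Fin N → ℂ) (S : Type*) [CommRing S] [Algebra ℂ S] where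
  x : Fin M → Fin N → S
  y : Fin M → Fin N → S
  r : Fin N → S
  v : S
  dx : Fin M → Fin N → Derivation ℂ S S
  dy : Fin M → Fin N → Derivation ℂ S S
  du : Derivation ℂ S S
  smul_r_mul_r : ∀ a b, (z a - z b) • (r a * r b) = r a - r b
  dx_x : ∀ i a j b, dx i a (x j b) = if i = j ∧ a = b then 1 else 0
  dx_y : ∀ i a j b, dx i a (y j b) = 0
  dx_r : ∀ i a b, dx i a (r b) = 0
  dx_v : ∀ i a, dx i a v = 0
  dy_x : ∀ i a j b, dy i a (x j b) = 0
  dy_y : ∀ i a j b, dy i a (y j b) = if i = j ∧ a = b then 1 else 0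
  dy_r : ∀ i a b, dy i a (r b) = 0
  dy_v : ∀ i a, dy i a v = 0
  du_x : ∀ i a, du (x i a) = 0
  du_y : ∀ i a, du (y i a) = 0
  du_r : ∀ a, du (r a) = -(r a * r a)
  du_v : du v = 0

namespace SymbolRing

variable {M N : ℕ} {z : Fin N → ℂ} {S : Type*} [CommRing S] [Algebra ℂ S]
  (Q : SymbolRing M N z S)

/-- The matrix `(v - λ_i) δ_{ij} - ∑_a r_a y_{ia} x_{ja}`. -/
def symbolMatrix (lam : Fin M → ℂ) : Matrix (Fin M) (Fin M) S :=
  Matrix.of fun i j => (if i = j then Q.v - algebraMap ℂ S (lam i) else 0) -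
    ∑ a, Q.r a * (Q.y i a * Q.x j a)

/-- The operator `x_{ia} (∂/∂x_{ja} + y_{ja})`: the effect on symbols of the composition with
`x_{ia} ∂/∂x_{ja}` on the left. -/
def hatE (i j : Fin M) (a : Fin N) : Module.End ℂ S :=
  LinearMap.mulLeft ℂ (Q.x i a) * ((Q.dx j a : S →ₗ[ℂ] S) + LinearMap.mulLeft ℂ (Q.y j a))

/-- The operator `y_{ja} (x_{ia} + ∂/∂y_{ia})`: the effect on symbols of the composition with
`x_{ia} ∂/∂x_{ja}` on the right. -/
def checkE (i j : Fin M) (a : Fin N) : Module.End ℂ S :=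
  LinearMap.mulLeft ℂ (Q.y j a) * ((Q.dy i a : S →ₗ[ℂ] S) + LinearMap.mulLeft ℂ (Q.x i a))

theorem hatE_apply (i j : Fin M) (a : Fin N) (f : S) :
    Q.hatE i j a f = Q.x i a * (Q.dx j a f + Q.y j a * f) := rfl

theorem checkE_apply (i j : Fin M) (a : Fin N) (f : S) :
    Q.checkE i j a f = Q.y j a * (Q.dy i a f + Q.x i a * f) := rfl

theorem dx_symbolMatrix (lam : Fin M → ℂ) (i : Fin M) (a : Fin N) (k l : Fin M) :
    Q.dx i a (Q.symbolMatrix lam k l) = -(if i = l then Q.r a * Q.y k a else 0) := by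
  rw [symbolMatrix, Matrix.of_apply, map_sub, apply_ite (Q.dx i a), map_zero, map_sub, Q.dx_v,
    Derivation.map_algebraMap, sub_zero, ite_self, zero_sub, map_sum]
  congr 1
  simp [Q.dx_r, Q.dx_y, Q.dx_x, ite_and]

theorem dy_symbolMatrix (lam : Fin M → ℂ) (i : Fin M) (a : Fin N) (k l : Fin M) :
    Q.dy i a (Q.symbolMatrix lam k l) = -(if i = k then Q.r a * Q.x l a else 0) := by
  rw [symbolMatrix, Matrix.of_apply, map_sub, apply_ite (Q.dy i a), map_zero, map_sub, Q.dy_v,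
    Derivation.map_algebraMap, sub_zero, ite_self, zero_sub, map_sum]
  congr 1
  simp [Q.dy_r, Q.dy_y, Q.dy_x, ite_and]

theorem du_symbolMatrix (lam : Fin M → ℂ) (k l : Fin M) :
    Q.du (Q.symbolMatrix lam k l) = ∑ a, Q.r a * Q.r a * (Q.y k a * Q.x l a) := by
  rw [symbolMatrix, Matrix.of_apply, map_sub, apply_ite Q.du, map_zero, map_sub, Q.du_v,
    Derivation.map_algebraMap, sub_zero, ite_self, zero_sub, map_sum, ← Finset.sum_neg_distrib]
  refine Finset.sum_congr rfl fun a _ => ?_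
  simp only [Derivation.leibniz, Q.du_x, Q.du_y, Q.du_r, smul_eq_mul]
  ring

/-- The Capelli identity for the Gaudin model: the symbol of the row determinant is a
determinant. -/
theorem rdet_apply_one (lam : Fin M → ℂ) :
    rdet (Matrix.of fun i j => (if i = j then LinearMap.mulLeft ℂ Q.v + (Q.du : S →ₗ[ℂ] S) -
        algebraMap ℂ (Module.End ℂ S) (lam i) else 0) -
      ∑ a, LinearMap.mulLeft ℂ (Q.r a) * Q.hatE j i a) 1 = (Q.symbolMatrix lam).det := by
  rw [← BetheGaudin.rdet_apply_one (R := ℂ) (Q.symbolMatrix lam)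
    -- The same matrix q arises from two sources: from ∂/∂u through r_a' = -r_a², and from r_a x_ja
    -- ∂/∂x_ia acting on the factor x_ia of column i. This coincidence is exactly the hypothesis of
    -- the abstract Capelli identity.
    (Matrix.of fun k l => ∑ a, Q.r a * Q.r a * (Q.y k a * Q.x l a))
    (fun i j => (if i = j then Q.du else 0) - ∑ a, (Q.r a * Q.x j a) • Q.dx i a)]
  · congr 2
    ext i j f
    simp only [Matrix.of_apply, symbolMatrix, LinearMap.sub_apply, LinearMap.add_apply,
      LinearMap.sum_apply, Module.End.mul_apply, LinearMap.mulLeft_apply, hatE_apply,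
      Derivation.coeFn_coe, Derivation.sub_apply, derivation_sum_apply, Derivation.smul_apply,
      smul_eq_mul, sub_mul, Finset.sum_mul]
    have : ∑ a, Q.r a * (Q.x j a * (Q.dx i a f + Q.y i a * f)) =
        ∑ a, Q.r a * (Q.y i a * Q.x j a) * f + ∑ a, Q.r a * Q.x j a * Q.dx i a f := by
      rw [← Finset.sum_add_distrib]
      exact Finset.sum_congr rfl fun a _ => by ring
    rw [this]
    split_ifs
    · simp [Algebra.smul_def]; ring
    · simp; ring
  · intro i j k l
    rw [Derivation.sub_apply, derivation_sum_apply]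
    simp only [Derivation.smul_apply, dx_symbolMatrix, Matrix.of_apply]
    rw [sub_eq_add_neg, ← Finset.sum_neg_distrib]
    congr 1
    · split_ifs
      · rw [du_symbolMatrix]
      · rfl
    · split_ifs
      · exact Finset.sum_congr rfl fun a _ => by simp only [smul_eq_mul]; ring
      · simp

/-! ### The quadratic Hamiltonian and its classical flow on symbols. -/

/-- The quadratic Hamiltonian built from operators `e i j a`. -/
def _root_.BetheGaudin.hamiltonian {A : Type*} [Ring A] [Algebra ℂ A]
    (e : Fin M → Fin M → Fin N → A) (z c : Fin N → ℂ) (lam : Fin M → ℂ) : A :=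
  ∑ a, ∑ i, (2 * (c a * lam i)) • e i i a +
    ∑ a, ∑ b, ∑ i, ∑ j, ((c a - c b) / (z a - z b)) • (e i j a * e j i b)

/-- The effect on symbols of the composition with the quadratic Hamiltonian on the right. -/
def checkHamiltonian (c : Fin N → ℂ) (lam : Fin M → ℂ) : Module.End ℂ S :=
  ∑ a, ∑ i, (2 * (c a * lam i)) • Q.checkE i i a +
    ∑ a, ∑ b, ∑ i, ∑ j, ((c a - c b) / (z a - z b)) • (Q.checkE j i b * Q.checkE i j a)

/-- The classical Hamiltonian vector field. -/
def flow (c : Fin N → ℂ) (lam : Fin M → ℂ) : Derivation ℂ S S :=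
  ∑ a, ∑ i, (2 * (c a * lam i)) • (Q.x i a • Q.dx i a - Q.y i a • Q.dy i a) +
    ∑ a, ∑ b, ∑ i, ∑ j, ((c a - c b) / (z a - z b)) •
      ((Q.x i a * Q.x j b * Q.y i b) • Q.dx j a + (Q.x i a * Q.x j b * Q.y j a) • Q.dx i b -
        (Q.y i b * Q.y j a * Q.x j b) • Q.dy i a - (Q.y i b * Q.y j a * Q.x i a) • Q.dy j b)

/-- Right composition reverses the order of factors, hence the swapped `checkE`. The terms without
derivatives coincide and drop out; a first-order part, the one entering `flow`, and a second-order
part remain. Since a ≠ b, the operators for one index do not differentiate the coefficients of the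
other. -/
theorem hatE_mul_sub_checkE_mul {a b : Fin N} (hab : a ≠ b) (i j : Fin M) (f : S) :
    Q.hatE i j a (Q.hatE j i b f) - Q.checkE j i b (Q.checkE i j a f) =
      (Q.x i a * Q.x j b * Q.y i b * Q.dx j a f + Q.x i a * Q.x j b * Q.y j a * Q.dx i b f -
        Q.y i b * Q.y j a * Q.x j b * Q.dy i a f - Q.y i b * Q.y j a * Q.x i a * Q.dy j b f) +
      (Q.x i a * Q.x j b * Q.dx j a (Q.dx i b f) - Q.y i b * Q.y j a * Q.dy j b (Q.dy i a f)) := by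
  simp only [hatE_apply, checkE_apply, Derivation.leibniz, map_add, smul_eq_mul, Q.dx_x, Q.dx_y,
    Q.dy_x, Q.dy_y, hab, hab.symm, and_false, if_false]
  ring

/-- Differentiating the symbol matrix in x_ja changes only column j, and in y_ia only row i. Both
second derivatives are therefore values of the same Hessian of the determinant, and reversing the
order of the four summation indices matches the two sums term by term. -/
theorem second_order_eq_zero (lam : Fin M → ℂ) (a b : Fin N) :
    ∑ i, ∑ j, (Q.x i a * Q.x j b * Q.dx j a (Q.dx i b (Q.symbolMatrix lam).det) -
      Q.y i b * Q.y j a * Q.dy j b (Q.dy i a (Q.symbolMatrix lam).det)) = 0 := by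
  obtain ⟨B, hB, h⟩ := exists_symm_derivation_derivation_det (R := ℂ) (Q.symbolMatrix lam)
  have hx (i j : Fin M) : Q.dx j a (Q.dx i b (Q.symbolMatrix lam).det) =
      ∑ k, ∑ l, B (k, j) (l, i) * (Q.r a * Q.y k a * (Q.r b * Q.y l b)) := by
    rw [h]
    · simp only [Fintype.sum_prod_type, dx_symbolMatrix, neg_mul_neg, mul_ite, mul_zero, ite_mul,
        zero_mul, Finset.sum_ite_eq, Finset.mem_univ, if_true, Finset.sum_ite_irrel,
        Finset.sum_const_zero]
    · intro k l
      rw [dx_symbolMatrix, map_neg, apply_ite (Q.dx j a)]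
      simp [Q.dx_r, Q.dx_y]
  have hy (i j : Fin M) : Q.dy j b (Q.dy i a (Q.symbolMatrix lam).det) =
      ∑ k, ∑ l, B (j, k) (i, l) * (Q.r b * Q.x k b * (Q.r a * Q.x l a)) := by
    rw [h]
    · simp only [Fintype.sum_prod_type, dy_symbolMatrix, neg_mul_neg, mul_ite, mul_zero, ite_mul,
        zero_mul, Finset.sum_ite_eq, Finset.mem_univ, if_true, Finset.sum_ite_irrel,
        Finset.sum_const_zero]
    · intro k l
      rw [dy_symbolMatrix, map_neg, apply_ite (Q.dy j b)]
      simp [Q.dy_r, Q.dy_x]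
  simp only [hx, hy, Finset.sum_sub_distrib, Finset.mul_sum]
  rw [sub_eq_zero]
  have e1 (F : Fin M → Fin M → Fin M → Fin M → S) :
      ∑ i, ∑ j, ∑ k, ∑ l, F i j k l = ∑ l, ∑ k, ∑ j, ∑ i, F i j k l := by
    calc _ = ∑ p : Fin M × Fin M × Fin M × Fin M, F p.1 p.2.1 p.2.2.1 p.2.2.2 := by
          simp only [Fintype.sum_prod_type]
      _ = ∑ p : Fin M × Fin M × Fin M × Fin M, F p.2.2.2 p.2.2.1 p.2.1 p.1 :=
          Fintype.sum_equiv ⟨fun p => (p.2.2.2, p.2.2.1, p.2.1, p.1),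
            fun p => (p.2.2.2, p.2.2.1, p.2.1, p.1), fun _ => rfl, fun _ => rfl⟩ _ _
            fun _ => rfl
      _ = _ := by simp only [Fintype.sum_prod_type]
  rw [e1]
  refine Finset.sum_congr rfl fun l _ => Finset.sum_congr rfl fun k _ =>
    Finset.sum_congr rfl fun j _ => Finset.sum_congr rfl fun i _ => ?_
  rw [hB]
  ring

/-- The commutator form of the classical flow on the symbol matrix. -/
theorem flow_symbolMatrix (hz : Function.Injective z) (c : Fin N → ℂ) (lam : Fin M → ℂ) (k l : Fin M) :
    Q.flow c lam (Q.symbolMatrix lam k l) =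
      ((Matrix.of fun i j => ∑ a, (2 * c a) • (Q.r a * (Q.y i a * Q.x j a))) * Q.symbolMatrix lam -
        Q.symbolMatrix lam *
          Matrix.of fun i j => ∑ a, (2 * c a) • (Q.r a * (Q.y i a * Q.x j a))) k l := by
  let G (a b : Fin N) : S := (∑ i, Q.x i a * Q.y i b) * (Q.y k a * Q.x l b)
  have hflow : Q.flow c lam (Q.symbolMatrix lam k l) =
      -∑ a, (2 * c a * (lam l - lam k)) • (Q.r a * (Q.y k a * Q.x l a)) -
        ∑ a, ∑ b, ((c a - c b) / (z a - z b)) • ((Q.r a - Q.r b) * (G a b - G b a)) := by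
    rw [flow, Derivation.add_apply, sub_eq_add_neg]
    simp only [derivation_sum_apply, Derivation.smul_apply, Derivation.sub_apply,
      Derivation.add_apply, dx_symbolMatrix, dy_symbolMatrix]
    congr 1
    · rw [← Finset.sum_neg_distrib]
      refine Finset.sum_congr rfl fun a _ => ?_
      simp only [smul_sub, Finset.sum_sub_distrib, smul_neg, smul_eq_mul, mul_neg, mul_ite, mul_zero,
        smul_ite, smul_zero, Finset.sum_neg_distrib, Finset.sum_ite_eq', Finset.mem_univ, if_true]
      simp only [Algebra.smul_def, map_mul, map_sub]
      ring
    · rw [← Finset.sum_neg_distrib]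
      refine Finset.sum_congr rfl fun a _ => ?_
      rw [← Finset.sum_neg_distrib]
      refine Finset.sum_congr rfl fun b _ => ?_
      simp only [← Finset.smul_sum, ← smul_neg]
      congr 1
      simp only [Finset.sum_sub_distrib, Finset.sum_add_distrib, smul_eq_mul, mul_neg, mul_ite,
        mul_zero, Finset.sum_neg_distrib, Finset.sum_ite_eq', Finset.mem_univ, if_true,
        Finset.sum_ite_irrel, Finset.sum_const_zero, G, Finset.sum_mul]
      simp only [← Finset.sum_sub_distrib, ← Finset.sum_add_distrib, ← Finset.sum_neg_distrib,
        Finset.mul_sum]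
      exact Finset.sum_congr rfl fun i _ => by ring
  have hlax : ((Matrix.of fun i j => ∑ a, (2 * c a) • (Q.r a * (Q.y i a * Q.x j a))) *
        Q.symbolMatrix lam - Q.symbolMatrix lam *
          Matrix.of fun i j => ∑ a, (2 * c a) • (Q.r a * (Q.y i a * Q.x j a))) k l =
      -∑ a, (2 * c a * (lam l - lam k)) • (Q.r a * (Q.y k a * Q.x l a)) -
        ∑ a, ∑ b, (2 * c a) • (Q.r a * Q.r b * (G a b - G b a)) := by
    have h3 : ∑ a, (2 * c a * (lam l - lam k)) • (Q.r a * (Q.y k a * Q.x l a)) =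
        (∑ a, (2 * c a) • (Q.r a * (Q.y k a * Q.x l a))) *
          (algebraMap ℂ S (lam l) - algebraMap ℂ S (lam k)) := by
      rw [Finset.sum_mul]
      refine Finset.sum_congr rfl fun a _ => ?_
      simp only [Algebra.smul_def, map_mul, map_sub]
      ring
    rw [h3]
    simp only [Matrix.sub_apply, Matrix.mul_apply, Matrix.of_apply, symbolMatrix, mul_sub, sub_mul,
      mul_ite, ite_mul, mul_zero, zero_mul, Finset.sum_sub_distrib, Finset.sum_ite_eq',
      Finset.sum_ite_eq, Finset.mem_univ, if_true]
    have h1 : ∑ i, (∑ a, (2 * c a) • (Q.r a * (Q.y k a * Q.x i a))) *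
        (∑ b, Q.r b * (Q.y i b * Q.x l b)) =
          ∑ a, ∑ b, (2 * c a) • (Q.r a * Q.r b * G a b) := by
      simp only [Finset.sum_mul_sum]
      simp only [G, Finset.sum_mul, Finset.mul_sum, Finset.smul_sum]
      rw [Finset.sum_comm]
      refine Finset.sum_congr rfl fun a _ => ?_
      rw [Finset.sum_comm]
      refine Finset.sum_congr rfl fun b _ => Finset.sum_congr rfl fun i _ => ?_
      simp only [Algebra.smul_def]
      ring
    have h2 : ∑ i, (∑ b, Q.r b * (Q.y k b * Q.x i b)) *
        (∑ a, (2 * c a) • (Q.r a * (Q.y i a * Q.x l a))) =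
          ∑ a, ∑ b, (2 * c a) • (Q.r a * Q.r b * G b a) := by
      simp only [Finset.sum_mul_sum]
      simp only [G, Finset.sum_mul, Finset.mul_sum, Finset.smul_sum]
      rw [Finset.sum_comm, Finset.sum_congr rfl fun b _ => Finset.sum_comm, Finset.sum_comm]
      refine Finset.sum_congr rfl fun a _ => Finset.sum_congr rfl fun b _ =>
        Finset.sum_congr rfl fun i _ => ?_
      simp only [Algebra.smul_def]
      ring
    rw [h1, h2]
    simp only [smul_sub, Finset.sum_sub_distrib]
    ring
  rw [hflow, hlax]
  congr 1
  -- The relation (z_a - z_b) r_a r_b = r_a - r_b clears the denominator. The result splits into a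
  -- c_a half and a c_b half that are exchanged by a ↔ b, which produces the factor 2 c_a of the Lax
  -- matrix.
  have h1 (a b : Fin N) : ((c a - c b) / (z a - z b)) • ((Q.r a - Q.r b) * (G a b - G b a)) =
      c a • (Q.r a * Q.r b * (G a b - G b a)) + c b • (Q.r b * Q.r a * (G b a - G a b)) := by
    rcases eq_or_ne a b with rfl | hab
    · simp
    · have hz' : z a - z b ≠ 0 := sub_ne_zero.2 (hz.ne hab)
      rw [← Q.smul_r_mul_r, smul_mul_assoc, smul_smul, div_mul_cancel₀ _ hz']
      simp only [Algebra.smul_def, map_sub]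
      ring
  simp only [h1, Finset.sum_add_distrib]
  rw [Finset.sum_comm (f := fun a b => c b • (Q.r b * Q.r a * (G b a - G a b))),
    ← Finset.sum_add_distrib]
  refine Finset.sum_congr rfl fun a _ => ?_
  rw [← Finset.sum_add_distrib]
  refine Finset.sum_congr rfl fun b _ => ?_
  rw [← add_smul, two_mul]

/-- On the determinant the difference of the two sides is the flow plus second-order terms. The flow
annihilates it because the symbol matrix evolves by a commutator, and the second-order terms cancel
by `second_order_eq_zero`. -/
theorem hamiltonian_hatE_det (hz : Function.Injective z) (c : Fin N → ℂ) (lam : Fin M → ℂ) :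
    hamiltonian Q.hatE z c lam (Q.symbolMatrix lam).det =
      Q.checkHamiltonian c lam (Q.symbolMatrix lam).det := by
  have hflow := derivation_det_eq_zero (Q.flow c lam) (Q.symbolMatrix lam) _
    (Q.flow_symbolMatrix hz c lam)
  rw [← sub_eq_zero, ← hflow]
  set f := (Q.symbolMatrix lam).det with hf
  simp only [hamiltonian, checkHamiltonian, flow, LinearMap.add_apply, LinearMap.sum_apply,
    LinearMap.smul_apply, Module.End.mul_apply, Derivation.add_apply, derivation_sum_apply,
    Derivation.smul_apply]
  rw [add_sub_add_comm, ← Finset.sum_sub_distrib, ← Finset.sum_sub_distrib]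
  congr 1
  · refine Finset.sum_congr rfl fun a _ => ?_
    rw [← Finset.sum_sub_distrib]
    refine Finset.sum_congr rfl fun i _ => ?_
    rw [← smul_sub]
    congr 1
    simp only [hatE_apply, checkE_apply, Derivation.sub_apply, Derivation.smul_apply, smul_eq_mul]
    ring
  · refine Finset.sum_congr rfl fun a _ => ?_
    rw [← Finset.sum_sub_distrib]
    refine Finset.sum_congr rfl fun b _ => ?_
    -- For a = b the coefficient is 0 / 0 = 0, so the Hamiltonian has no diagonal quadratic terms.
    rcases eq_or_ne a b with rfl | hab
    · simp
    · have h := Q.second_order_eq_zero lam a b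
      rw [← hf] at h
      simp only [← Finset.smul_sum, ← Finset.sum_sub_distrib, ← smul_sub]
      congr 1
      simp only [Q.hatE_mul_sub_checkE_mul hab, Finset.sum_add_distrib, Derivation.sub_apply, Derivation.add_apply,
        Derivation.smul_apply, smul_eq_mul]
      rw [h, add_zero]

/-- Left and right composition of the identity operator with H both give H, hence the same symbol.
-/
theorem hamiltonian_hatE_one (c : Fin N → ℂ) (lam : Fin M → ℂ) :
    hamiltonian Q.hatE z c lam 1 = Q.checkHamiltonian c lam 1 := by
  simp only [hamiltonian, SymbolRing.checkHamiltonian, LinearMap.add_apply, LinearMap.sum_apply,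
    LinearMap.smul_apply, Module.End.mul_apply]
  congr 1
  · refine Finset.sum_congr rfl fun a _ => Finset.sum_congr rfl fun i _ => ?_
    simp only [hatE_apply, checkE_apply, Derivation.map_one_eq_zero]
    ring
  · refine Finset.sum_congr rfl fun a _ => Finset.sum_congr rfl fun b _ =>
      Finset.sum_congr rfl fun i _ => Finset.sum_congr rfl fun j _ => ?_
    rcases eq_or_ne a b with rfl | hab
    · simp
    · congr 1
      have := Q.hatE_mul_sub_checkE_mul hab i j 1
      simpa [sub_eq_zero] using this

end SymbolRing

end BetheGaudin

end

noncomputable section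

namespace BetheGaudin

/-! ### Naturality of transfer matrices -/

theorem rdet_intertwine {V W : Type*} [AddCommGroup V] [Module ℂ V] [AddCommGroup W] [Module ℂ W]
    {M : ℕ} (ψ : V →ₗ[ℂ] W) (T : Matrix (Fin M) (Fin M) (Module.End ℂ V))
    (T' : Matrix (Fin M) (Fin M) (Module.End ℂ W))
    (h : ∀ i j v, ψ (T i j v) = T' i j (ψ v)) (v : V) : ψ (rdet T v) = rdet T' (ψ v) := by
  have hl (l : List (Fin M × Fin M)) (v : V) :
      ψ ((l.map fun p => T p.1 p.2).prod v) = (l.map fun p => T' p.1 p.2).prod (ψ v) := by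
    induction l with
    | nil => simp
    | cons p l ih => simp [h, ih]
  simp only [rdet, LinearMap.sum_apply, map_sum]
  refine Finset.sum_congr rfl fun σ _ => ?_
  have := hl (List.ofFn fun i => (i, σ i)) v
  rw [List.map_ofFn, List.map_ofFn] at this
  simp only [Units.smul_def, LinearMap.smul_apply, map_zsmul]
  congr 1

namespace DiffOp

variable {B B' : Type} [Ring B] [Algebra ℂ B] [Ring B'] [Algebra ℂ B']

/-- The application of a linear map to the coefficients of a differential operator. -/
def mapCoeff (f : B →ₗ[ℂ] B') : DiffOp B →ₗ[ℂ] DiffOp B' :=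
  Finsupp.lsum (M := B) ℂ fun k => (monomial k).comp f

theorem mapCoeff_monomial (f : B →ₗ[ℂ] B') (k : ℕ) (b : B) :
    mapCoeff f (monomial k b) = monomial k (f b) :=
  lsum_monomial _ k b

theorem coeff_mapCoeff (f : B →ₗ[ℂ] B') (k : ℕ) (c : DiffOp B) :
    coeff k (mapCoeff f c) = f (coeff k c) := by
  induction c using DiffOp.induction with
  | zero => simp only [map_zero]
  | add c c' hc hc' => simp only [map_add, hc, hc']
  | monomial j b =>
    rw [mapCoeff_monomial, coeff_monomial, coeff_monomial]
    split_ifs <;> simp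

theorem coeff_leftCoeff (b : B) (k : ℕ) (c : DiffOp B) :
    coeff k (leftCoeff b c) = b * coeff k c := by
  induction c using DiffOp.induction with
  | zero => simp only [map_zero, mul_zero]
  | add c c' hc hc' => simp only [map_add, hc, hc', mul_add]
  | monomial j x =>
    rw [leftCoeff_monomial, coeff_monomial, coeff_monomial]
    split_ifs <;> simp

theorem coeff_zero_leftPartial (d : B →ₗ[ℂ] B) (c : DiffOp B) :
    coeff 0 (leftPartial d c) = d (coeff 0 c) := by
  induction c using DiffOp.induction with
  | zero => simp only [map_zero]
  | add c c' hc hc' => simp only [map_add, hc, hc']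
  | monomial j x =>
    rw [leftPartial_monomial, map_add, coeff_monomial, coeff_monomial, coeff_monomial]
    split_ifs <;> simp_all

theorem coeff_succ_leftPartial (d : B →ₗ[ℂ] B) (k : ℕ) (c : DiffOp B) :
    coeff (k + 1) (leftPartial d c) = coeff k c + d (coeff (k + 1) c) := by
  induction c using DiffOp.induction with
  | zero => simp only [map_zero, add_zero]
  | add c c' hc hc' => simp only [map_add, hc, hc']; abel
  | monomial j x =>
    rw [leftPartial_monomial, map_add, coeff_monomial, coeff_monomial, coeff_monomial,
      coeff_monomial, apply_ite d, map_zero]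
    simp only [Nat.add_right_cancel_iff]

theorem mapCoeff_leftPartial {f : B →ₗ[ℂ] B'} {d : B →ₗ[ℂ] B} {d' : B' →ₗ[ℂ] B'}
    (h : ∀ b, f (d b) = d' (f b)) (c : DiffOp B) :
    mapCoeff f (leftPartial d c) = leftPartial d' (mapCoeff f c) := by
  induction c using DiffOp.induction with
  | zero => simp only [map_zero]
  | add c c' hc hc' => simp only [map_add, hc, hc']
  | monomial j x =>
    simp only [leftPartial_monomial, map_add, mapCoeff_monomial, h]

theorem mapCoeff_leftCoeff {f : B →ₗ[ℂ] B'} {b : B} {b' : B'}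
    (h : ∀ x, f (b * x) = b' * f x) (c : DiffOp B) :
    mapCoeff f (leftCoeff b c) = leftCoeff b' (mapCoeff f c) := by
  induction c using DiffOp.induction with
  | zero => simp only [map_zero]
  | add c c' hc hc' => simp only [map_add, hc, hc']
  | monomial j x => simp only [leftCoeff_monomial, mapCoeff_monomial, h]

end DiffOp

section Transfer

variable {A A' : Type} [Ring A] [Algebra ℂ A] [Ring A'] [Algebra ℂ A'] {M N : ℕ}

/-- The contraction of the first factor of `ℂ(u) ⊗ A` with a functional on `ℂ(u)`. -/
def contract (A : Type) [AddCommGroup A] [Module ℂ A] (l : RatFunc ℂ →ₗ[ℂ] ℂ) :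
    RatFunc ℂ ⊗[ℂ] A →ₗ[ℂ] A :=
  (TensorProduct.lid ℂ A : ℂ ⊗[ℂ] A →ₗ[ℂ] A) ∘ₗ LinearMap.rTensor A l

@[simp]
theorem contract_tmul {A : Type} [AddCommGroup A] [Module ℂ A] (l : RatFunc ℂ →ₗ[ℂ] ℂ)
    (f : RatFunc ℂ) (a : A) : contract A l (f ⊗ₜ a) = l f • a := by
  simp [contract]

theorem contract_lTensor {A A' : Type} [AddCommGroup A] [Module ℂ A] [AddCommGroup A']
    [Module ℂ A'] (l : RatFunc ℂ →ₗ[ℂ] ℂ) (φ : A →ₗ[ℂ] A') (t : RatFunc ℂ ⊗[ℂ] A) :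
    contract A' l (LinearMap.lTensor (RatFunc ℂ) φ t) = φ (contract A l t) := by
  induction t using TensorProduct.induction_on with
  | zero => simp
  | add x y hx hy => simp only [map_add, hx, hy]
  | tmul f x => simp

theorem contract_smul {A : Type} [AddCommGroup A] [Module ℂ A] (l : RatFunc ℂ →ₗ[ℂ] ℂ)
    (f : RatFunc ℂ) (t : RatFunc ℂ ⊗[ℂ] A) :
    contract A l (f • t) = contract A (l ∘ₗ LinearMap.mulLeft ℂ f) t := by
  induction t using TensorProduct.induction_on with
  | zero => simp
  | add x y hx hy => simp only [smul_add, map_add, hx, hy]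
  | tmul g x => simp [TensorProduct.smul_tmul']

/-- The contraction of a transfer matrix with a functional on `ℂ(u)`. -/
def transferCoeff (e : Fin M → Fin M → Fin N → A) (z : Fin N → ℂ) (lam : Fin M → ℂ)
    (l : RatFunc ℂ →ₗ[ℂ] ℂ) (i : ℕ) : A :=
  contract A l (transferMatrix e z lam i)

theorem lTensor_mul_tmul (φ : A →ₐ[ℂ] A') (f : RatFunc ℂ) (a : A) (t : RatVal A) :
    LinearMap.lTensor (RatFunc ℂ) φ.toLinearMap ((f ⊗ₜ[ℂ] a) * t) =
      (f ⊗ₜ[ℂ] φ a) * LinearMap.lTensor (RatFunc ℂ) φ.toLinearMap t := by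
  induction t using TensorProduct.induction_on with
  | zero => simp
  | add x y hx hy => simp only [mul_add, map_add, hx, hy]
  | tmul g x => simp

theorem lTensor_ratValDeriv (φ : A →ₗ[ℂ] A') (t : RatVal A) :
    LinearMap.lTensor (RatFunc ℂ) φ (ratValDeriv A t) =
      ratValDeriv A' (LinearMap.lTensor (RatFunc ℂ) φ t) := by
  induction t using TensorProduct.induction_on with
  | zero => simp
  | add x y hx hy => simp only [map_add, hx, hy]
  | tmul g x => simp [ratValDeriv]

/-- Naturality in the algebra carries identities between transfer matrices from one realization of
the E_ij^(a) to another, even though ℂ(u) ⊗ A and the differential operators are rebuilt for each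
algebra. -/
theorem map_transferCoeff (φ : A →ₐ[ℂ] A') (e : Fin M → Fin M → Fin N → A) (z : Fin N → ℂ)
    (lam : Fin M → ℂ) (l : RatFunc ℂ →ₗ[ℂ] ℂ) (i : ℕ) :
    φ (transferCoeff e z lam l i) = transferCoeff (fun j k a => φ (e j k a)) z lam l i := by
  have key : DiffOp.mapCoeff (LinearMap.lTensor (RatFunc ℂ) φ.toLinearMap)
      (DiffOp.normalForm (rdet (gaudinMatrix e z lam))) =
        DiffOp.normalForm (rdet (gaudinMatrix (fun j k a => φ (e j k a)) z lam)) := by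
    rw [DiffOp.normalForm, rdet_intertwine _ _
      (gaudinMatrix (fun j k a => φ (e j k a)) z lam), DiffOp.mapCoeff_monomial,
      DiffOp.normalForm]
    · congr 2
      simp [Algebra.TensorProduct.one_def]
    · intro j k c
      simp only [gaudinMatrix, Matrix.of_apply, LinearMap.sub_apply, LinearMap.sum_apply, map_sub,
        map_sum]
      congr 1
      · split_ifs
        · rw [LinearMap.sub_apply, LinearMap.sub_apply, map_sub, Module.algebraMap_end_apply,
            Module.algebraMap_end_apply, map_smul]
          congr 1
          exact DiffOp.mapCoeff_leftPartial (lTensor_ratValDeriv _) c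
        · simp
      · exact Finset.sum_congr rfl fun a _ =>
          DiffOp.mapCoeff_leftCoeff (lTensor_mul_tmul φ _ _) c
  rw [transferCoeff, transferCoeff, transferMatrix, transferMatrix, ← key, DiffOp.coeff_mapCoeff,
    contract_lTensor]
  rfl

/-! ### Generators of the transfer subalgebra -/

theorem ratDeriv_algebraMap (q : Polynomial ℂ) :
    ratDeriv (algebraMap _ (RatFunc ℂ) q) = algebraMap _ (RatFunc ℂ) (Polynomial.derivative q) := by
  have h := ratDerivFun_div q 1 one_ne_zero
  simp only [map_one, div_one, Polynomial.derivative_one, mul_zero, sub_zero, mul_one,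
    one_pow] at h
  exact h

theorem ratValDeriv_smul (f : RatFunc ℂ) (t : RatVal A) :
    ratValDeriv A (f • t) = ratDeriv f • t + f • ratValDeriv A t := by
  induction t using TensorProduct.induction_on with
  | zero => simp
  | add x y hx hy => simp only [smul_add, map_add, hx, hy]; abel
  | tmul g x =>
    simp [ratValDeriv, TensorProduct.smul_tmul', TensorProduct.add_tmul, add_comm, mul_comm]

/-- The polynomials in `u` with values in `A`, as a subspace of `ℂ(u) ⊗ A`. -/
def polyValued (A : Type) [Ring A] [Algebra ℂ A] : Submodule ℂ (RatVal A) :=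
  Submodule.span ℂ (Set.range fun t : Polynomial ℂ × A =>
    (algebraMap (Polynomial ℂ) (RatFunc ℂ) t.1) ⊗ₜ[ℂ] t.2)

theorem map_mem_polyValued {f : RatVal A →ₗ[ℂ] RatVal A'}
    (hf : ∀ (q : Polynomial ℂ) (a : A),
      f ((algebraMap (Polynomial ℂ) (RatFunc ℂ) q) ⊗ₜ[ℂ] a) ∈ polyValued A')
    {t : RatVal A} (ht : t ∈ polyValued A) : f t ∈ polyValued A' := by
  have : polyValued A ≤ (polyValued A').comap f := by
    refine Submodule.span_le.2 ?_
    rintro _ ⟨⟨q, a⟩, rfl⟩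
    exact hf q a
  exact this ht

theorem tmul_mem_polyValued (q : Polynomial ℂ) (a : A) :
    (algebraMap (Polynomial ℂ) (RatFunc ℂ) q) ⊗ₜ[ℂ] a ∈ polyValued A :=
  Submodule.subset_span ⟨(q, a), rfl⟩

theorem smul_mem_polyValued (q : Polynomial ℂ) {t : RatVal A} (ht : t ∈ polyValued A) :
    algebraMap (Polynomial ℂ) (RatFunc ℂ) q • t ∈ polyValued A := by
  refine map_mem_polyValued
    (f := (LinearMap.lsmul (RatFunc ℂ) (RatVal A)
      (algebraMap (Polynomial ℂ) (RatFunc ℂ) q)).restrictScalars ℂ) (fun p a => ?_) ht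
  simpa [TensorProduct.smul_tmul', Algebra.smul_def] using tmul_mem_polyValued (q * p) a

theorem tmul_mul_mem_polyValued (q : Polynomial ℂ) (a : A) {t : RatVal A}
    (ht : t ∈ polyValued A) :
    ((algebraMap (Polynomial ℂ) (RatFunc ℂ) q) ⊗ₜ[ℂ] a) * t ∈ polyValued A := by
  refine map_mem_polyValued (f := LinearMap.mulLeft ℂ _) (fun p b => ?_) ht
  simpa using tmul_mem_polyValued (q * p) (a * b)

theorem ratValDeriv_mem_polyValued {t : RatVal A} (ht : t ∈ polyValued A) :
    ratValDeriv A t ∈ polyValued A := by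
  refine map_mem_polyValued (fun p b => ?_) ht
  rw [ratValDeriv, LinearMap.rTensor_tmul, Derivation.coeFn_coe, ratDeriv_algebraMap]
  exact tmul_mem_polyValued _ _

theorem polyToRatVal_add (P P' : Polynomial A) :
    polyToRatVal (P + P') = polyToRatVal P + polyToRatVal P' :=
  Polynomial.sum_add_index _ _ _ (by simp) (by simp [TensorProduct.tmul_add])

theorem polyToRatVal_smul (c : ℂ) (P : Polynomial A) :
    polyToRatVal (c • P) = c • polyToRatVal P := by
  rw [polyToRatVal, polyToRatVal, Polynomial.sum_smul_index' _ _ _ (by simp), Polynomial.smul_sum]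
  simp

theorem polyToRatVal_monomial (k : ℕ) (a : A) :
    polyToRatVal (Polynomial.monomial k a) = ((RatFunc.X : RatFunc ℂ) ^ k) ⊗ₜ[ℂ] a :=
  Polynomial.sum_monomial_index _ _ (by simp)

theorem exists_polyToRatVal_eq {t : RatVal A} (ht : t ∈ polyValued A) :
    ∃ P : Polynomial A, polyToRatVal P = t := by
  induction ht using Submodule.span_induction with
  | mem t ht =>
    obtain ⟨⟨q, a⟩, rfl⟩ := ht
    induction q using Polynomial.induction_on' with
    | add p q hp hq =>
      obtain ⟨P, hP⟩ := hp
      obtain ⟨P', hP'⟩ := hq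
      refine ⟨P + P', ?_⟩
      rw [polyToRatVal_add, hP, hP']
      simp [TensorProduct.add_tmul]
    | monomial k c =>
      refine ⟨Polynomial.monomial k (c • a), ?_⟩
      rw [polyToRatVal_monomial, ← Polynomial.C_mul_X_pow_eq_monomial]
      simp [← RatFunc.smul_eq_C_mul, TensorProduct.smul_tmul']
  | zero => exact ⟨0, Polynomial.sum_zero_index _⟩
  | add s t _ _ hs ht =>
    obtain ⟨P, hP⟩ := hs
    obtain ⟨P', hP'⟩ := ht
    exact ⟨P + P', by rw [polyToRatVal_add, hP, hP']⟩
  | smul c t _ ht =>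
    obtain ⟨P, hP⟩ := ht
    exact ⟨c • P, by rw [polyToRatVal_smul, hP]⟩

/-! ### Denominators of the transfer matrices. -/

/-- The differential operators of order at most `d` whose coefficient of `∂ ^ k` has a denominator
dividing `p ^ (d - k)`. -/
def boundedDenom (A : Type) [Ring A] [Algebra ℂ A] (p : Polynomial ℂ) (d : ℕ) :
    Submodule ℂ (DiffOp (RatVal A)) where
  carrier := {c | (∀ k, d < k → DiffOp.coeff k c = 0) ∧ ∀ k ≤ d,
    algebraMap (Polynomial ℂ) (RatFunc ℂ) (p ^ (d - k)) • DiffOp.coeff k c ∈ polyValued A}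
  zero_mem' := ⟨fun k _ => map_zero _, fun k _ => by simp⟩
  add_mem' := fun {c c'} hc hc' =>
    ⟨fun k hk => by rw [map_add, hc.1 k hk, hc'.1 k hk, add_zero],
      fun k hk => by rw [map_add, smul_add]; exact add_mem (hc.2 k hk) (hc'.2 k hk)⟩
  smul_mem' := fun r c hc =>
    ⟨fun k hk => by rw [map_smul, hc.1 k hk, smul_zero],
      fun k hk => by rw [map_smul, smul_comm]; exact Submodule.smul_mem _ _ (hc.2 k hk)⟩

/-- This is the identity p^(n+1) t' = p (p^n t)' - n p' (p^n t). -/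
theorem pow_succ_smul_ratValDeriv_mem (p : Polynomial ℂ) (n : ℕ) {t : RatVal A}
    (ht : algebraMap (Polynomial ℂ) (RatFunc ℂ) (p ^ n) • t ∈ polyValued A) :
    algebraMap (Polynomial ℂ) (RatFunc ℂ) (p ^ (n + 1)) • ratValDeriv A t ∈ polyValued A := by
  have h1 := smul_mem_polyValued p (ratValDeriv_mem_polyValued ht)
  have h2 := smul_mem_polyValued (Polynomial.C (n : ℂ) * Polynomial.derivative p) ht
  have : algebraMap (Polynomial ℂ) (RatFunc ℂ) (p ^ (n + 1)) • ratValDeriv A t =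
      algebraMap (Polynomial ℂ) (RatFunc ℂ) p •
        ratValDeriv A (algebraMap (Polynomial ℂ) (RatFunc ℂ) (p ^ n) • t) -
      algebraMap (Polynomial ℂ) (RatFunc ℂ) (Polynomial.C (n : ℂ) * Polynomial.derivative p) •
        algebraMap (Polynomial ℂ) (RatFunc ℂ) (p ^ n) • t := by
    rw [ratValDeriv_smul, ratDeriv_algebraMap, smul_add, smul_smul, smul_smul, smul_smul,
      ← map_mul, ← map_mul, ← map_mul, pow_succ', add_comm, add_sub_assoc, ← sub_smul, ← map_sub]
    have : p * Polynomial.derivative (p ^ n) -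
        Polynomial.C (n : ℂ) * Polynomial.derivative p * p ^ n = 0 := by
      rw [Polynomial.derivative_pow]
      rcases n with _ | n
      · simp
      · rw [Nat.add_sub_cancel]; ring
    rw [this, map_zero, zero_smul, add_zero]
  rw [this]
  exact sub_mem h1 h2

theorem leftPartial_mem_boundedDenom (p : Polynomial ℂ) {d : ℕ} {c : DiffOp (RatVal A)}
    (hc : c ∈ boundedDenom A p d) :
    DiffOp.leftPartial (ratValDeriv A) c ∈ boundedDenom A p (d + 1) := by
  have hD (k : ℕ) (hk : k ≤ d + 1) : algebraMap (Polynomial ℂ) (RatFunc ℂ) (p ^ (d + 1 - k)) •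
      ratValDeriv A (DiffOp.coeff k c) ∈ polyValued A := by
    rcases Nat.lt_or_ge d k with h | h
    · rw [hc.1 k h, map_zero, smul_zero]
      exact zero_mem _
    · rw [Nat.sub_add_comm h]
      exact pow_succ_smul_ratValDeriv_mem _ _ (hc.2 k h)
  constructor
  · intro k hk
    obtain ⟨j, rfl⟩ : ∃ j, k = j + 1 := ⟨k - 1, by omega⟩
    rw [DiffOp.coeff_succ_leftPartial, hc.1 j (by omega), hc.1 (j + 1) (by omega), map_zero,
      add_zero]
  · intro k hk
    rcases k with _ | j
    · rw [DiffOp.coeff_zero_leftPartial]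
      exact hD 0 hk
    · rw [DiffOp.coeff_succ_leftPartial, smul_add]
      refine add_mem ?_ (hD _ hk)
      rw [Nat.add_sub_add_right]
      exact hc.2 j (by omega)

theorem leftCoeff_mem_boundedDenom {p : Polynomial ℂ} {f : RatFunc ℂ} {q : Polynomial ℂ}
    (hf : algebraMap (Polynomial ℂ) (RatFunc ℂ) p * f = algebraMap _ _ q) (a : A) {d : ℕ}
    {c : DiffOp (RatVal A)} (hc : c ∈ boundedDenom A p d) :
    DiffOp.leftCoeff (f ⊗ₜ[ℂ] a) c ∈ boundedDenom A p (d + 1) := by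
  constructor
  · intro k hk
    rw [DiffOp.coeff_leftCoeff, hc.1 k (by omega), mul_zero]
  · intro k hk
    rw [DiffOp.coeff_leftCoeff]
    rcases Nat.lt_or_ge d k with h | h
    · rw [hc.1 k h, mul_zero, smul_zero]
      exact zero_mem _
    · have := tmul_mul_mem_polyValued q a (hc.2 k h)
      rw [Nat.sub_add_comm h, pow_succ', map_mul, ← smul_mul_smul_comm, TensorProduct.smul_tmul',
        smul_eq_mul, hf]
      exact this

theorem gaudinMatrix_mem_boundedDenom (e : Fin M → Fin M → Fin N → A) (z : Fin N → ℂ)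
    (lam : Fin M → ℂ) (i j : Fin M) {d : ℕ} {c : DiffOp (RatVal A)}
    (hc : c ∈ boundedDenom A (∏ a, (Polynomial.X - Polynomial.C (z a))) d) :
    gaudinMatrix e z lam i j c ∈
      boundedDenom A (∏ a, (Polynomial.X - Polynomial.C (z a))) (d + 1) := by
  rw [gaudinMatrix, Matrix.of_apply, LinearMap.sub_apply, LinearMap.sum_apply]
  refine sub_mem ?_ (sum_mem fun a _ => ?_)
  · split_ifs
    · rw [LinearMap.sub_apply, Module.algebraMap_end_apply]
      refine sub_mem (leftPartial_mem_boundedDenom _ hc) (Submodule.smul_mem _ _ ?_)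
      refine ⟨fun k hk => hc.1 k (by omega), fun k hk => ?_⟩
      rcases Nat.lt_or_ge d k with h | h
      · rw [hc.1 k h, smul_zero]
        exact zero_mem _
      · rw [Nat.sub_add_comm h, pow_succ', map_mul, ← smul_smul]
        exact smul_mem_polyValued _ (hc.2 k h)
    · exact zero_mem _
  · refine leftCoeff_mem_boundedDenom
      (q := ∏ b ∈ Finset.univ.erase a, (Polynomial.X - Polynomial.C (z b))) ?_ _ hc
    have h0 : (RatFunc.X - RatFunc.C (z a) : RatFunc ℂ) ≠ 0 := by
      have := (map_ne_zero_iff (algebraMap (Polynomial ℂ) (RatFunc ℂ))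
        (RatFunc.algebraMap_injective ℂ)).2 (Polynomial.X_sub_C_ne_zero (z a))
      simpa using this
    rw [← Finset.mul_prod_erase _ _ (Finset.mem_univ a), map_mul, mul_right_comm]
    simp [h0]

theorem rdet_gaudinMatrix_mem_boundedDenom (e : Fin M → Fin M → Fin N → A) (z : Fin N → ℂ)
    (lam : Fin M → ℂ) :
    DiffOp.normalForm (rdet (gaudinMatrix e z lam)) ∈
      boundedDenom A (∏ a, (Polynomial.X - Polynomial.C (z a))) M := by
  have hone : DiffOp.monomial 0 1 ∈
      boundedDenom A (∏ a, (Polynomial.X - Polynomial.C (z a))) 0 := by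
    refine ⟨fun k hk => ?_, fun k hk => ?_⟩
    · rw [DiffOp.coeff_monomial, if_neg (by omega)]
    · obtain rfl : k = 0 := by omega
      rw [DiffOp.coeff_monomial, if_pos rfl]
      simpa [Algebra.TensorProduct.one_def] using tmul_mem_polyValued (A := A) 1 1
  have hl (l : List (Fin M × Fin M)) :
      (l.map fun p => gaudinMatrix e z lam p.1 p.2).prod (DiffOp.monomial 0 1) ∈
        boundedDenom A (∏ a, (Polynomial.X - Polynomial.C (z a))) l.length := by
    induction l with
    | nil => simpa using hone
    | cons p l ih =>
      rw [List.map_cons, List.prod_cons, Module.End.mul_apply, List.length_cons]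
      exact gaudinMatrix_mem_boundedDenom _ _ _ _ _ ih
  rw [DiffOp.normalForm, rdet, LinearMap.sum_apply]
  refine sum_mem fun σ _ => ?_
  rw [Units.smul_def, LinearMap.smul_apply]
  refine zsmul_mem ?_ _
  have := hl (List.ofFn fun i => (i, σ i))
  rw [List.map_ofFn, List.length_ofFn] at this
  exact this

/-- The functional on `ℂ(u)` that extends the functional `q ↦ q_k` on polynomials. -/
theorem exists_functional_coeff (k : ℕ) :
    ∃ l : RatFunc ℂ →ₗ[ℂ] ℂ, ∀ j, l (RatFunc.X ^ j) = if j = k then 1 else 0 := by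
  have hinj : Function.Injective (IsScalarTower.toAlgHom ℂ (Polynomial ℂ) (RatFunc ℂ)).toLinearMap :=
    RatFunc.algebraMap_injective ℂ
  obtain ⟨g, hg⟩ := LinearMap.exists_leftInverse_of_injective _ (LinearMap.ker_eq_bot.2 hinj)
  refine ⟨Polynomial.lcoeff ℂ k ∘ₗ g, fun j => ?_⟩
  have := LinearMap.congr_fun hg (Polynomial.X ^ j)
  have hX : (IsScalarTower.toAlgHom ℂ (Polynomial ℂ) (RatFunc ℂ)).toLinearMap (Polynomial.X ^ j) =
      RatFunc.X ^ j := by simp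
  rw [LinearMap.comp_apply, hX] at this
  rw [LinearMap.comp_apply, this]
  simp [Polynomial.coeff_X_pow, eq_comm]

theorem contract_polyToRatVal (l : RatFunc ℂ →ₗ[ℂ] ℂ) (P : Polynomial A) :
    contract A l (polyToRatVal P) = P.sum fun k x => l (RatFunc.X ^ k) • x := by
  rw [polyToRatVal, Polynomial.sum, map_sum, Polynomial.sum]
  simp

/-- The transfer subalgebra is generated by the contractions of the transfer matrices. -/
theorem transferSubalgebra_eq_adjoin (e : Fin M → Fin M → Fin N → A) (z : Fin N → ℂ)
    (lam : Fin M → ℂ) :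
    transferSubalgebra e z lam =
      Algebra.adjoin ℂ {x | ∃ i ∈ Finset.Icc 1 M, ∃ l, x = transferCoeff e z lam l i} := by
  apply le_antisymm
  · refine Algebra.adjoin_le ?_
    rintro x ⟨i, hi, P, hP, k, rfl⟩
    obtain ⟨l, hl⟩ := exists_functional_coeff k
    refine Algebra.subset_adjoin ⟨i, hi,
      l ∘ₗ LinearMap.mulLeft ℂ (∏ a : Fin N, (RatFunc.X - RatFunc.C (z a) : RatFunc ℂ) ^ i), ?_⟩
    rw [transferCoeff, ← contract_smul, ← hP, contract_polyToRatVal]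
    simp only [hl, ite_smul, one_smul, zero_smul]
    rw [Polynomial.sum, Finset.sum_ite_eq']
    split_ifs with h
    · rfl
    · exact Polynomial.notMem_support_iff.1 h
  · refine Algebra.adjoin_le ?_
    rintro x ⟨i, hi, l, rfl⟩
    have hi' := Finset.mem_Icc.1 hi
    -- The denominator bound shows that ∏ (u - z_a)^i G_i(u) really is a polynomial in u. Only then
    -- do the generators of `transferSubalgebra` supply all coefficients, and an arbitrary
    -- contraction of G_i is a linear combination of them.
    have hmem := (rdet_gaudinMatrix_mem_boundedDenom e z lam).2 (M - i) (by omega)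
    rw [Nat.sub_sub_self hi'.2] at hmem
    obtain ⟨P, hP⟩ := exists_polyToRatVal_eq hmem
    set f : RatFunc ℂ := ∏ a : Fin N, (RatFunc.X - RatFunc.C (z a) : RatFunc ℂ) ^ i with hf
    have hf' : algebraMap (Polynomial ℂ) (RatFunc ℂ)
        ((∏ a, (Polynomial.X - Polynomial.C (z a))) ^ i) = f := by
      simp [hf, Finset.prod_pow]
    have hf0 : f ≠ 0 := by
      rw [← hf', map_ne_zero_iff _ (RatFunc.algebraMap_injective ℂ)]
      exact pow_ne_zero _ (Finset.prod_ne_zero_iff.2 fun a _ => Polynomial.X_sub_C_ne_zero _)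
    rw [hf'] at hP
    have : transferCoeff e z lam l i = P.sum fun k x => (l ∘ₗ LinearMap.mulLeft ℂ f⁻¹)
        (RatFunc.X ^ k) • x := by
      rw [← contract_polyToRatVal, ← contract_smul, hP, smul_smul, inv_mul_cancel₀ hf0, one_smul]
      rfl
    rw [this, Polynomial.sum]
    refine sum_mem fun k _ => Subalgebra.smul_mem _ ?_ _
    exact Algebra.subset_adjoin ⟨i, hi, P, hP, k, rfl⟩

end Transfer

end BetheGaudin

end

noncomputable section

namespace BetheGaudin

/-! ### The symbol of the transfer matrix -/

section Extension

variable {B : Type*} [CommRing B] [Algebra ℂ B]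

/-- The coefficientwise extension of a derivation to polynomials. -/
def polyDer (d : Derivation ℂ B B) : Derivation ℂ (Polynomial B) (Polynomial B) :=
  (PolynomialModule.equivPolynomialSelf (R := B)).toLinearMap.compDer d.mapCoeffs

theorem coeff_polyDer (d : Derivation ℂ B B) (p : Polynomial B) (k : ℕ) :
    (polyDer d p).coeff k = d (p.coeff k) := rfl

theorem polyDer_C (d : Derivation ℂ B B) (b : B) :
    polyDer d (Polynomial.C b) = Polynomial.C (d b) := by
  ext k
  rw [coeff_polyDer, Polynomial.coeff_C, Polynomial.coeff_C]
  split_ifs <;> simp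

theorem polyDer_X (d : Derivation ℂ B B) : polyDer d Polynomial.X = 0 := by
  ext k
  rw [coeff_polyDer, Polynomial.coeff_X]
  split_ifs <;> simp

theorem polyDer_monomial (d : Derivation ℂ B B) (k : ℕ) (b : B) :
    polyDer d (Polynomial.monomial k b) = Polynomial.monomial k (d b) := by
  ext j
  rw [coeff_polyDer, Polynomial.coeff_monomial, Polynomial.coeff_monomial]
  split_ifs <;> simp

/-- The extension of a derivation of `B` to `ℂ(u) ⊗ B`. -/
def lTensorDer (d : Derivation ℂ B B) :
    Derivation ℂ (RatFunc ℂ ⊗[ℂ] B) (RatFunc ℂ ⊗[ℂ] B) :=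
  Derivation.mk' (LinearMap.lTensor (RatFunc ℂ) (d : B →ₗ[ℂ] B)) fun s t => by
    induction s using TensorProduct.induction_on with
    | zero => simp
    | add x y hx hy => simp only [add_mul, map_add, hx, hy, smul_add, add_smul]; abel
    | tmul f x =>
      induction t using TensorProduct.induction_on with
      | zero => simp
      | add x y hx hy => simp only [mul_add, map_add, hx, hy, smul_add, add_smul]; abel
      | tmul g y => simp [TensorProduct.tmul_add, mul_comm]

@[simp]
theorem lTensorDer_tmul (d : Derivation ℂ B B) (f : RatFunc ℂ) (b : B) :
    lTensorDer d (f ⊗ₜ b) = f ⊗ₜ d b := rfl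

/-- The derivation `d/du` of `ℂ(u) ⊗ B` for a commutative algebra `B`. -/
def rTensorDer (B : Type) [CommRing B] [Algebra ℂ B] :
    Derivation ℂ (RatFunc ℂ ⊗[ℂ] B) (RatFunc ℂ ⊗[ℂ] B) :=
  Derivation.mk' (ratValDeriv B) fun s t => by
    rw [ratValDeriv_mul, smul_eq_mul, smul_eq_mul, mul_comm t]

@[simp]
theorem rTensorDer_tmul {B : Type} [CommRing B] [Algebra ℂ B] (f : RatFunc ℂ) (b : B) :
    rTensorDer B (f ⊗ₜ b) = ratDeriv f ⊗ₜ b := rfl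

end Extension

theorem ratFunc_X_sub_C_ne_zero (w : ℂ) : (RatFunc.X - RatFunc.C w : RatFunc ℂ) ≠ 0 := by
  have := (map_ne_zero_iff (algebraMap (Polynomial ℂ) (RatFunc ℂ))
    (RatFunc.algebraMap_injective ℂ)).2 (Polynomial.X_sub_C_ne_zero w)
  simpa using this

theorem ratDeriv_inv_X_sub_C (w : ℂ) :
    ratDeriv ((RatFunc.X - RatFunc.C w)⁻¹ : RatFunc ℂ) =
      -((RatFunc.X - RatFunc.C w)⁻¹ * (RatFunc.X - RatFunc.C w)⁻¹) := by
  have h := ratDeriv_algebraMap (Polynomial.X - Polynomial.C w)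
  rw [map_sub, RatFunc.algebraMap_X, RatFunc.algebraMap_C] at h
  rw [Derivation.leibniz_inv, h]
  simp [sq]

/-- Polynomials in the variables `x_{ia}` and `y_{ia}`. -/
abbrev PhasePoly (M N : ℕ) : Type := MvPolynomial ((Fin M × Fin N) ⊕ (Fin M × Fin N)) ℂ

variable {M N : ℕ} (z : Fin N → ℂ)

/-- The polynomials in `x_{ia}` and `y_{ia}`, with `∂/∂u = v = r_a = 0`. -/
def phaseRing : SymbolRing M N z (PhasePoly M N) where
  x i a := MvPolynomial.X (Sum.inl (i, a))
  y i a := MvPolynomial.X (Sum.inr (i, a))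
  r _ := 0
  v := 0
  dx i a := MvPolynomial.pderiv (Sum.inl (i, a))
  dy i a := MvPolynomial.pderiv (Sum.inr (i, a))
  du := 0
  smul_r_mul_r := by simp
  dx_x := by
    classical
    intro i a j b
    simp [MvPolynomial.pderiv_X, Pi.single_apply, eq_comm]
  dx_y := by
    classical
    intro i a j b
    simp [MvPolynomial.pderiv_X]
  dx_r := by simp
  dx_v := by simp
  dy_x := by
    classical
    intro i a j b
    simp [MvPolynomial.pderiv_X]
  dy_y := by
    classical
    intro i a j b
    simp [MvPolynomial.pderiv_X, Pi.single_apply, eq_comm]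
  dy_r := by simp
  dy_v := by simp
  du_x := by simp
  du_y := by simp
  du_r := by simp
  du_v := by simp

/-- The ring of symbols: polynomials in `v` over `ℂ(u) ⊗ ℂ[x, y]`. -/
def ratPhaseRing : SymbolRing M N z (Polynomial (RatFunc ℂ ⊗[ℂ] PhasePoly M N)) where
  x i a := Polynomial.C (1 ⊗ₜ (phaseRing z).x i a)
  y i a := Polynomial.C (1 ⊗ₜ (phaseRing z).y i a)
  r a := Polynomial.C ((RatFunc.X - RatFunc.C (z a))⁻¹ ⊗ₜ 1)
  v := Polynomial.X
  dx i a := polyDer (lTensorDer ((phaseRing z).dx i a))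
  dy i a := polyDer (lTensorDer ((phaseRing z).dy i a))
  du := polyDer (rTensorDer (PhasePoly M N))
  smul_r_mul_r a b := by
    rw [← map_mul, Algebra.TensorProduct.tmul_mul_tmul, mul_one, ← Polynomial.C_sub,
      ← TensorProduct.sub_tmul, Polynomial.smul_C, TensorProduct.smul_tmul',
      RatFunc.smul_eq_C_mul, map_sub]
    congr 2
    have h1 := ratFunc_X_sub_C_ne_zero (z a)
    have h2 := ratFunc_X_sub_C_ne_zero (z b)
    field_simp
    ring
  dx_x i a j b := by
    rw [polyDer_C, lTensorDer_tmul, (phaseRing z).dx_x]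
    split_ifs <;> simp [← Algebra.TensorProduct.one_def]
  dx_y i a j b := by rw [polyDer_C, lTensorDer_tmul, (phaseRing z).dx_y]; simp
  dx_r i a b := by rw [polyDer_C, lTensorDer_tmul]; simp
  dx_v i a := polyDer_X _
  dy_x i a j b := by rw [polyDer_C, lTensorDer_tmul, (phaseRing z).dy_x]; simp
  dy_y i a j b := by
    rw [polyDer_C, lTensorDer_tmul, (phaseRing z).dy_y]
    split_ifs <;> simp [← Algebra.TensorProduct.one_def]
  dy_r i a b := by rw [polyDer_C, lTensorDer_tmul]; simp
  dy_v i a := polyDer_X _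
  du_x i a := by rw [polyDer_C, rTensorDer_tmul]; simp
  du_y i a := by rw [polyDer_C, rTensorDer_tmul]; simp
  du_r a := by
    rw [polyDer_C, rTensorDer_tmul, ratDeriv_inv_X_sub_C, ← map_mul,
      Algebra.TensorProduct.tmul_mul_tmul, mul_one, TensorProduct.neg_tmul, map_neg]
  du_v := polyDer_X _

/-- The coefficient of `v ^ k`, contracted with a functional on `ℂ(u)`. -/
def coeffContract (l : RatFunc ℂ →ₗ[ℂ] ℂ) (k : ℕ) :
    Polynomial (RatFunc ℂ ⊗[ℂ] PhasePoly M N) →ₗ[ℂ] PhasePoly M N :=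
  contract (PhasePoly M N) l ∘ₗ (Polynomial.lcoeff _ k).restrictScalars ℂ

theorem coeffContract_apply (l : RatFunc ℂ →ₗ[ℂ] ℂ) (k : ℕ)
    (p : Polynomial (RatFunc ℂ ⊗[ℂ] PhasePoly M N)) :
    coeffContract l k p = contract (PhasePoly M N) l (p.coeff k) := rfl

theorem contract_one_tmul_mul (l : RatFunc ℂ →ₗ[ℂ] ℂ) (q : PhasePoly M N)
    (t : RatFunc ℂ ⊗[ℂ] PhasePoly M N) :
    contract (PhasePoly M N) l ((1 ⊗ₜ q) * t) = q * contract (PhasePoly M N) l t := by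
  induction t using TensorProduct.induction_on with
  | zero => simp
  | add x y hx hy => simp only [mul_add, map_add, hx, hy]
  | tmul g x => simp

theorem coeffContract_C_mul (l : RatFunc ℂ →ₗ[ℂ] ℂ) (k : ℕ) (q : PhasePoly M N)
    (p : Polynomial (RatFunc ℂ ⊗[ℂ] PhasePoly M N)) :
    coeffContract l k (Polynomial.C (1 ⊗ₜ q) * p) = q * coeffContract l k p := by
  rw [coeffContract_apply, Polynomial.coeff_C_mul, contract_one_tmul_mul, coeffContract_apply]

theorem coeffContract_polyDer (l : RatFunc ℂ →ₗ[ℂ] ℂ) (k : ℕ)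
    (d : Derivation ℂ (PhasePoly M N) (PhasePoly M N))
    (p : Polynomial (RatFunc ℂ ⊗[ℂ] PhasePoly M N)) :
    coeffContract l k (polyDer (lTensorDer d) p) = d (coeffContract l k p) := by
  rw [coeffContract_apply, coeff_polyDer]
  exact contract_lTensor l _ _

theorem coeffContract_hatE (l : RatFunc ℂ →ₗ[ℂ] ℂ) (k : ℕ) (i j : Fin M) (a : Fin N)
    (p : Polynomial (RatFunc ℂ ⊗[ℂ] PhasePoly M N)) :
    coeffContract l k ((ratPhaseRing z).hatE i j a p) =
      (phaseRing z).hatE i j a (coeffContract l k p) := by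
  rw [SymbolRing.hatE_apply, SymbolRing.hatE_apply, ratPhaseRing]
  simp only [coeffContract_C_mul, map_add, coeffContract_polyDer]

theorem coeffContract_checkE (l : RatFunc ℂ →ₗ[ℂ] ℂ) (k : ℕ) (i j : Fin M) (a : Fin N)
    (p : Polynomial (RatFunc ℂ ⊗[ℂ] PhasePoly M N)) :
    coeffContract l k ((ratPhaseRing z).checkE i j a p) =
      (phaseRing z).checkE i j a (coeffContract l k p) := by
  rw [SymbolRing.checkE_apply, SymbolRing.checkE_apply, ratPhaseRing]
  simp only [coeffContract_C_mul, map_add, coeffContract_polyDer]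

/-- The symbol of a differential operator in `u` with coefficients in the operators on
`ℂ[x, y]`. -/
def symbol : DiffOp (RatVal (Module.End ℂ (PhasePoly M N))) →ₗ[ℂ]
    Polynomial (RatFunc ℂ ⊗[ℂ] PhasePoly M N) :=
  Finsupp.lsum (M := RatVal (Module.End ℂ (PhasePoly M N))) ℂ fun k =>
    (Polynomial.monomial k).restrictScalars ℂ ∘ₗ
      LinearMap.lTensor (RatFunc ℂ) (LinearMap.applyₗ 1)

theorem symbol_monomial (k : ℕ) (b : RatVal (Module.End ℂ (PhasePoly M N))) :
    symbol (DiffOp.monomial k b) =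
      Polynomial.monomial k (LinearMap.lTensor (RatFunc ℂ) (LinearMap.applyₗ 1) b) :=
  DiffOp.lsum_monomial _ k b

theorem coeff_symbol (c : DiffOp (RatVal (Module.End ℂ (PhasePoly M N)))) (k : ℕ) :
    (symbol c).coeff k = LinearMap.lTensor (RatFunc ℂ) (LinearMap.applyₗ 1) (DiffOp.coeff k c) := by
  induction c using DiffOp.induction with
  | zero => simp
  | add c c' hc hc' => simp only [map_add, Polynomial.coeff_add, hc, hc']
  | monomial j b =>
    rw [symbol_monomial, Polynomial.coeff_monomial, DiffOp.coeff_monomial]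
    split_ifs <;> simp

/-- On symbols, ∂/∂u composed on the left acts as v + d/du, just as ∂/∂x_ja acts as y_ja + ∂/∂x_ja
inside `hatE`. -/
theorem symbol_leftPartial (c : DiffOp (RatVal (Module.End ℂ (PhasePoly M N)))) :
    symbol (DiffOp.leftPartial (ratValDeriv _) c) =
      (ratPhaseRing z).v * symbol c + (ratPhaseRing z).du (symbol c) := by
  induction c using DiffOp.induction with
  | zero => simp
  | add c c' hc hc' => simp only [map_add, hc, hc']; ring
  | monomial j b =>
    rw [DiffOp.leftPartial_monomial, map_add, symbol_monomial, symbol_monomial, symbol_monomial,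
      lTensor_ratValDeriv]
    simp only [ratPhaseRing, polyDer_monomial, Polynomial.X_mul_monomial]
    rfl

theorem symbol_leftCoeff (f : RatFunc ℂ) (i j : Fin M) (a : Fin N)
    (c : DiffOp (RatVal (Module.End ℂ (PhasePoly M N)))) :
    symbol (DiffOp.leftCoeff (f ⊗ₜ (phaseRing z).hatE i j a) c) =
      Polynomial.C (f ⊗ₜ 1) * (ratPhaseRing z).hatE i j a (symbol c) := by
  induction c using DiffOp.induction with
  | zero => simp
  | add c c' hc hc' => simp only [map_add, hc, hc']; ring
  | monomial k b =>
    rw [DiffOp.leftCoeff_monomial, symbol_monomial, symbol_monomial, SymbolRing.hatE_apply,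
      ratPhaseRing]
    simp only [polyDer_monomial, Polynomial.C_mul_monomial, ← map_add]
    congr 1
    induction b using TensorProduct.induction_on with
    | zero => simp
    | add x y hx hy => simp only [mul_add, map_add, hx, hy]; ring
    | tmul g T =>
      simp [SymbolRing.hatE_apply, TensorProduct.tmul_add, mul_add]

/-- `symbol` intertwines each entry of the Gaudin matrix with the corresponding operator on symbols,
so the Capelli identity in `ratPhaseRing` applies. -/
theorem symbol_rdet (lam : Fin M → ℂ) :
    symbol (DiffOp.normalForm (rdet (gaudinMatrix (phaseRing (M := M) z).hatE z lam))) =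
      ((ratPhaseRing z).symbolMatrix lam).det := by
  rw [← SymbolRing.rdet_apply_one, DiffOp.normalForm]
  have h1 : symbol (DiffOp.monomial 0 1) =
      (1 : Polynomial (RatFunc ℂ ⊗[ℂ] PhasePoly M N)) := by
    rw [symbol_monomial]
    simp [Algebra.TensorProduct.one_def]
    rfl
  rw [← h1]
  refine rdet_intertwine (V := DiffOp (RatVal (Module.End ℂ (PhasePoly M N))))
    (W := Polynomial (RatFunc ℂ ⊗[ℂ] PhasePoly M N)) symbol _ _ (fun i j c => ?_) _
  simp only [gaudinMatrix, Matrix.of_apply, LinearMap.sub_apply, LinearMap.sum_apply, map_sub,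
    map_sum]
  congr 1
  · split_ifs
    · simp only [LinearMap.sub_apply, LinearMap.add_apply, map_sub, Module.algebraMap_end_apply,
        map_smul, symbol_leftPartial z, LinearMap.mulLeft_apply, Derivation.coeFn_coe]
    · simp
  · exact Finset.sum_congr rfl fun a _ => symbol_leftCoeff z _ _ _ _ _

theorem transferCoeff_hatE_one (lam : Fin M → ℂ) (l : RatFunc ℂ →ₗ[ℂ] ℂ) (i : ℕ) :
    transferCoeff (phaseRing z).hatE z lam l i 1 =
      coeffContract l (M - i) ((ratPhaseRing z).symbolMatrix lam).det := by
  rw [← symbol_rdet, coeffContract_apply, coeff_symbol, contract_lTensor]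
  rfl

end BetheGaudin

end

noncomputable section

namespace BetheGaudin

/-! ### Commutation with the quadratic Hamiltonian -/

theorem pderiv_pderiv_comm {σ : Type*} (s t : σ) (f : MvPolynomial σ ℂ) :
    MvPolynomial.pderiv s (MvPolynomial.pderiv t f) =
      MvPolynomial.pderiv t (MvPolynomial.pderiv s f) := by
  classical
  have h : ⁅MvPolynomial.pderiv s, MvPolynomial.pderiv t⁆ =
      (0 : Derivation ℂ (MvPolynomial σ ℂ) (MvPolynomial σ ℂ)) :=
    MvPolynomial.derivation_ext fun i => by
      rw [Derivation.commutator_apply]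
      simp [MvPolynomial.pderiv_X, Pi.single_apply, apply_ite]
  have := congrArg (fun D => D f) h
  rwa [Derivation.commutator_apply, Derivation.zero_apply, sub_eq_zero] at this

/-- Naturality applied to the inclusion of the subalgebra. -/
theorem transferCoeff_mem {A : Type} [Ring A] [Algebra ℂ A] {M N : ℕ} {s : Subalgebra ℂ A}
    {e : Fin M → Fin M → Fin N → A} (he : ∀ i j a, e i j a ∈ s) (z : Fin N → ℂ) (lam : Fin M → ℂ)
    (l : RatFunc ℂ →ₗ[ℂ] ℂ) (i : ℕ) : transferCoeff e z lam l i ∈ s := by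
  have h := map_transferCoeff s.val (fun i j a => (⟨e i j a, he i j a⟩ : s)) z lam l i
  simp only [Subalgebra.val_apply] at h
  rw [← h]
  exact Subtype.property _

theorem map_hamiltonian {A A' : Type*} [Ring A] [Algebra ℂ A] [Ring A'] [Algebra ℂ A'] {M N : ℕ}
    (φ : A →ₐ[ℂ] A') (e : Fin M → Fin M → Fin N → A) (z c : Fin N → ℂ) (lam : Fin M → ℂ) :
    φ (hamiltonian e z c lam) = hamiltonian (fun i j a => φ (e i j a)) z c lam := by
  simp [hamiltonian]

theorem hamiltonian_mem {A : Type*} [Ring A] [Algebra ℂ A] {M N : ℕ} {s : Subalgebra ℂ A}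
    {e : Fin M → Fin M → Fin N → A} (he : ∀ i j a, e i j a ∈ s) (z c : Fin N → ℂ)
    (lam : Fin M → ℂ) : hamiltonian e z c lam ∈ s :=
  add_mem (sum_mem fun _ _ => sum_mem fun _ _ => s.smul_mem (he _ _ _) _)
    (sum_mem fun _ _ => sum_mem fun _ _ => sum_mem fun _ _ => sum_mem fun _ _ =>
      s.smul_mem (mul_mem (he _ _ _) (he _ _ _)) _)

variable {M N : ℕ} (z : Fin N → ℂ)

/-- The effect on symbols of the composition with `∂/∂x_{ia}` on the right, and of the composition
with `x_{ia}` on the right. -/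
def rightOperators (M N : ℕ) : Set (Module.End ℂ (PhasePoly M N)) :=
  Set.range (fun s : Fin M × Fin N => LinearMap.mulLeft ℂ (MvPolynomial.X (Sum.inr s))) ∪
    Set.range (fun s : Fin M × Fin N =>
      ((MvPolynomial.pderiv (Sum.inr s) : Derivation ℂ (PhasePoly M N) (PhasePoly M N)) :
        PhasePoly M N →ₗ[ℂ] PhasePoly M N) +
        LinearMap.mulLeft ℂ (MvPolynomial.X (Sum.inl s)))

/-- Associativity of composition: left compositions commute with right compositions. -/
theorem hatE_mem_centralizer (i j : Fin M) (a : Fin N) :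
    (phaseRing z).hatE i j a ∈ Subalgebra.centralizer ℂ (rightOperators M N) := by
  classical
  rw [Subalgebra.mem_centralizer_iff]
  rintro _ (⟨s, rfl⟩ | ⟨s, rfl⟩) <;> refine LinearMap.ext fun f => ?_
  · simp only [Module.End.mul_apply, LinearMap.mulLeft_apply, SymbolRing.hatE_apply, phaseRing,
      Derivation.leibniz, MvPolynomial.pderiv_X, smul_eq_mul]
    simp
    ring
  · simp only [Module.End.mul_apply, LinearMap.mulLeft_apply, SymbolRing.hatE_apply, phaseRing,
      LinearMap.add_apply, Derivation.coeFn_coe, map_add,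
      Derivation.leibniz, MvPolynomial.pderiv_X, smul_eq_mul, pderiv_pderiv_comm (Sum.inr s)]
    rcases eq_or_ne s (j, a) with rfl | h
    · simp
      ring
    · simp only [Pi.single_apply, reduceCtorEq, if_false, Sum.inl.injEq, Sum.inr.injEq, h, h.symm]
      ring

theorem checkHamiltonian_mem_adjoin (c : Fin N → ℂ) (lam : Fin M → ℂ) :
    (phaseRing z).checkHamiltonian c lam ∈ Algebra.adjoin ℂ (rightOperators M N) := by
  have h (i j : Fin M) (a : Fin N) :
      (phaseRing z).checkE i j a ∈ Algebra.adjoin ℂ (rightOperators M N) :=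
    mul_mem (Algebra.subset_adjoin (Or.inl ⟨(j, a), rfl⟩))
      (Algebra.subset_adjoin (Or.inr ⟨(i, a), rfl⟩))
  exact add_mem (sum_mem fun _ _ => sum_mem fun _ _ => Subalgebra.smul_mem _ (h _ _ _) _)
    (sum_mem fun _ _ => sum_mem fun _ _ => sum_mem fun _ _ => sum_mem fun _ _ =>
      Subalgebra.smul_mem _ (mul_mem (h _ _ _) (h _ _ _)) _)

theorem commute_of_mem_adjoin {A : Type*} [Ring A] [Algebra ℂ A] {s : Set A} {T U : A}
    (hT : T ∈ Subalgebra.centralizer ℂ s) (hU : U ∈ Algebra.adjoin ℂ s) : T * U = U * T := by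
  induction hU using Algebra.adjoin_induction with
  | mem x hx => exact ((Subalgebra.mem_centralizer_iff ℂ).1 hT x hx).symm
  | algebraMap r => exact (Algebra.commutes r T).symm
  | add x y _ _ hx hy => rw [mul_add, add_mul, hx, hy]
  | mul x y _ _ hx hy => rw [← mul_assoc, hx, mul_assoc, hy, mul_assoc]

/-- An operator commuting with the right multiplications is determined by its symbol. -/
theorem eq_zero_of_apply_one {T : Module.End ℂ (PhasePoly M N)}
    (hT : T ∈ Subalgebra.centralizer ℂ (rightOperators M N)) (h1 : T 1 = 0) : T = 0 := by
  classical
  rw [Subalgebra.mem_centralizer_iff] at hT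
  have hy (s : Fin M × Fin N) (f : PhasePoly M N) :
      T (MvPolynomial.X (Sum.inr s) * f) = MvPolynomial.X (Sum.inr s) * T f :=
    (LinearMap.congr_fun (hT _ (Or.inl ⟨s, rfl⟩)) f).symm
  have hx (s : Fin M × Fin N) (f : PhasePoly M N) :
      T (MvPolynomial.X (Sum.inl s) * f) = MvPolynomial.pderiv (Sum.inr s) (T f) +
        MvPolynomial.X (Sum.inl s) * T f - T (MvPolynomial.pderiv (Sum.inr s) f) := by
    have := LinearMap.congr_fun (hT _ (Or.inr ⟨s, rfl⟩)) f
    simp only [Module.End.mul_apply, LinearMap.add_apply, Derivation.coeFn_coe,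
      LinearMap.mulLeft_apply, map_add] at this
    rw [this]; ring
  -- The operators in `rightOperators` generate everything from 1. Solving `hx` for T(x f) costs a
  -- derivative of f in y, so the induction on the x-part must hold for all q simultaneously.
  have hprod (p q : MvPolynomial (Fin M × Fin N) ℂ) :
      T (MvPolynomial.rename Sum.inl p * MvPolynomial.rename Sum.inr q) = 0 := by
    induction p using MvPolynomial.induction_on generalizing q with
    | C a =>
      rw [MvPolynomial.rename_C, ← MvPolynomial.smul_eq_C_mul, map_smul]
      have : T (MvPolynomial.rename Sum.inr q) = 0 := by
        induction q using MvPolynomial.induction_on with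
        | C b => rw [MvPolynomial.rename_C, MvPolynomial.C_eq_smul_one, map_smul, h1, smul_zero]
        | add p q hp hq => rw [map_add, map_add, hp, hq, add_zero]
        | mul_X q s hq => rw [map_mul, MvPolynomial.rename_X, mul_comm, hy, hq, mul_zero]
      rw [this, smul_zero]
    | add p p' hp hp' => rw [map_add, add_mul, map_add, hp, hp', add_zero]
    | mul_X p s hp =>
      have hder : MvPolynomial.pderiv (Sum.inr s)
          (MvPolynomial.rename Sum.inl p * MvPolynomial.rename Sum.inr q : PhasePoly M N) =
            MvPolynomial.rename Sum.inl p * MvPolynomial.rename Sum.inr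
              (MvPolynomial.pderiv s q) := by
        have h0 : MvPolynomial.pderiv (Sum.inr s)
            (MvPolynomial.rename Sum.inl p : PhasePoly M N) = 0 := by
          refine MvPolynomial.pderiv_eq_zero_of_notMem_vars fun h => ?_
          have := MvPolynomial.vars_rename _ _ h
          simp at this
        rw [Derivation.leibniz, MvPolynomial.pderiv_rename Sum.inr_injective, h0, smul_zero,
          add_zero, smul_eq_mul]
      have hcomm : (MvPolynomial.rename Sum.inl (p * MvPolynomial.X s) *
          MvPolynomial.rename Sum.inr q : PhasePoly M N) = MvPolynomial.X (Sum.inl s) *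
            (MvPolynomial.rename Sum.inl p * MvPolynomial.rename Sum.inr q) := by
        simp; ring
      rw [hcomm, hx, hder, hp, hp]
      simp
  have hspan (f : PhasePoly M N) : f ∈ Submodule.span ℂ (Set.range
      fun t : MvPolynomial (Fin M × Fin N) ℂ × MvPolynomial (Fin M × Fin N) ℂ =>
        (MvPolynomial.rename Sum.inl t.1 * MvPolynomial.rename Sum.inr t.2 : PhasePoly M N)) := by
    induction f using MvPolynomial.induction_on with
    | C a => exact Submodule.subset_span ⟨(MvPolynomial.C a, 1), by simp⟩
    | add p q hp hq => exact add_mem hp hq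
    | mul_X p s hp =>
      induction hp using Submodule.span_induction with
      | mem x hx =>
        obtain ⟨⟨p, q⟩, rfl⟩ := hx
        rcases s with s | s
        · exact Submodule.subset_span ⟨(p * MvPolynomial.X s, q), by simp; ring⟩
        · exact Submodule.subset_span ⟨(p, q * MvPolynomial.X s), by simp; ring⟩
      | zero => simp
      | add p q _ _ hp hq => rw [add_mul]; exact add_mem hp hq
      | smul a p _ hp => rw [smul_mul_assoc]; exact Submodule.smul_mem _ _ hp
  have hle : Submodule.span ℂ (Set.range
      fun t : MvPolynomial (Fin M × Fin N) ℂ × MvPolynomial (Fin M × Fin N) ℂ =>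
        (MvPolynomial.rename Sum.inl t.1 * MvPolynomial.rename Sum.inr t.2 : PhasePoly M N)) ≤
      LinearMap.ker T := by
    refine Submodule.span_le.2 ?_
    rintro _ ⟨t, rfl⟩
    exact hprod _ _
  exact LinearMap.ext fun f => hle (hspan f)

/-- It suffices to compare symbols. With G a transfer coefficient and Ȟ right composition with H, G
H 1 = G Ȟ 1 = Ȟ G 1, since G commutes with right compositions. Here G 1 is a contracted coefficient
of the symbol determinant, on which Ȟ and H agree. -/
theorem commute_transferCoeff_hatE (hz : Function.Injective z) (c : Fin N → ℂ) (lam : Fin M → ℂ)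
    (l : RatFunc ℂ →ₗ[ℂ] ℂ) (i : ℕ) :
    transferCoeff (phaseRing z).hatE z lam l i * hamiltonian (phaseRing z).hatE z c lam =
      hamiltonian (phaseRing z).hatE z c lam * transferCoeff (phaseRing z).hatE z lam l i := by
  have hG := transferCoeff_mem (hatE_mem_centralizer (M := M) z) z lam l i
  have hH := hamiltonian_mem (hatE_mem_centralizer (M := M) z) z c lam
  rw [← sub_eq_zero]
  refine eq_zero_of_apply_one (sub_mem (mul_mem hG hH) (mul_mem hH hG)) ?_
  have hcheck := LinearMap.congr_fun
    (commute_of_mem_adjoin hG (checkHamiltonian_mem_adjoin z c lam)) 1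
  rw [LinearMap.sub_apply, Module.End.mul_apply, Module.End.mul_apply, SymbolRing.hamiltonian_hatE_one,
    ← Module.End.mul_apply, hcheck, Module.End.mul_apply, transferCoeff_hatE_one, sub_eq_zero]
  have h := congrArg (coeffContract l (M - i))
    ((ratPhaseRing (M := M) z).hamiltonian_hatE_det hz c lam)
  simp only [hamiltonian, SymbolRing.checkHamiltonian, LinearMap.add_apply, LinearMap.sum_apply,
    LinearMap.smul_apply, Module.End.mul_apply, map_add, map_sum, map_smul, coeffContract_hatE,
    coeffContract_checkE] at h
  simp only [hamiltonian, SymbolRing.checkHamiltonian, LinearMap.add_apply, LinearMap.sum_apply,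
    LinearMap.smul_apply, Module.End.mul_apply]
  exact h.symm

/-! ### The second transfer matrix -/

/-- The sum `∑ i, e i i a`. -/
def diagSum {A : Type*} [Ring A] (e : Fin M → Fin M → Fin N → A) (a : Fin N) : A := ∑ i, e i i a

theorem map_diagSum {A A' : Type*} [Ring A] [Algebra ℂ A] [Ring A'] [Algebra ℂ A']
    (φ : A →ₐ[ℂ] A') (e : Fin M → Fin M → Fin N → A) (a : Fin N) :
    φ (diagSum e a) = diagSum (fun i j a => φ (e i j a)) a := by
  simp [diagSum]

/-- The part of the second transfer matrix that is constant on tensor products of symmetric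
powers. -/
def centralPart {A : Type*} [Ring A] [Algebra ℂ A] (e : Fin M → Fin M → Fin N → A)
    (z c : Fin N → ℂ) (lam : Fin M → ℂ) (s : ℂ) : A :=
  algebraMap ℂ A (s * ((∑ i, lam i) ^ 2 - ∑ i, lam i ^ 2)) +
    ∑ a, (2 * (c a * ∑ i, lam i)) • diagSum e a +
    ∑ a, ∑ b, ((c a - c b) / (z a - z b)) • (diagSum e a * diagSum e b)

theorem map_centralPart {A A' : Type*} [Ring A] [Algebra ℂ A] [Ring A'] [Algebra ℂ A']
    (φ : A →ₐ[ℂ] A') (e : Fin M → Fin M → Fin N → A) (z c : Fin N → ℂ) (lam : Fin M → ℂ) (s : ℂ) :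
    φ (centralPart e z c lam s) = centralPart (fun i j a => φ (e i j a)) z c lam s := by
  simp only [centralPart, map_add, map_sum, map_smul, map_mul, map_diagSum, AlgHom.commutes]

theorem centralPart_mem {A : Type*} [Ring A] [Algebra ℂ A] {s : Subalgebra ℂ A}
    {e : Fin M → Fin M → Fin N → A} (he : ∀ i j a, e i j a ∈ s) (z c : Fin N → ℂ)
    (lam : Fin M → ℂ) (t : ℂ) : centralPart e z c lam t ∈ s := by
  have hd (a : Fin N) : diagSum e a ∈ s := sum_mem fun _ _ => he _ _ _
  exact add_mem (add_mem (s.algebraMap_mem _) (sum_mem fun _ _ => s.smul_mem (hd _) _))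
    (sum_mem fun _ _ => sum_mem fun _ _ => s.smul_mem (mul_mem (hd _) (hd _)) _)

end BetheGaudin

end

/-! ### Comparison of the second transfer matrix with the Hamiltonian. -/

noncomputable section

namespace BetheGaudin

variable {M N : ℕ} (z : Fin N → ℂ)

/-- The variable v thus plays the role of the spectral parameter, and the symbol of the second
transfer matrix is a sum of principal 2 × 2 minors. -/
theorem symbolMatrix_eq_charmatrix (lam : Fin M → ℂ) :
    (ratPhaseRing z).symbolMatrix lam = Matrix.charmatrix (Matrix.of fun i j =>
      (1 : RatFunc ℂ) ⊗ₜ[ℂ] (if i = j then algebraMap ℂ (PhasePoly M N) (lam i) else 0) +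
        ∑ a, (RatFunc.X - RatFunc.C (z a))⁻¹ ⊗ₜ[ℂ]
          ((phaseRing z).y i a * (phaseRing z).x j a)) := by
  ext1 i j
  rw [SymbolRing.symbolMatrix, Matrix.of_apply, Matrix.charmatrix_apply, Matrix.of_apply,
    Polynomial.C_add, ← sub_sub]
  congr 1
  · rw [Matrix.diagonal_apply]
    split_ifs
    · rw [Polynomial.algebraMap_apply, Algebra.TensorProduct.algebraMap_apply']
      rfl
    · simp
  · rw [map_sum]
    refine Finset.sum_congr rfl fun a _ => ?_
    simp only [ratPhaseRing]
    rw [← map_mul, ← map_mul]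
    simp

theorem contract_mul (l : RatFunc ℂ →ₗ[ℂ] ℂ) (r : Fin N → RatFunc ℂ) (s t : PhasePoly M N)
    (p q : Fin N → PhasePoly M N) :
    contract _ l ((1 ⊗ₜ[ℂ] s + ∑ a, r a ⊗ₜ[ℂ] p a) * (1 ⊗ₜ[ℂ] t + ∑ a, r a ⊗ₜ[ℂ] q a)) =
      l 1 • (s * t) + ∑ a, l (r a) • (s * q a + p a * t) +
        ∑ a, ∑ b, l (r a * r b) • (p a * q b) := by
  simp only [mul_add, add_mul, Finset.sum_mul, Finset.mul_sum, map_add, map_sum,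
    Algebra.TensorProduct.tmul_mul_tmul, contract_tmul, one_mul, mul_one, smul_add,
    Finset.sum_add_distrib]
  rw [Finset.sum_comm (f := fun a b => l (r a * r b) • (p a * q b))]
  abel

theorem two_smul_coeffContract (hM : 2 ≤ M) (lam : Fin M → ℂ) (l : RatFunc ℂ →ₗ[ℂ] ℂ) :
    (2 : ℂ) • coeffContract l (M - 2) ((ratPhaseRing z).symbolMatrix lam).det =
      ∑ i, ∑ j, contract (PhasePoly M N) l
        (((1 : RatFunc ℂ) ⊗ₜ[ℂ] algebraMap ℂ (PhasePoly M N) (lam i) +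
          ∑ a, (RatFunc.X - RatFunc.C (z a))⁻¹ ⊗ₜ[ℂ]
            ((phaseRing z).y i a * (phaseRing z).x i a)) *
        ((1 : RatFunc ℂ) ⊗ₜ[ℂ] algebraMap ℂ (PhasePoly M N) (lam j) +
          ∑ a, (RatFunc.X - RatFunc.C (z a))⁻¹ ⊗ₜ[ℂ]
            ((phaseRing z).y j a * (phaseRing z).x j a))) -
      ∑ i, ∑ j, contract (PhasePoly M N) l
        (((1 : RatFunc ℂ) ⊗ₜ[ℂ] (if i = j then algebraMap ℂ (PhasePoly M N) (lam i) else 0) +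
          ∑ a, (RatFunc.X - RatFunc.C (z a))⁻¹ ⊗ₜ[ℂ]
            ((phaseRing z).y i a * (phaseRing z).x j a)) *
        ((1 : RatFunc ℂ) ⊗ₜ[ℂ] (if j = i then algebraMap ℂ (PhasePoly M N) (lam j) else 0) +
          ∑ a, (RatFunc.X - RatFunc.C (z a))⁻¹ ⊗ₜ[ℂ]
            ((phaseRing z).y j a * (phaseRing z).x i a))) := by
  rw [coeffContract_apply, symbolMatrix_eq_charmatrix]
  have h := two_mul_charpoly_coeff (Matrix.of fun i j : Fin M =>
      (1 : RatFunc ℂ) ⊗ₜ[ℂ] (if i = j then algebraMap ℂ (PhasePoly M N) (lam i) else 0) +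
        ∑ a, (RatFunc.X - RatFunc.C (z a))⁻¹ ⊗ₜ[ℂ]
          ((phaseRing z).y i a * (phaseRing z).x j a)) (by simpa using hM)
  rw [Fintype.card_fin] at h
  rw [← map_smul, ← Matrix.charpoly]
  have h2 (t : RatFunc ℂ ⊗[ℂ] PhasePoly M N) : (2 : ℂ) • t = 2 * t := by
    rw [two_smul, two_mul]
  rw [h2, h, map_sum, ← Finset.sum_sub_distrib]
  refine Finset.sum_congr rfl fun i _ => ?_
  rw [map_sum, ← Finset.sum_sub_distrib]
  refine Finset.sum_congr rfl fun j _ => ?_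
  rw [map_sub]
  simp only [Matrix.of_apply, if_true]

namespace SymbolRing

variable {z} {S : Type*} [CommRing S] [Algebra ℂ S] (Q : SymbolRing M N z S)

theorem centralPart_sub_hamiltonian_one (c : Fin N → ℂ) (lam : Fin M → ℂ) (s : ℂ) :
    centralPart Q.hatE z c lam s 1 - hamiltonian Q.hatE z c lam 1 =
      s • algebraMap ℂ S ((∑ i, lam i) ^ 2 - ∑ i, lam i ^ 2) +
      ∑ a, (2 * c a) • (algebraMap ℂ S (∑ i, lam i) * (∑ i, Q.y i a * Q.x i a) -
        ∑ i, algebraMap ℂ S (lam i) * (Q.y i a * Q.x i a)) +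
      ∑ a, ∑ b, ((c a - c b) / (z a - z b)) • ∑ i, ∑ j,
        (Q.y i a * Q.x i a * (Q.y j b * Q.x j b) - Q.y i a * Q.x j a * (Q.y j b * Q.x i b)) := by
  have h1 (i : Fin M) (a : Fin N) : Q.hatE i i a 1 = Q.y i a * Q.x i a := by
    rw [hatE_apply, Derivation.map_one_eq_zero]; ring
  have h2 {a b : Fin N} (hab : a ≠ b) (i j k l : Fin M) :
      Q.hatE i j a (Q.hatE k l b 1) = Q.y j a * Q.x i a * (Q.y l b * Q.x k b) := by
    simp only [hatE_apply, Derivation.map_one_eq_zero, Derivation.leibniz, Q.dx_x,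
      Q.dx_y, hab, and_false, if_false, zero_add, mul_one, smul_zero]
    ring
  simp only [centralPart, hamiltonian, diagSum, LinearMap.add_apply, LinearMap.sum_apply,
    LinearMap.smul_apply, Module.End.mul_apply, Module.algebraMap_end_apply, map_sum]
  rw [add_assoc, add_sub_assoc, add_assoc, add_sub_add_comm]
  congr 1
  · simp only [Algebra.smul_def, map_mul, map_sub, map_pow, map_sum, mul_one]
  congr 1
  · rw [← Finset.sum_sub_distrib]
    refine Finset.sum_congr rfl fun a _ => ?_
    simp only [h1, Algebra.smul_def, map_mul, map_sum, mul_sub, Finset.mul_sum, Finset.sum_mul]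
    congr 1
    · exact Finset.sum_congr rfl fun i _ => Finset.sum_congr rfl fun j _ => by ring
    · exact Finset.sum_congr rfl fun i _ => by ring
  · rw [← Finset.sum_sub_distrib]
    refine Finset.sum_congr rfl fun a _ => ?_
    rw [← Finset.sum_sub_distrib]
    refine Finset.sum_congr rfl fun b _ => ?_
    rcases eq_or_ne a b with rfl | hab
    · simp
    · simp only [← Finset.smul_sum, ← smul_sub, ← Finset.sum_sub_distrib, h2 hab]
      congr 1
      rw [Finset.sum_comm]

/-- The diagonal values W a a are left free: they multiply minors of the rank-one matrix y_ia x_ja,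
which vanish. This is where symmetric powers matter, since for them no double poles contribute. -/
theorem sum_minors_eq (c : Fin N → ℂ) (lam : Fin M → ℂ) (s : ℂ) (W : Fin N → Fin N → ℂ)
    (hW : ∀ a b, a ≠ b → W a b = (c a - c b) / (z a - z b)) :
    ∑ i, ∑ j, (s • (algebraMap ℂ S (lam i) * algebraMap ℂ S (lam j)) +
        ∑ a, c a • (algebraMap ℂ S (lam i) * (Q.y j a * Q.x j a) +
          Q.y i a * Q.x i a * algebraMap ℂ S (lam j)) +
        ∑ a, ∑ b, W a b • (Q.y i a * Q.x i a * (Q.y j b * Q.x j b))) -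
      ∑ i, ∑ j, (s • ((if i = j then algebraMap ℂ S (lam i) else 0) *
          (if j = i then algebraMap ℂ S (lam j) else 0)) +
        ∑ a, c a • ((if i = j then algebraMap ℂ S (lam i) else 0) * (Q.y j a * Q.x i a) +
          Q.y i a * Q.x j a * (if j = i then algebraMap ℂ S (lam j) else 0)) +
        ∑ a, ∑ b, W a b • (Q.y i a * Q.x j a * (Q.y j b * Q.x i b))) =
      centralPart Q.hatE z c lam s 1 - hamiltonian Q.hatE z c lam 1 := by
  have hcomm (F : Fin M → Fin M → Fin N → S) :
      ∑ i, ∑ j, ∑ a, F i j a = ∑ a, ∑ i, ∑ j, F i j a :=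
    (Finset.sum_congr rfl fun i _ => Finset.sum_comm).trans Finset.sum_comm
  rw [centralPart_sub_hamiltonian_one]
  simp only [Finset.sum_add_distrib]
  rw [add_sub_add_comm, add_sub_add_comm]
  congr 1
  congr 1
  · simp only [← Finset.smul_sum, ← smul_sub]
    congr 1
    simp only [mul_ite, ite_mul, mul_zero, zero_mul, Finset.sum_ite_eq',
      Finset.mem_univ, if_true, map_sub, map_sum, sq, Finset.sum_mul_sum, map_mul]
  · rw [hcomm, hcomm, ← Finset.sum_sub_distrib]
    refine Finset.sum_congr rfl fun a _ => ?_
    simp only [← Finset.smul_sum, ← smul_sub, mul_smul, Finset.sum_add_distrib, mul_ite, ite_mul,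
      mul_zero, zero_mul, Finset.sum_ite_eq, Finset.sum_ite_eq', Finset.mem_univ, if_true, map_sum,
      ← Finset.mul_sum, ← Finset.sum_mul]
    rw [smul_comm (2 : ℂ), two_smul]
    congr 1
    have : ∑ i, Q.y i a * Q.x i a * algebraMap ℂ S (lam i) =
        ∑ i, algebraMap ℂ S (lam i) * (Q.y i a * Q.x i a) :=
      Finset.sum_congr rfl fun i _ => mul_comm _ _
    rw [this]
    ring
  · rw [hcomm, hcomm, ← Finset.sum_sub_distrib]
    refine Finset.sum_congr rfl fun a _ => ?_
    rw [hcomm, hcomm, ← Finset.sum_sub_distrib]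
    refine Finset.sum_congr rfl fun b _ => ?_
    simp only [← Finset.smul_sum, ← smul_sub, ← Finset.sum_sub_distrib]
    rcases eq_or_ne a b with rfl | hab
    · rw [Finset.sum_eq_zero fun i _ => Finset.sum_eq_zero fun j _ => by ring, smul_zero, smul_zero]
    · rw [hW a b hab]

end SymbolRing

/-- Partial fractions force l(1/((u - z_a)(u - z_b))) = (c_a - c_b)/(z_a - z_b) for a ≠ b, which are
the coefficients of the Hamiltonian. Both sides commute with right compositions, so equality of
symbols is enough. -/
theorem two_smul_transferCoeff_two (hz : Function.Injective z) (hM : 2 ≤ M) (c : Fin N → ℂ)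
    (lam : Fin M → ℂ) (l : RatFunc ℂ →ₗ[ℂ] ℂ)
    (hl : ∀ a, l ((RatFunc.X - RatFunc.C (z a))⁻¹) = c a) :
    (2 : ℂ) • transferCoeff (phaseRing (M := M) z).hatE z lam l 2 =
      centralPart (phaseRing z).hatE z c lam (l 1) - hamiltonian (phaseRing z).hatE z c lam := by
  have hl2 {a b : Fin N} (hab : a ≠ b) :
      l ((RatFunc.X - RatFunc.C (z a))⁻¹ * (RatFunc.X - RatFunc.C (z b))⁻¹) =
        (c a - c b) / (z a - z b) := by
    have hz' : z a - z b ≠ 0 := sub_ne_zero.2 (hz.ne hab)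
    rw [eq_div_iff hz', ← hl, ← hl, ← map_sub, mul_comm, ← smul_eq_mul, ← map_smul]
    congr 1
    have h1 := ratFunc_X_sub_C_ne_zero (z a)
    have h2 := ratFunc_X_sub_C_ne_zero (z b)
    rw [RatFunc.smul_eq_C_mul, map_sub]
    field_simp
    ring
  have he := hatE_mem_centralizer (M := M) z
  rw [← sub_eq_zero]
  refine eq_zero_of_apply_one (sub_mem (Subalgebra.smul_mem _ (transferCoeff_mem he _ _ _ _) _)
    (sub_mem (centralPart_mem he _ _ _ _) (hamiltonian_mem he _ _ _))) ?_
  rw [LinearMap.sub_apply, LinearMap.smul_apply, LinearMap.sub_apply, transferCoeff_hatE_one,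
    two_smul_coeffContract z hM, sub_eq_zero]
  rw [← SymbolRing.sum_minors_eq _ c lam (l 1) (fun a b =>
    l ((RatFunc.X - RatFunc.C (z a))⁻¹ * (RatFunc.X - RatFunc.C (z b))⁻¹)) fun a b => hl2]
  simp only [contract_mul, hl]

end BetheGaudin

end

noncomputable section

namespace BetheGaudin

/-! ### Tensor products of symmetric powers as polynomials -/

variable {M N : ℕ} (n : Fin N → ℕ)

instance : AddCommGroup (SymTensor M n) := Module.addCommMonoidToAddCommGroup ℂ

theorem symPowRep_single (i j : Fin M) (k : ℕ) (p : SymPow M k) :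
    (symPowRep M k (Matrix.single i j 1) p : MvPolynomial (Fin M) ℂ) =
      MvPolynomial.X i * MvPolynomial.pderiv j (p : MvPolynomial (Fin M) ℂ) := by
  change polyDerivation (Matrix.single i j 1) (p : MvPolynomial (Fin M) ℂ) = _
  rw [polyDerivation_apply, Finset.sum_eq_single i, Finset.sum_eq_single j]
  · simp
  · intro b _ hb
    simp [hb.symm]
  · simp
  · intro b _ hb
    simp [hb.symm]
  · simp

theorem tensorAction_E_tprod (i j : Fin M) (a : Fin N) (p : ∀ a, SymPow M (n a)) :
    tensorAction M n (E M N i j a) (PiTensorProduct.tprod ℂ p) =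
      PiTensorProduct.tprod ℂ
        (Function.update p a (symPowRep M (n a) (Matrix.single i j 1) (p a))) := by
  have h : E M N i j a = PiTensorProduct.tprod ℂ (Pi.mulSingle a
      (UniversalEnvelopingAlgebra.ι ℂ (Matrix.single i j (1 : ℂ) : Gl M))) := rfl
  rw [h, tensorAction, PiTensorProduct.liftAlgHom, AlgHom.ofLinearMap_apply,
    PiTensorProduct.lift.tprod, MultilinearMap.compLinearMap_apply,
    PiTensorProduct.mapMultilinear_apply, PiTensorProduct.map_tprod]
  congr 1
  ext1 b
  rcases eq_or_ne b a with rfl | hb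
  · simp
  · simp [Function.update_of_ne hb, Pi.mulSingle_eq_of_ne hb]

/-- The embedding of the tensor product of symmetric powers into the polynomials in the variables
`x_{ia}`. -/
def toPoly : SymTensor M n →ₗ[ℂ] MvPolynomial (Fin M × Fin N) ℂ :=
  PiTensorProduct.lift ((MultilinearMap.mkPiAlgebra ℂ (Fin N)
    (MvPolynomial (Fin M × Fin N) ℂ)).compLinearMap fun a =>
      (MvPolynomial.rename fun i => (i, a)).toLinearMap ∘ₗ (SymPow M (n a)).subtype)

theorem toPoly_tprod (p : ∀ a, SymPow M (n a)) :
    toPoly n (PiTensorProduct.tprod ℂ p) =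
      ∏ a, MvPolynomial.rename (fun i => (i, a)) (p a : MvPolynomial (Fin M) ℂ) := by
  simp [toPoly]

theorem pderiv_rename_of_ne {a b : Fin N} (hab : a ≠ b) (j : Fin M)
    (p : MvPolynomial (Fin M) ℂ) :
    MvPolynomial.pderiv (j, a) (MvPolynomial.rename (fun i => (i, b)) p) = 0 := by
  classical
  refine MvPolynomial.pderiv_eq_zero_of_notMem_vars fun h => ?_
  have := MvPolynomial.vars_rename _ _ h
  simp only [Finset.mem_image, Prod.mk.injEq] at this
  obtain ⟨_, _, _, h⟩ := this
  exact hab h.symm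

theorem toPoly_tensorAction (i j : Fin M) (a : Fin N) (v : SymTensor M n) :
    toPoly n (tensorAction M n (E M N i j a) v) =
      MvPolynomial.X (i, a) * MvPolynomial.pderiv (j, a) (toPoly n v) := by
  induction v using PiTensorProduct.induction_on with
  | smul_tprod r p =>
    simp only [map_smul, tensorAction_E_tprod, toPoly_tprod]
    rw [Derivation.map_smul, derivation_prod,
      ← Finset.mul_prod_erase _ _ (Finset.mem_univ a), Finset.sum_eq_single a]
    · rw [Function.update_self, symPowRep_single, map_mul, MvPolynomial.rename_X,
        MvPolynomial.pderiv_rename (fun _ _ h => (Prod.mk.inj h).1)]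
      rw [Finset.prod_congr rfl fun b hb => by
        rw [Function.update_of_ne (Finset.ne_of_mem_erase hb)]]
      rw [mul_smul_comm]
      congr 1
      ring
    · intro b _ hb
      rw [pderiv_rename_of_ne hb.symm, mul_zero]
    · simp
  | add x y hx hy => simp only [map_add, hx, hy, mul_add]

/-- The monomial basis of the space of homogeneous polynomials. -/
def symPowBasis (M k : ℕ) :
    Module.Basis {d : Fin M →₀ ℕ // d.degree = k} ℂ (SymPow M k) :=
  Module.Basis.mk (v := fun d => ⟨MvPolynomial.monomial d.1 1,
      MvPolynomial.isHomogeneous_monomial 1 d.2⟩)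
    (LinearIndependent.of_comp (SymPow M k).subtype
      ((MvPolynomial.basisMonomials (Fin M) ℂ).linearIndependent.comp _
        Subtype.val_injective))
    (by
      rintro ⟨p, hp⟩ -
      have h : (⟨p, hp⟩ : SymPow M k) = ∑ d : p.support, p.coeff d.1 •
          ⟨MvPolynomial.monomial d.1 1, MvPolynomial.isHomogeneous_monomial 1
            (Finsupp.degree_eq_weight_one (R := ℕ) ▸
              hp (MvPolynomial.mem_support_iff.1 d.2))⟩ := by
        apply Subtype.ext
        rw [Submodule.coe_sum]
        refine (MvPolynomial.as_sum p).trans ?_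
        rw [← Finset.sum_coe_sort]
        simp [MvPolynomial.smul_monomial]
      rw [h]
      refine sum_mem fun d _ => Submodule.smul_mem _ _ (Submodule.subset_span ⟨⟨d.1, ?_⟩, rfl⟩)
      exact Finsupp.degree_eq_weight_one (R := ℕ) ▸ hp (MvPolynomial.mem_support_iff.1 d.2))

theorem coe_symPowBasis (M k : ℕ) (d : {d : Fin M →₀ ℕ // d.degree = k}) :
    (symPowBasis M k d : MvPolynomial (Fin M) ℂ) = MvPolynomial.monomial d.1 1 := by
  simp [symPowBasis]

/-- The indices of the monomial basis of the tensor product of symmetric powers. -/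
abbrev TensorIndex (M : ℕ) {N : ℕ} (n : Fin N → ℕ) : Type :=
  ∀ a : Fin N, {d : Fin M →₀ ℕ // d.degree = n a}

instance (k : ℕ) : Finite {d : Fin M →₀ ℕ // d.degree = k} :=
  (Finsupp.finite_of_degree_le k).subset fun _ hd => le_of_eq hd

instance : Fintype (TensorIndex M n) := Fintype.ofFinite _

/-- The monomial basis of the tensor product of symmetric powers. -/
def tensorBasis : Module.Basis (TensorIndex M n) ℂ (SymTensor M n) :=
  Basis.piTensorProduct fun a => symPowBasis M (n a)

theorem tensorBasis_apply (k : TensorIndex M n) :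
    tensorBasis n k = PiTensorProduct.tprod ℂ fun a => symPowBasis M (n a) (k a) :=
  Basis.piTensorProduct_apply _ _

theorem toPoly_tensorBasis (k : TensorIndex M n) :
    toPoly n (tensorBasis n k) =
      MvPolynomial.monomial (∑ a, (k a).1.mapDomain fun i => (i, a)) 1 := by
  rw [tensorBasis_apply, toPoly_tprod]
  simp only [coe_symPowBasis, MvPolynomial.rename_monomial]
  exact (MvPolynomial.monomial_sum_one _ _).symm

theorem sum_mapDomain_apply (k : TensorIndex M n) (i : Fin M) (a : Fin N) :
    (∑ b, (k b).1.mapDomain fun i => (i, b)) (i, a) = (k a).1 i := by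
  rw [Finsupp.finsetSum_apply, Finset.sum_eq_single a]
  · exact Finsupp.mapDomain_apply (fun _ _ h => (Prod.mk.inj h).1) _ _
  · intro b _ hb
    refine Finsupp.mapDomain_of_notMem_range _ _ ?_
    rintro ⟨_, h⟩
    exact hb (Prod.mk.inj h).2
  · simp

/-- Different tensor factors use disjoint sets of variables, so the exponents of each factor can be
read off from the product monomial. -/
theorem toPoly_injective : Function.Injective (toPoly (M := M) n) := by
  have hli : LinearIndependent ℂ fun k => toPoly n (tensorBasis (M := M) n k) := by
    simp only [toPoly_tensorBasis]
    refine (MvPolynomial.basisMonomials (Fin M × Fin N) ℂ).linearIndependent.comp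
      (fun k : TensorIndex M n => ∑ a, (k a).1.mapDomain fun i => (i, a)) fun k k' h => ?_
    ext a i
    rw [← sum_mapDomain_apply, ← sum_mapDomain_apply]
    exact DFunLike.congr_fun h (i, a)
  intro v w h
  rw [← (tensorBasis n).linearCombination_repr v, ← (tensorBasis n).linearCombination_repr w,
    Finsupp.apply_linearCombination, Finsupp.apply_linearCombination] at h
  exact (tensorBasis n).repr.injective (hli h)

theorem tensorAction_E_self_tensorBasis (i : Fin M) (a : Fin N) (k : TensorIndex M n) :
    tensorAction M n (E M N i i a) (tensorBasis n k) = ((k a).1 i : ℂ) • tensorBasis n k := by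
  rw [tensorBasis_apply, tensorAction_E_tprod]
  have : symPowRep M (n a) (Matrix.single i i 1) (symPowBasis M (n a) (k a)) =
      ((k a).1 i : ℂ) • symPowBasis M (n a) (k a) := by
    apply Subtype.ext
    rw [symPowRep_single, Submodule.coe_smul, coe_symPowBasis, MvPolynomial.X_mul_pderiv_monomial]
    simp [MvPolynomial.smul_monomial]
  rw [this, MultilinearMap.map_update_smul, Function.update_eq_self]

/-! ### Transfer of identities from symbols to tensor products -/

/-- The specialization of `y_{ia}` to `0`. -/
def specialize (M N : ℕ) : PhasePoly M N →ₐ[ℂ] MvPolynomial (Fin M × Fin N) ℂ :=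
  MvPolynomial.aeval (Sum.elim MvPolynomial.X 0)

theorem specialize_surjective : Function.Surjective (specialize M N) := fun p =>
  ⟨MvPolynomial.rename Sum.inl p, by
    rw [specialize, MvPolynomial.aeval_rename]; simp⟩

theorem specialize_pderiv (s : Fin M × Fin N) (q : PhasePoly M N) :
    specialize M N (MvPolynomial.pderiv (Sum.inl s) q) =
      MvPolynomial.pderiv s (specialize M N q) := by
  classical
  induction q using MvPolynomial.induction_on with
  | C a => simp [specialize]
  | add p q hp hq => simp only [map_add, hp, hq]
  | mul_X p t hp =>
    simp only [Derivation.leibniz, map_mul, map_add, hp, smul_eq_mul]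
    congr 2
    rcases t with t | t <;> simp [specialize, MvPolynomial.pderiv_X, Pi.single_apply, apply_ite]

theorem specialize_hatE (z : Fin N → ℂ) (i j : Fin M) (a : Fin N) (q : PhasePoly M N) :
    specialize M N ((phaseRing z).hatE i j a q) =
      MvPolynomial.X (i, a) * MvPolynomial.pderiv (j, a) (specialize M N q) := by
  rw [SymbolRing.hatE_apply, map_mul, map_add, map_mul, ← specialize_pderiv]
  simp [specialize, phaseRing]

/-- The pairs of operators on the tensor product and on symbols that are compatible with the maps to
polynomials in the variables `x_{ia}`. -/
def compatible : Subalgebra ℂ (Module.End ℂ (SymTensor M n) × Module.End ℂ (PhasePoly M N)) where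
  carrier := {T | ∀ v q, toPoly n v = specialize M N q →
    toPoly n (T.1 v) = specialize M N (T.2 q)}
  mul_mem' := fun hS hT v q h => hS _ _ (hT _ _ h)
  add_mem' := fun {S T} hS hT v q h => by
    simp only [Prod.fst_add, Prod.snd_add, LinearMap.add_apply, map_add, hS v q h, hT v q h]
  algebraMap_mem' := fun r v q h => by
    simp [Prod.algebraMap_apply, Module.algebraMap_end_apply, h]

theorem pair_mem_compatible (z : Fin N → ℂ) (i j : Fin M) (a : Fin N) :
    (tensorAction M n (E M N i j a), (phaseRing z).hatE i j a) ∈ compatible n := fun v q h => by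
  rw [toPoly_tensorAction, specialize_hatE, h]

/-- Setting y = 0 turns `hatE` into x_ia ∂/∂x_ja on ℂ[x]. Every polynomial in x lifts to a symbol
and L_n embeds into ℂ[x], so an operator identity on symbols descends to L_n. -/
theorem fst_eq_zero_of_compatible
    {T : Module.End ℂ (SymTensor M n) × Module.End ℂ (PhasePoly M N)} (hT : T ∈ compatible n)
    (h : T.2 = 0) : T.1 = 0 := by
  refine LinearMap.ext fun v => toPoly_injective n ?_
  obtain ⟨q, hq⟩ := specialize_surjective (toPoly n v)
  rw [hT v q hq.symm, h]
  simp

/-- The transfer matrices are formed in the product of the two operator algebras; its projections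
give those on L_n and on symbols, and membership in `compatible` links them. -/
theorem commute_tensorAction_transferCoeff (z : Fin N → ℂ) (hz : Function.Injective z)
    (c : Fin N → ℂ) (lam : Fin M → ℂ) (l : RatFunc ℂ →ₗ[ℂ] ℂ) (i : ℕ) :
    tensorAction M n (transferCoeff (E M N) z lam l i) *
        tensorAction M n (hamiltonian (E M N) z c lam) =
      tensorAction M n (hamiltonian (E M N) z c lam) *
        tensorAction M n (transferCoeff (E M N) z lam l i) := by
  let e (i j : Fin M) (a : Fin N) : Module.End ℂ (SymTensor M n) × Module.End ℂ (PhasePoly M N) :=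
    (tensorAction M n (E M N i j a), (phaseRing z).hatE i j a)
  have he := pair_mem_compatible n z (M := M)
  have hG := transferCoeff_mem (e := e) he z lam l i
  have hH := hamiltonian_mem (e := e) he z c lam
  have h := fst_eq_zero_of_compatible n (sub_mem (mul_mem hG hH) (mul_mem hH hG)) ?_
  · have hG1 := map_transferCoeff (AlgHom.fst ℂ _ _) e z lam l i
    have hH1 := map_hamiltonian (AlgHom.fst ℂ _ _) e z c lam
    simp only [AlgHom.fst_apply, e] at hG1 hH1
    rw [Prod.fst_sub, Prod.fst_mul, Prod.fst_mul, hG1, hH1, sub_eq_zero] at h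
    rw [map_transferCoeff, map_hamiltonian]
    exact h
  · have hG2 := map_transferCoeff (AlgHom.snd ℂ _ _) e z lam l i
    have hH2 := map_hamiltonian (AlgHom.snd ℂ _ _) e z c lam
    simp only [AlgHom.snd_apply, e] at hG2 hH2
    rw [Prod.snd_sub, Prod.snd_mul, Prod.snd_mul, hG2, hH2, sub_eq_zero]
    exact commute_transferCoeff_hatE z hz c lam l i

theorem two_smul_tensorAction_transferCoeff_two (z : Fin N → ℂ) (hz : Function.Injective z)
    (hM : 2 ≤ M) (c : Fin N → ℂ) (lam : Fin M → ℂ) (l : RatFunc ℂ →ₗ[ℂ] ℂ)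
    (hl : ∀ a, l ((RatFunc.X - RatFunc.C (z a))⁻¹) = c a) :
    (2 : ℂ) • tensorAction M n (transferCoeff (E M N) z lam l 2) =
      tensorAction M n (centralPart (E M N) z c lam (l 1)) -
        tensorAction M n (hamiltonian (E M N) z c lam) := by
  let e (i j : Fin M) (a : Fin N) : Module.End ℂ (SymTensor M n) × Module.End ℂ (PhasePoly M N) :=
    (tensorAction M n (E M N i j a), (phaseRing z).hatE i j a)
  have he := pair_mem_compatible n z (M := M)
  have hG := (compatible n).smul_mem (transferCoeff_mem (e := e) he z lam l 2) (2 : ℂ)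
  have hH := hamiltonian_mem (e := e) he z c lam
  have hC := centralPart_mem (e := e) he z c lam (l 1)
  have h := fst_eq_zero_of_compatible n (sub_mem hG (sub_mem hC hH)) ?_
  · have hG1 := map_transferCoeff (AlgHom.fst ℂ _ _) e z lam l 2
    have hH1 := map_hamiltonian (AlgHom.fst ℂ _ _) e z c lam
    have hC1 := map_centralPart (AlgHom.fst ℂ _ _) e z c lam (l 1)
    simp only [AlgHom.fst_apply, e] at hG1 hH1 hC1
    rw [Prod.fst_sub, Prod.fst_sub, Prod.smul_fst, hG1, hH1, hC1, sub_eq_zero] at h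
    rw [map_transferCoeff, map_hamiltonian, map_centralPart]
    exact h
  · have hG2 := map_transferCoeff (AlgHom.snd ℂ _ _) e z lam l 2
    have hH2 := map_hamiltonian (AlgHom.snd ℂ _ _) e z c lam
    have hC2 := map_centralPart (AlgHom.snd ℂ _ _) e z c lam (l 1)
    simp only [AlgHom.snd_apply, e] at hG2 hH2 hC2
    rw [Prod.snd_sub, Prod.snd_sub, Prod.smul_snd, hG2, hH2, hC2, sub_eq_zero]
    exact two_smul_transferCoeff_two z hz hM c lam l hl

/-- Euler's identity: the operator measures the degree in the a-th factor. -/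
theorem tensorAction_diagSum (a : Fin N) :
    tensorAction M n (diagSum (E M N) a) = (n a : ℂ) • 1 := by
  refine (tensorBasis n).ext fun k => ?_
  simp only [diagSum, map_sum, LinearMap.sum_apply, tensorAction_E_self_tensorBasis,
    LinearMap.smul_apply, Module.End.one_apply]
  rw [← Finset.sum_smul, ← Nat.cast_sum, ← Finsupp.degree_eq_sum, (k a).2]

theorem tensorAction_centralPart (z c : Fin N → ℂ) (lam : Fin M → ℂ) (s : ℂ) :
    ∃ t : ℂ, tensorAction M n (centralPart (E M N) z c lam s) = t • 1 := by
  have h : tensorAction M n (centralPart (E M N) z c lam s) ∈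
      (⊥ : Subalgebra ℂ (Module.End ℂ (SymTensor M n))) := by
    have hd (a : Fin N) : tensorAction M n (diagSum (E M N) a) ∈
        (⊥ : Subalgebra ℂ (Module.End ℂ (SymTensor M n))) := by
      rw [tensorAction_diagSum]
      exact Subalgebra.smul_mem _ (one_mem _) _
    simp only [centralPart, map_add, map_sum, map_smul, map_mul, AlgHom.commutes]
    exact add_mem (add_mem (mul_mem (Subalgebra.algebraMap_mem _ _) (Subalgebra.algebraMap_mem _ _))
      (sum_mem fun _ _ => Subalgebra.smul_mem _ (hd _) _))
      (sum_mem fun _ _ => sum_mem fun _ _ => Subalgebra.smul_mem _ (mul_mem (hd _) (hd _)) _)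
  obtain ⟨t, ht⟩ := Algebra.mem_bot.1 h
  exact ⟨t, by rw [← ht, Algebra.algebraMap_eq_smul_one]⟩

end BetheGaudin

end

noncomputable section

namespace BetheGaudin

/-! ### Generic simplicity of the spectrum in a linear family of matrices -/

section CharpolyDisc

variable {ι : Type*} [Fintype ι] [DecidableEq ι]

/-- The resultant of the characteristic polynomial and its derivative. -/
def charpolyDisc {R : Type*} [CommRing R] (A : Matrix ι ι R) : R :=
  Polynomial.resultant A.charpoly (Polynomial.derivative A.charpoly) (Fintype.card ι)
    (Fintype.card ι - 1)

/-- The resultant is taken with fixed degrees rather than the actual ones, so it is a universal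
polynomial in the matrix entries and commutes with every ring homomorphism. -/
theorem charpolyDisc_map {R S : Type*} [CommRing R] [CommRing S] (φ : R →+* S)
    (A : Matrix ι ι R) : charpolyDisc (A.map φ) = φ (charpolyDisc A) := by
  rw [charpolyDisc, charpolyDisc, ← Polynomial.resultant_map_map, ← Polynomial.derivative_map,
    Matrix.charpoly_map]

theorem charpolyDisc_ne_zero_iff {K : Type*} [Field K] [CharZero K] (A : Matrix ι ι K) :
    charpolyDisc A ≠ 0 ↔ A.charpoly.Separable := by
  have h : charpolyDisc A =
      Polynomial.resultant A.charpoly (Polynomial.derivative A.charpoly) := by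
    rw [charpolyDisc, Polynomial.natDegree_derivative, Matrix.charpoly_natDegree_eq_dim]
  rw [h, Ne, Polynomial.resultant_eq_zero_iff, Polynomial.separable_def]
  simp [A.charpoly_monic.ne_zero]

theorem charpoly_smul_comp {R : Type*} [CommRing R] (t : R) (A : Matrix ι ι R) :
    (t • A).charpoly.comp (Polynomial.C t * Polynomial.X) =
      Polynomial.C t ^ Fintype.card ι * A.charpoly := by
  rw [Matrix.charpoly, Matrix.charpoly, ← Polynomial.coe_compRingHom_apply, RingHom.map_det,
    ← Matrix.det_smul]
  congr 1
  ext1 i j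
  by_cases hij : i = j
  · subst hij
    simp [Matrix.charmatrix_apply_eq, mul_sub]
  · simp [Matrix.charmatrix_apply_ne _ _ _ hij]

theorem separable_charpoly_of_smul {K : Type*} [Field K] {t : K} (ht : t ≠ 0)
    {A : Matrix ι ι K} (h : (t • A).charpoly.Separable) : A.charpoly.Separable := by
  have hC : IsUnit (Polynomial.C t) := Polynomial.isUnit_C.2 ht.isUnit
  rw [Polynomial.separable_def] at h
  have h2 : ((t • A).charpoly.comp (Polynomial.C t * Polynomial.X)).Separable := by
    rw [Polynomial.separable_def, Polynomial.derivative_comp]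
    refine (isCoprime_mul_unit_left_right ?_ _ _).2
      (h.map (Polynomial.compRingHom (Polynomial.C t * Polynomial.X)))
    simpa using ht
  rw [charpoly_smul_comp] at h2
  exact h2.of_mul_right

theorem exists_polynomial_separable_charpoly {σ : Type*} [Fintype σ]
    (A : σ → Matrix ι ι ℂ) (B : Matrix ι ι ℂ) (mu : σ → ℂ) (d : ι → ℂ)
    (hd : Function.Injective d) (hA : ∑ s, mu s • A s = Matrix.diagonal d) :
    ∃ P : MvPolynomial σ ℂ, P ≠ 0 ∧ ∀ lam : σ → ℂ, MvPolynomial.eval lam P ≠ 0 →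
      (∑ s, lam s • A s + B).charpoly.Separable := by
  let F : Matrix ι ι (MvPolynomial σ ℂ) :=
    ∑ s, (MvPolynomial.X s : MvPolynomial σ ℂ) • (A s).map MvPolynomial.C + B.map MvPolynomial.C
  have hF (lam : σ → ℂ) : F.map (MvPolynomial.eval lam) = ∑ s, lam s • A s + B := by
    ext i j
    simp [F, Matrix.sum_apply]
  have heval (lam : σ → ℂ) : MvPolynomial.eval lam (charpolyDisc F) ≠ 0 ↔
      (∑ s, lam s • A s + B).charpoly.Separable := by
    rw [← charpolyDisc_ne_zero_iff, ← hF, charpolyDisc_map]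
  refine ⟨charpolyDisc F, fun h0 => ?_, fun lam h => (heval lam).1 h⟩
  -- Along λ = μ / t, multiplying the family by t gives diag(d) + t B. At t = 0 its eigenvalues are
  -- the distinct d, so its discriminant is a nonzero polynomial in t.
  let G : Matrix ι ι (Polynomial ℂ) :=
    (Matrix.diagonal d).map Polynomial.C + (Polynomial.X : Polynomial ℂ) • B.map Polynomial.C
  have hG (t : ℂ) : G.map (Polynomial.evalRingHom t) = Matrix.diagonal d + t • B := by
    ext i j
    rcases eq_or_ne i j with rfl | hij
    · simp [G]; ring
    · simp [G, hij]; ring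
  have hGeval (t : ℂ) : Polynomial.eval t (charpolyDisc G) ≠ 0 ↔
      (Matrix.diagonal d + t • B).charpoly.Separable := by
    rw [← charpolyDisc_ne_zero_iff, ← hG, charpolyDisc_map, Polynomial.coe_evalRingHom]
  have hG0 : charpolyDisc G ≠ 0 := by
    intro h
    refine (hGeval 0).2 ?_ (by rw [h, Polynomial.eval_zero])
    rw [zero_smul, add_zero, Matrix.charpoly_diagonal]
    exact Polynomial.separable_prod_X_sub_C_iff.2 hd
  obtain ⟨t, ht⟩ := Infinite.exists_notMem_finset
    (insert 0 (charpolyDisc G).roots.toFinset)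
  rw [Finset.mem_insert, not_or, Multiset.mem_toFinset, Polynomial.mem_roots hG0] at ht
  -- Some t ≠ 0 avoids the finitely many zeros. Rescaling by t does not affect separability, so the
  -- discriminant of the family is nonzero at μ / t, contradicting `h0`.
  refine (heval fun s => t⁻¹ * mu s).2 (separable_charpoly_of_smul ht.1 ?_)
    (by rw [h0, map_zero])
  have hscale : t • (∑ s, (t⁻¹ * mu s) • A s + B) = Matrix.diagonal d + t • B := by
    rw [smul_add, Finset.smul_sum, ← hA]
    congr 1
    refine Finset.sum_congr rfl fun s _ => ?_
    rw [smul_smul, mul_inv_cancel_left₀ ht.1]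
  rw [hscale]
  exact (hGeval t).1 ht.2

end CharpolyDisc

/-! ### Bases of eigenvectors -/

section Eigenbasis

variable {V : Type*} [AddCommGroup V] [Module ℂ V]

theorem exists_eigenbasis [FiniteDimensional ℂ V] {f : Module.End ℂ V} (hf : f.charpoly.Separable) :
    ∃ (v : Module.Basis (Fin (Module.finrank ℂ V)) ℂ V)
      (t : Fin (Module.finrank ℂ V) → ℂ), Function.Injective t ∧ ∀ k, f (v k) = t k • v k := by
  have hcard : Fintype.card f.charpoly.roots.toFinset = Module.finrank ℂ V := by
    rw [Fintype.card_coe, Multiset.toFinset_card_of_nodup (Polynomial.nodup_roots hf),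
      IsAlgClosed.card_roots_eq_natDegree, LinearMap.charpoly_natDegree]
  let e := (Fintype.equivFinOfCardEq hcard).symm
  have hev (k : Fin (Module.finrank ℂ V)) : f.HasEigenvalue (e k : ℂ) := by
    rw [Module.End.hasEigenvalue_iff_isRoot_charpoly]
    exact Polynomial.isRoot_of_mem_roots (Multiset.mem_toFinset.1 (e k).2)
  choose v hv using fun k => (hev k).exists_hasEigenvector
  have hinj : Function.Injective fun k => (e k : ℂ) := Subtype.val_injective.comp e.injective
  have hli := f.eigenvectors_linearIndependent' _ hinj v hv
  refine ⟨Module.Basis.mk hli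
    (hli.span_eq_top_of_card_eq_finrank' (Fintype.card_fin _)).ge, _, hinj, fun k => ?_⟩
  simpa using (hv k).apply_eq_smul

theorem repr_apply_of_eigenbasis {κ : Type*} {f : Module.End ℂ V} {v : Module.Basis κ ℂ V}
    {t : κ → ℂ} (hf : ∀ k, f (v k) = t k • v k) (w : V) (j : κ) :
    v.repr (f w) j = t j * v.repr w j := by
  have h : (v.coord j) ∘ₗ f = t j • v.coord j := v.ext fun i => by
    rcases eq_or_ne i j with rfl | hij <;> simp [*]
  exact LinearMap.congr_fun h w

/-- Comparing the j-th coordinates of g f v_k = f g v_k gives (t_k - t_j) times the j-th coordinate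
of g v_k equal to zero. -/
theorem exists_smul_of_commute {κ : Type*} {f g : Module.End ℂ V} {v : Module.Basis κ ℂ V}
    {t : κ → ℂ} (ht : Function.Injective t) (hf : ∀ k, f (v k) = t k • v k)
    (hfg : g * f = f * g) (k : κ) : ∃ c : ℂ, g (v k) = c • v k := by
  refine ⟨v.repr (g (v k)) k, v.ext_elem fun j => ?_⟩
  rcases eq_or_ne k j with rfl | hkj
  · simp
  · have h := congrArg (fun w => v.repr w j) (LinearMap.congr_fun hfg (v k))
    simp only [Module.End.mul_apply, hf, map_smul, repr_apply_of_eigenbasis hf, Finsupp.smul_apply, smul_eq_mul] at h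
    have h' : (t k - t j) * v.repr (g (v k)) j = 0 := by rw [sub_mul, h, sub_self]
    rcases mul_eq_zero.1 h' with h' | h'
    · exact absurd (ht (sub_eq_zero.1 h')) hkj
    · simp [h', hkj]

/-- By `hW`, the basis vectors lying in W already span W, and they form the required basis. The
family of eigenvalues inherits injectivity from `hsep`. -/
theorem hasSimpleJointSpectrum_of_basis {A κ : Type*} [Ring A] [Algebra ℂ A] [Finite κ]
    (ρ : A →ₐ[ℂ] Module.End ℂ V) (S : Subalgebra ℂ A) (W : Submodule ℂ V)
    (v : Module.Basis κ ℂ V) (hS : ∀ s ∈ S, ∀ k, ∃ c : ℂ, ρ s (v k) = c • v k)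
    (hW : ∀ w ∈ W, ∀ k, v.repr w k ≠ 0 → v k ∈ W)
    (hsep : ∀ k k', k ≠ k' → ∃ s ∈ S, ∀ c : ℂ, ρ s (v k) = c • v k → ρ s (v k') ≠ c • v k') :
    HasSimpleJointSpectrum ρ S W := by
  classical
  have := Fintype.ofFinite κ
  let v' : {k // v k ∈ W} → W := fun k => ⟨v k, k.2⟩
  have hli : LinearIndependent ℂ v' :=
    LinearIndependent.of_comp W.subtype (v.linearIndependent.comp _ Subtype.val_injective)
  have hspan : ⊤ ≤ Submodule.span ℂ (Set.range v') := by
    rintro ⟨w, hw⟩ -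
    have h : (⟨w, hw⟩ : W) = ∑ k : {k // v k ∈ W}, v.repr w k • v' k := by
      apply Subtype.ext
      rw [Submodule.coe_sum]
      refine (v.sum_repr w).symm.trans ?_
      rw [← Finset.sum_filter_of_ne (p := fun k => v k ∈ W)
        fun k _ h => hW w hw k fun h0 => h (by rw [h0, zero_smul])]
      exact Finset.sum_subtype _ (by simp) _
    rw [h]
    exact sum_mem fun k _ => Submodule.smul_mem _ _ (Submodule.subset_span ⟨k, rfl⟩)
  let e := (Fintype.equivFin {k // v k ∈ W}).symm
  choose! c hc using hS
  refine ⟨_, (Module.Basis.mk hli hspan).reindex e.symm, fun i s => c s (e i), fun i s => ?_,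
    fun i j hij => ?_⟩
  · simpa [v'] using hc s s.2 (e i)
  · by_contra hne
    obtain ⟨s, hs, h⟩ := hsep (e i) (e j) fun h => hne (e.injective (Subtype.ext h))
    refine h _ (hc s hs _) ?_
    rw [hc s hs]
    congr 1
    exact (congrFun hij ⟨s, hs⟩).symm

end Eigenbasis

end BetheGaudin

end

noncomputable section

namespace BetheGaudin

/-! ### Simplicity of the spectrum of the quadratic Hamiltonian -/

theorem exists_linearIndependent_monomials (M N : ℕ) :
    ∃ (c : Fin N → ℂ) (mu : Fin M → ℂ),
      LinearIndependent ℤ fun s : Fin N × Fin M => c s.1 * mu s.2 := by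
  have hτ : Transcendental ℤ ((liouvilleNumber (2 : ℕ) : ℝ) : ℂ) := by
    have h : Function.Injective (algebraMap ℝ ℂ) := (algebraMap ℝ ℂ).injective
    exact (transcendental_algebraMap_iff h).2 (transcendental_liouvilleNumber le_rfl)
  set τ : ℂ := ((liouvilleNumber (2 : ℕ) : ℝ) : ℂ)
  have hli : LinearIndependent ℤ fun k : ℕ => τ ^ k := by
    have h := (Polynomial.basisMonomials ℤ).linearIndependent.map' (Polynomial.aeval τ).toLinearMap
      (LinearMap.ker_eq_bot.2 (transcendental_iff_injective.1 hτ))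
    simpa [Function.comp_def] using h
  -- The products c_a μ_i are the powers τ^(M a + i). Since i < M, the exponents are distinct, and
  -- powers of the transcendental τ are linearly independent.
  refine ⟨fun a => τ ^ (M * (a : ℕ)), fun i => τ ^ (i : ℕ), ?_⟩
  have h := hli.comp (fun s : Fin N × Fin M => (finProdFinEquiv s : ℕ))
    (Fin.val_injective.comp finProdFinEquiv.injective)
  convert h using 2 with s
  simp [finProdFinEquiv, pow_add, mul_comm]

/-- The sums are the eigenvalues, on the monomial basis, of the λ-linear part of the Hamiltonian at
λ = μ. Exponents are integers, so independence over ℤ recovers them all from one sum. -/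
theorem exists_injective_weight_sum (M : ℕ) {N : ℕ} (n : Fin N → ℕ) :
    ∃ (c : Fin N → ℂ) (mu : Fin M → ℂ), Function.Injective fun k : TensorIndex M n =>
      ∑ i, mu i * ∑ a, 2 * c a * ((k a).1 i : ℂ) := by
  obtain ⟨c, mu, h⟩ := exists_linearIndependent_monomials M N
  refine ⟨c, mu, fun k k' hk => ?_⟩
  have h0 := Fintype.linearIndependent_iff.1 h
    (fun s => ((k s.1).1 s.2 : ℤ) - ((k' s.1).1 s.2 : ℤ)) ?_
  · ext a i
    exact_mod_cast sub_eq_zero.1 (h0 (a, i))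
  · simp only [Finset.mul_sum] at hk
    rw [Fintype.sum_prod_type, Finset.sum_comm]
    rw [← sub_eq_zero, ← Finset.sum_sub_distrib] at hk
    refine (mul_eq_zero.1 (Eq.trans ?_ hk)).resolve_left (two_ne_zero (α := ℂ))
    rw [Finset.mul_sum]
    refine Finset.sum_congr rfl fun i _ => ?_
    rw [← Finset.sum_sub_distrib, Finset.mul_sum]
    refine Finset.sum_congr rfl fun a _ => ?_
    rw [zsmul_eq_mul]
    push_cast
    ring

/-- For distinct z_a the functions 1/(u - z_a) are linearly independent, so their values can be
prescribed. -/
theorem exists_functional_inv_X_sub_C {N : ℕ} {z : Fin N → ℂ} (hz : Function.Injective z)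
    (c : Fin N → ℂ) :
    ∃ l : RatFunc ℂ →ₗ[ℂ] ℂ, ∀ a, l ((RatFunc.X - RatFunc.C (z a))⁻¹) = c a := by
  have hX : Transcendental ℂ (RatFunc.X : RatFunc ℂ) := by
    rw [← RatFunc.algebraMap_X]
    exact (transcendental_algebraMap_iff (RatFunc.algebraMap_injective ℂ)).2
      (Polynomial.transcendental_X ℂ)
  have h := hX.linearIndependent_sub_inv.comp z hz
  obtain ⟨l, hl⟩ := (Module.Basis.span h).constr ℂ c |>.exists_extend
  refine ⟨l, fun a => ?_⟩
  have h1 := LinearMap.congr_fun hl (Module.Basis.span h a)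
  rw [Module.Basis.constr_basis, LinearMap.comp_apply, Submodule.subtype_apply,
    Module.Basis.span_apply] at h1
  exact h1

variable {M N : ℕ}

theorem hamiltonian_eq_sum {A : Type*} [Ring A] [Algebra ℂ A] (e : Fin M → Fin M → Fin N → A)
    (z c : Fin N → ℂ) (lam : Fin M → ℂ) :
    hamiltonian e z c lam =
      ∑ i, lam i • (∑ a, (2 * c a) • e i i a) + hamiltonian e z c 0 := by
  rw [hamiltonian, hamiltonian, ← add_assoc]
  congr 1
  simp only [Pi.zero_apply, mul_zero, zero_smul, Finset.sum_const_zero, add_zero, Finset.smul_sum,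
    smul_smul]
  rw [Finset.sum_comm]
  refine Finset.sum_congr rfl fun i _ => Finset.sum_congr rfl fun a _ => ?_
  congr 1
  ring

theorem hamiltonian_one {A : Type*} [Ring A] [Algebra ℂ A] (e : Fin M → Fin M → Fin N → A)
    (z : Fin N → ℂ) (i : Fin M) :
    hamiltonian e z 1 (Pi.single i 1) = (2 : ℂ) • ∑ a, e i i a := by
  rw [hamiltonian_eq_sum, Finset.sum_eq_single i]
  · simp [hamiltonian, Finset.smul_sum]
  · intro j _ hj
    simp [hj]
  · simp

variable (n : Fin N → ℕ)

instance : FiniteDimensional ℂ (SymTensor M n) := Module.Finite.of_basis (tensorBasis n)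

theorem commute_tensorAction_E_self (i j : Fin M) (a b : Fin N) :
    Commute (tensorAction M n (E M N i i a)) (tensorAction M n (E M N j j b)) := by
  refine (tensorBasis n).ext fun k => ?_
  simp only [Module.End.mul_apply, tensorAction_E_self_tensorBasis, map_smul]
  rw [smul_comm]

/-- The weight operator is itself half a Hamiltonian, with all c_a = 1 and λ the i-th unit vector.
So it commutes with the transfer matrices at that λ, hence with the Hamiltonian for any c at that λ.
Changing λ only alters the diagonal part, with which the weight operator commutes anyway. -/
theorem commute_tensorAction_weight_hamiltonian (hM : 2 ≤ M) {z : Fin N → ℂ}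
    (hz : Function.Injective z) (c : Fin N → ℂ) (lam : Fin M → ℂ) (i : Fin M) :
    Commute (tensorAction M n (∑ a, E M N i i a))
      (tensorAction M n (hamiltonian (E M N) z c lam)) := by
  have hdiag (lam : Fin M → ℂ) : Commute (tensorAction M n (∑ a, E M N i i a))
      (∑ j, lam j • ∑ a, (2 * c a) • tensorAction M n (E M N j j a)) := by
    rw [map_sum]
    exact Commute.sum_left _ _ _ fun a _ => Commute.sum_right _ _ _ fun j _ =>
      Commute.smul_right (Commute.sum_right _ _ _ fun b _ =>
        (commute_tensorAction_E_self n i j a b).smul_right _) _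
  obtain ⟨l, hl⟩ := exists_functional_inv_X_sub_C hz c
  obtain ⟨t, ht⟩ := tensorAction_centralPart n z c (Pi.single i 1 : Fin M → ℂ) (l 1)
  have h2 := two_smul_tensorAction_transferCoeff_two n z hz hM c (Pi.single i 1) l hl
  have h1 : Commute (tensorAction M n (∑ a, E M N i i a))
      (tensorAction M n (hamiltonian (E M N) z c (Pi.single i 1))) := by
    have h := commute_tensorAction_transferCoeff n z hz 1 (Pi.single i 1 : Fin M → ℂ) l 2
    rw [hamiltonian_one, map_smul] at h
    have h' : Commute (tensorAction M n (∑ a, E M N i i a))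
        (tensorAction M n (transferCoeff (E M N) z (Pi.single i 1) l 2)) := by
      have := (Commute.smul_right_iff₀ (two_ne_zero (α := ℂ))).1 (show Commute _ _ from h)
      exact this.symm
    have h3 : tensorAction M n (hamiltonian (E M N) z c (Pi.single i 1)) = t • 1 -
        (2 : ℂ) • tensorAction M n (transferCoeff (E M N) z (Pi.single i 1) l 2) := by
      rw [h2, ht, sub_sub_cancel]
    rw [h3]
    exact ((Commute.one_right _).smul_right t).sub_right (h'.smul_right 2)
  have hsum (lam : Fin M → ℂ) : tensorAction M n (hamiltonian (E M N) z c lam) =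
      ∑ j, lam j • ∑ a, (2 * c a) • tensorAction M n (E M N j j a) +
        tensorAction M n (hamiltonian (E M N) z c 0) := by
    rw [hamiltonian_eq_sum]
    simp only [map_add, map_sum, map_smul]
  rw [hsum] at h1 ⊢
  refine (hdiag lam).add_right ?_
  have h := h1.sub_right (hdiag (Pi.single i 1))
  rwa [add_sub_cancel_left] at h

theorem toMatrix_eq_diagonal {ι V : Type*} [Fintype ι] [DecidableEq ι] [AddCommGroup V]
    [Module ℂ V] (b : Module.Basis ι ℂ V) {f : Module.End ℂ V} {d : ι → ℂ}
    (h : ∀ k, f (b k) = d k • b k) : LinearMap.toMatrix b b f = Matrix.diagonal d := by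
  ext i j
  rcases eq_or_ne i j with rfl | hij
  · simp [LinearMap.toMatrix_apply, h]
  · simp [LinearMap.toMatrix_apply, h, hij, Finsupp.single_eq_of_ne]

/-- In the monomial basis the Hamiltonian is a linear family of diagonal matrices in λ plus a
constant matrix, the situation of `exists_polynomial_separable_charpoly`. -/
theorem exists_polynomial_separable_hamiltonian (M : ℕ) {N : ℕ} (n : Fin N → ℕ) (z : Fin N → ℂ) :
    ∃ (c : Fin N → ℂ) (P : MvPolynomial (Fin M) ℂ), P ≠ 0 ∧
      ∀ lam : Fin M → ℂ, MvPolynomial.eval lam P ≠ 0 →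
        (tensorAction M n (hamiltonian (E M N) z c lam)).charpoly.Separable := by
  classical
  obtain ⟨c, mu, hd⟩ := exists_injective_weight_sum M n
  let b := tensorBasis (M := M) n
  let f (i : Fin M) : Module.End ℂ (SymTensor M n) :=
    ∑ a, (2 * c a) • tensorAction M n (E M N i i a)
  have hf (i : Fin M) (k : TensorIndex M n) :
      f i (b k) = (∑ a, 2 * c a * ((k a).1 i : ℂ)) • b k := by
    simp only [f, LinearMap.sum_apply, LinearMap.smul_apply, b, tensorAction_E_self_tensorBasis,
      smul_smul, Finset.sum_smul]
  obtain ⟨P, hP, h⟩ := exists_polynomial_separable_charpoly (fun i => LinearMap.toMatrix b b (f i))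
    (LinearMap.toMatrix b b (tensorAction M n (hamiltonian (E M N) z c 0))) mu _ hd (by
      rw [← toMatrix_eq_diagonal b (f := ∑ i, mu i • f i)]
      · simp only [map_sum, map_smul]
      · intro k
        simp only [LinearMap.sum_apply, LinearMap.smul_apply, hf, smul_smul]
        rw [Finset.sum_smul])
  refine ⟨c, P, hP, fun lam hlam => ?_⟩
  have h1 := h lam hlam
  have h2 : ∑ i, lam i • LinearMap.toMatrix b b (f i) +
      LinearMap.toMatrix b b (tensorAction M n (hamiltonian (E M N) z c 0)) =
      LinearMap.toMatrix b b (tensorAction M n (hamiltonian (E M N) z c lam)) := by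
    rw [hamiltonian_eq_sum _ _ _ lam]
    simp only [map_add, map_sum, map_smul, f]
  rwa [h2, LinearMap.charpoly_toMatrix] at h1

theorem mem_weightSpace_iff {m : Fin M → ℕ} {v : SymTensor M n} :
    v ∈ weightSpace M n m ↔ ∀ i, tensorAction M n (∑ a, E M N i i a) v = (m i : ℂ) • v := by
  simp [weightSpace, Submodule.mem_iInf, LinearMap.mem_eqLocus]

end BetheGaudin

end

noncomputable section

namespace BetheGaudin

/-! ### Simplicity of the joint spectrum of the Bethe subalgebra -/

variable {M N : ℕ} (n : Fin N → ℕ)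

/-- A weight vector can only involve basis vectors whose eigenvalues under all weight operators are
its own. -/
theorem mem_weightSpace_of_repr_ne_zero {κ : Type*} (m : Fin M → ℕ)
    (v : Module.Basis κ ℂ (SymTensor M n))
    (hv : ∀ i k, ∃ c : ℂ, tensorAction M n (∑ a, E M N i i a) (v k) = c • v k)
    (w : SymTensor M n) (hw : w ∈ weightSpace M n m) (k : κ) (hk : v.repr w k ≠ 0) :
    v k ∈ weightSpace M n m := by
  choose c hc using hv
  rw [mem_weightSpace_iff] at hw ⊢
  intro i
  have h := repr_apply_of_eigenbasis (hc i) w k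
  rw [hw i, map_smul, Finsupp.smul_apply, smul_eq_mul] at h
  rw [hc i k, mul_right_cancel₀ hk h]

/-- With at most one variable each L_{n_a} has at most one monomial, so there is nothing to
separate. Here no second transfer matrix is available as a generator. -/
theorem hasSimpleJointSpectrum_of_le_one (hM : M ≤ 1) (S : Subalgebra ℂ (UGlTensor M N))
    (m : Fin M → ℕ) :
    HasSimpleJointSpectrum (tensorAction M n) S (weightSpace M n m) := by
  have hs : Subsingleton (Fin M) := Fin.subsingleton_iff_le_one.2 hM
  have hsub : Subsingleton (TensorIndex M n) := by
    refine ⟨fun k k' => ?_⟩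
    ext a i
    have h := (k a).2.trans (k' a).2.symm
    rw [Finsupp.degree_eq_sum, Finsupp.degree_eq_sum, Fintype.sum_subsingleton _ i,
      Fintype.sum_subsingleton _ i] at h
    exact h
  have hsmul (f : Module.End ℂ (SymTensor M n)) (k : TensorIndex M n) :
      ∃ c : ℂ, f (tensorBasis n k) = c • tensorBasis n k := by
    refine ⟨(tensorBasis n).repr (f (tensorBasis n k)) k, (tensorBasis n).ext_elem fun j => ?_⟩
    rw [Subsingleton.elim j k]
    simp
  exact hasSimpleJointSpectrum_of_basis _ _ _ (tensorBasis n) (fun _ _ => hsmul _)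
    (mem_weightSpace_of_repr_ne_zero n m _ fun _ => hsmul _)
    fun k k' h => (h (Subsingleton.elim k k')).elim

theorem hasSimpleJointSpectrum_of_separable (hM : 2 ≤ M) {z : Fin N → ℂ}
    (hz : Function.Injective z) (m : Fin M → ℕ) (c : Fin N → ℂ) (lam : Fin M → ℂ)
    (h : (tensorAction M n (hamiltonian (E M N) z c lam)).charpoly.Separable) :
    HasSimpleJointSpectrum (tensorAction M n) (betheSubalgebra M N z lam) (weightSpace M n m) := by
  obtain ⟨v, t, ht, hv⟩ := exists_eigenbasis h
  have hcomm : ∀ s ∈ betheSubalgebra M N z lam, Commute (tensorAction M n s)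
      (tensorAction M n (hamiltonian (E M N) z c lam)) := by
    intro s hs
    rw [betheSubalgebra, transferSubalgebra_eq_adjoin] at hs
    induction hs using Algebra.adjoin_induction with
    | mem s hs =>
      obtain ⟨i, -, l, rfl⟩ := hs
      exact commute_tensorAction_transferCoeff n z hz c lam l i
    | algebraMap r =>
      rw [AlgHom.commutes]
      exact Algebra.commutes r _
    | add s s' _ _ hs hs' =>
      rw [map_add]
      exact hs.add_left hs'
    | mul s s' _ _ hs hs' =>
      rw [map_mul]
      exact hs.mul_left hs'
  refine hasSimpleJointSpectrum_of_basis _ _ _ v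
    (fun s hs => exists_smul_of_commute ht hv (hcomm s hs))
    (mem_weightSpace_of_repr_ne_zero n m v fun i => exists_smul_of_commute ht hv
      (commute_tensorAction_weight_hamiltonian n hM hz c lam i)) fun k k' hk => ?_
  obtain ⟨l, hl⟩ := exists_functional_inv_X_sub_C hz c
  obtain ⟨r, hr⟩ := tensorAction_centralPart n z c lam (l 1)
  have h2 := two_smul_tensorAction_transferCoeff_two n z hz hM c lam l hl
  rw [hr] at h2
  -- On L_n this generator is (r - H) / 2, so its eigenvalue x on v_k determines the eigenvalue t_k
  -- = r - 2 x of H, and the t_k are distinct.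
  refine ⟨transferCoeff (E M N) z lam l 2, ?_, fun x hx hx' => hk (ht ?_)⟩
  · rw [betheSubalgebra, transferSubalgebra_eq_adjoin]
    exact Algebra.subset_adjoin ⟨2, Finset.mem_Icc.2 ⟨one_le_two, hM⟩, l, rfl⟩
  · have key {k : Fin (Module.finrank ℂ (SymTensor M n))}
        (hx : tensorAction M n (transferCoeff (E M N) z lam l 2) (v k) = x • v k) :
        t k = r - 2 * x := by
      have h3 := LinearMap.congr_fun h2 (v k)
      rw [LinearMap.smul_apply, hx, LinearMap.sub_apply, LinearMap.smul_apply,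
        Module.End.one_apply, hv, smul_smul, ← sub_smul] at h3
      rw [smul_left_injective ℂ (v.ne_zero k) h3, sub_sub_cancel]
    rw [key hx, key hx']

end BetheGaudin

end

theorem proposition3p3 (M N : ℕ) (z : Fin N → ℂ) (hz : Function.Injective z)
    (n : Fin N → ℕ) (m : Fin M → ℕ) (hnm : ∑ a, n a = ∑ i, m i) :
    ∃ P : MvPolynomial (Fin M) ℂ, P ≠ 0 ∧
      ∀ lam : Fin M → ℂ, Function.Injective lam → MvPolynomial.eval lam P ≠ 0 →
        BetheGaudin.HasSimpleJointSpectrum (BetheGaudin.tensorAction M n)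
          (BetheGaudin.betheSubalgebra M N z lam) (BetheGaudin.weightSpace M n m) := by
  obtain hM | hM := Nat.lt_or_ge 1 M
  · obtain ⟨c, P, hP, h⟩ := BetheGaudin.exists_polynomial_separable_hamiltonian M n z
    exact ⟨P, hP, fun lam _ hlam =>
      BetheGaudin.hasSimpleJointSpectrum_of_separable n hM hz m c lam (h lam hlam)⟩
  · exact ⟨1, one_ne_zero, fun lam _ _ =>
      BetheGaudin.hasSimpleJointSpectrum_of_le_one n hM _ m⟩
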